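/- Let $a,b,c,d\in\mathbb{R}$ and consider the two-dimensional $(abcd)$-Boussinesq system for $\eta(t,x)\in\mathbb{R}$ and $\vec u(t,x)=(u_1,u_2)(t,x)\in\mathbb{R}^2$, $x\in\mathbb{R}^2$, $$(1-b\Delta)\partial_t\eta+\nabla\cdot\big(a\Delta\vec u+\vec u+\eta\,\vec u\big)=0,\qquad (1-d\Delta)\partial_t\vec u+\nabla\Big(c\Delta\eta+\eta+\tfrac12|\vec u|^2\Big)=0,$$ with irrotational velocity, $\partial_1u_2-\partial_2u_1=0$. A solution on $[0,T]$ is a classical solution $\vec v=(\eta,u_1,u_2)$ that belongs to $C([0,T];H^\sigma(\mathbb{R}^2)^3)$ for every $\sigma\in\mathbb{R}$. The flow map sends $\vec v_0$ to $\vec v$ if $\vec v$ is the unique such solution on its time interval with $\vec v(0)=\vec v_0$. The system is ill-posed, in the sense that the flow map from initial data to solutions is discontinuous at the origin in $H^s(\mathbb{R}^2)^3$, in each of the following cases: 1. $s<-\frac12$, in the generic regime $a,c<0$, $b,d>0$; 2. $s<-\frac32$, in the KdV-KdV regime $a=c=\frac16$, $b=d=0$; 3. $s<0$, in the BBM-BBM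 regime $a=c=0$, $b=d=\frac16$. In cases 1 and 3, discontinuity means: for every $T>0$ there is $\varepsilon>0$ such that for every $\delta>0$ the flow map is defined up to time $T$ at some $\vec v_0$ with $\|\vec v_0\|_{H^s}<\delta$, and the solution $\vec v$ on $[0,T]$ satisfies $\|\vec v(t)\|_{H^s}\ge\varepsilon$ for some $t\in[0,T]$; that is, $\vec v_0\mapsto\vec v$ is discontinuous at $0$ from $H^s$ to $C([0,T];H^s)$. In case 2 the lifespan may depend on the datum, and discontinuity means: there is $\varepsilon>0$ such that for all $T,\delta>0$ there is $T_1\in(0,T]$ such that the flow map is defined up to time $T_1$ at some $\vec v_0$ with $\|\vec v_0\|_{H^s}<\delta$, and $\|\vec v(t)\|_{H^s}\ge\varepsilon$ for some $t\in[0,T_1]$; that is, the local flow map $(t,\vec v_0)\mapsto\vec v(t)$ is discontinuous at $(0,0)$ in the topology of $H^s$. -/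

import Mathlib

open MeasureTheory Filter Topology Set
open scoped FourierTransform Laplacian ContDiff ENNReal

noncomputable section

namespace Boussinesq

/-- The Euclidean plane. -/
abbrev Plane : Type := EuclideanSpace ℝ (Fin 2)

/-- The divergence of a vector field on the plane. -/
def divergence (w : Plane → Plane) (x : Plane) : ℝ :=
  ∑ i : Fin 2, fderiv ℝ w x (EuclideanSpace.single i 1) i

/-- The scalar curl of a vector field on the plane, `∂₁ w₂ - ∂₂ w₁`. -/
def curl (w : Plane → Plane) (x : Plane) : ℝ :=
  fderiv ℝ w x (EuclideanSpace.single 0 1) 1 - fderiv ℝ w x (EuclideanSpace.single 1 1) 0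

open Classical in
/-- The norm of a real-valued square integrable function `f` in the Sobolev space `H^s`, for any
real `s` (negative ones included): the `L²` norm of `(1 + |ζ|²)^(s/2)` times the Fourier transform
of `f` (the one on `L²`, by Plancherel). The frequency is `ζ = 2πξ`, because Mathlib's
transform has the kernel `exp(-2πi x·ξ)`. The value is `∞` if this `L²` norm is infinite,
or if `f` is not in `L²`. -/
def sobolevNorm (s : ℝ) (f : Plane → ℝ) : ℝ≥0∞ :=
  if hf : MemLp (fun x => (f x : ℂ)) 2 (volume : Measure Plane) then
    eLpNorm (fun ξ : Plane =>
      (((1 + (2 * Real.pi * ‖ξ‖) ^ 2) ^ (s / 2) : ℝ) : ℂ) * (𝓕 (hf.toLp) : Lp ℂ 2 volume) ξ)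
      2 volume
  else ⊤

/-- A state of the system: the elevation `η` and the velocity `u = (u₁, u₂)`. -/
abbrev State : Type := (Plane → ℝ) × (Plane → Plane)

/-- The norm of a state `(η, u₁, u₂)` in `H^s × H^s × H^s`. -/
def State.sobolevNorm (s : ℝ) (v : State) : ℝ≥0∞ :=
  Boussinesq.sobolevNorm s v.1 + ∑ i : Fin 2, Boussinesq.sobolevNorm s (fun x => v.2 x i)

/-- `v : [0,T] → (H^∞)³` is a solution of the two-dimensional (abcd)-Boussinesq system
`(1 - bΔ) ∂ₜη + ∇·(aΔu + u + ηu) = 0`, `(1 - dΔ) ∂ₜu + ∇(cΔη + η + |u|²/2) = 0`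
in `C([0,T]; H^σ)` for all `σ`, with irrotational velocity. The equations hold
pointwise, for each `t` in `[0,T]` (with one-sided time derivatives at the endpoints).
The values of `v` outside `[0,T]` play no role. -/
structure IsSolution (a b c d T : ℝ) (v : ℝ → State) : Prop where
  /-- each state is smooth in space -/
  contDiff_eta : ∀ t ∈ Icc 0 T, ContDiff ℝ ∞ (v t).1
  contDiff_u : ∀ t ∈ Icc 0 T, ContDiff ℝ ∞ (v t).2
  /-- each state belongs to `H^σ` for all `σ` -/
  finite : ∀ σ : ℝ, ∀ t ∈ Icc 0 T, State.sobolevNorm σ (v t) < ⊤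
  /-- `v` is continuous in time with values in `H^σ`, for all `σ` -/
  continuous : ∀ σ : ℝ, ∀ t ∈ Icc 0 T,
    Tendsto (fun τ => State.sobolevNorm σ (v τ - v t)) (𝓝[Icc 0 T] t) (𝓝 0)
  /-- the velocity is irrotational -/
  irrotational : ∀ t ∈ Icc 0 T, ∀ x, curl (v t).2 x = 0
  /-- the equation of mass -/
  eq_eta : ∀ t ∈ Icc 0 T, ∀ x,
    HasDerivWithinAt (fun τ => (v τ).1 x - b * Δ (v τ).1 x)
      (-divergence (fun y => a • Δ (v t).2 y + (v t).2 y + (v t).1 y • (v t).2 y) x)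
      (Icc 0 T) t
  /-- the equation of momentum -/
  eq_u : ∀ t ∈ Icc 0 T, ∀ x,
    HasDerivWithinAt (fun τ => (v τ).2 x - d • Δ (v τ).2 x)
      (-gradient (fun y => c * Δ (v t).1 y + (v t).1 y + 1 / 2 * ‖(v t).2 y‖ ^ 2) x)
      (Icc 0 T) t

/-- The flow map is defined at the initial state `v₀` up to time `T`, and maps it to `v`: on
`[0,T]`, `v` is the one and only solution with initial state `v₀`. -/
structure IsFlow (a b c d T : ℝ) (v₀ : State) (v : ℝ → State) : Prop where
  isSolution : IsSolution a b c d T v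
  initial : v 0 = v₀
  unique : ∀ w : ℝ → State, IsSolution a b c d T w → w 0 = v₀ → EqOn w v (Icc 0 T)

/-- The flow map `v₀ ↦ v` from initial states (with a solution on `[0,T]`) to solutions on `[0,T]`
is discontinuous at the origin, for the norm of `H^s` on initial states and that of
`C([0,T]; H^s)` on solutions. -/
def FlowDiscontinuousOn (a b c d s T : ℝ) : Prop :=
  ∃ ε : ℝ≥0∞, 0 < ε ∧ ∀ δ : ℝ≥0∞, 0 < δ →
    ∃ (v₀ : State) (v : ℝ → State), IsFlow a b c d T v₀ v ∧
      State.sobolevNorm s v₀ < δ ∧ ∃ t ∈ Icc 0 T, ε ≤ State.sobolevNorm s (v t)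

/-- The local flow map `(t, v₀) ↦ v t`, defined where the solution with initial state `v₀` exists
up to time `t`, is discontinuous at the origin for the norm of `H^s`: in every neighbourhood of the
zero state and after arbitrarily short times, its values do not stay close to zero. Here the
lifespan of the solutions is allowed to depend on the initial state. -/
def LocalFlowDiscontinuous (a b c d s : ℝ) : Prop :=
  ∃ ε : ℝ≥0∞, 0 < ε ∧ ∀ T : ℝ, 0 < T → ∀ δ : ℝ≥0∞, 0 < δ →
    ∃ T₁ ∈ Ioc 0 T, ∃ (v₀ : State) (v : ℝ → State), IsFlow a b c d T₁ v₀ v ∧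
      State.sobolevNorm s v₀ < δ ∧ ∃ t ∈ Icc 0 T₁, ε ≤ State.sobolevNorm s (v t)

end Boussinesq

end

/-! The instability is a high-to-low frequency cascade. The datum is a wave packet: its transform is
a bump of height `A` and radius `1` at frequency `N`, so its `H^s` norm is of order `A * N ^ s`. The
square of the velocity contains the product of the packet with its mirror image at `-N`, which lives
at frequencies of order one and drives the velocity there. After a time `t` the low frequencies have
size comparable to `A ^ 2 * t`, and every `H^s` norm sees them. If `A * N ^ s` tends to zero while
`A ^ 2 * t` stays fixed, the flow is discontinuous at the origin.

Since the velocity is irrotational, its transform is parallel to the frequency, and the system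
becomes one scalar equation on the Fourier side, `∂ₜ y = -i lam y + nonlin y`. Its two linear waves
are `y` and its conjugate reflection (`IsDispersion.eta_identity`, `IsDispersion.vel_identity`). The
profile `z = exp(i lam t) y` solves a purely quadratic equation, which is expanded in powers of the
datum. The n-th term is dominated by sums of n-fold convolutions of the datum, counted by Catalan
numbers. As the datum has compactly supported transform, a derivative in the nonlinearity costs only
a factor linear in `n`, and the time integration gives it back (`Controls.iter_majorizedBy`). The
series therefore converges on a time interval and yields smooth solutions, even for KdV-KdV, where
the nonlinearity loses a derivative.

The quadratic term has a definite sign as long as the phases `lam` on the packet differ by at most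
`1 / t`: opposite frequencies have opposite directions, so no cancellation occurs
(`re_sum_velHat_ge`). The higher terms are smaller by the ratio `θ` of the series
(`norm_sol_sub_le`). Together these give `exists_norm_velHat_ge`.

In the generic and BBM-BBM regimes the multiplier `|ξ| / (1 + b |ξ|²)` is bounded and `lam` varies
boundedly over the packet. So `A` and `t` are fixed, only `N` tends to infinity, and every `s < 0`
is covered, in particular `s < -1 / 2`. In the KdV-KdV regime `lam` is of order `N ^ 3` and the
multiplier of order `N`; the choice `A = N ^ (3 / 2)`, `t = k / N ^ 3` keeps `A ^ 2 * t` fixed,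
makes `θ` of order `N ^ (-1 / 2)` and needs `s < -3 / 2`.

The definition of the flow also requires uniqueness, which is proved by energy estimates for the
difference of two solutions (`eq_zero_of_regularized`, `eq_zero_of_unregularized`). -/

noncomputable section

/-! ### Sobolev weights, rapidly decreasing functions and their convolutions -/

namespace Boussinesq

/-- The Sobolev weight `(1 + |2πξ|²)^(s/2)`. -/
def weight (s : ℝ) (ξ : Plane) : ℝ := (1 + (2 * Real.pi * ‖ξ‖) ^ 2) ^ (s / 2)

lemma one_le_bracket (ξ : Plane) : 1 ≤ 1 + (2 * Real.pi * ‖ξ‖) ^ 2 := by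
  nlinarith [sq_nonneg (2 * Real.pi * ‖ξ‖)]

lemma bracket_pos (ξ : Plane) : 0 < 1 + (2 * Real.pi * ‖ξ‖) ^ 2 :=
  lt_of_lt_of_le one_pos (one_le_bracket ξ)

lemma weight_pos (s : ℝ) (ξ : Plane) : 0 < weight s ξ := Real.rpow_pos_of_pos (bracket_pos ξ) _

lemma weight_nonneg (s : ℝ) (ξ : Plane) : 0 ≤ weight s ξ := (weight_pos s ξ).le

lemma weight_add (s t : ℝ) (ξ : Plane) : weight (s + t) ξ = weight s ξ * weight t ξ := by
  rw [weight, add_div, Real.rpow_add (bracket_pos ξ)]; rfl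

@[simp] lemma weight_zero (ξ : Plane) : weight 0 ξ = 1 := by simp [weight]

lemma weight_neg (s : ℝ) (ξ : Plane) : weight (-s) ξ = (weight s ξ)⁻¹ := by
  have := weight_add s (-s) ξ
  rw [add_neg_cancel, weight_zero] at this
  exact eq_inv_of_mul_eq_one_right this.symm

lemma weight_two (ξ : Plane) : weight 2 ξ = 1 + (2 * Real.pi * ‖ξ‖) ^ 2 := by
  simp [weight]

lemma weight_mono {s t : ℝ} (h : s ≤ t) (ξ : Plane) : weight s ξ ≤ weight t ξ :=
  Real.rpow_le_rpow_of_exponent_le (one_le_bracket ξ) (by linarith)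

lemma continuous_weight (s : ℝ) : Continuous (weight s) := by
  unfold weight
  exact Continuous.rpow_const (by fun_prop) fun ξ => Or.inl (bracket_pos ξ).ne'

lemma freq_le_weight_one (ξ : Plane) : 2 * Real.pi * ‖ξ‖ ≤ weight 1 ξ := by
  rw [weight, ← Real.sqrt_eq_rpow]
  exact Real.le_sqrt_of_sq_le (by linarith)

lemma norm_le_weight_one (ξ : Plane) : ‖ξ‖ ≤ weight 1 ξ := by
  refine le_trans ?_ (freq_le_weight_one ξ)
  nlinarith [Real.pi_gt_three, norm_nonneg ξ]

/-- Peetre's inequality: with `a = 2π‖ξ - ζ‖` and `b = 2π‖ζ‖`, the triangle inequality and `(a + b)²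
≤ 2a² + 2b²` suffice. -/
lemma bracket_le_mul (ξ ζ : Plane) :
    1 + (2 * Real.pi * ‖ξ‖) ^ 2 ≤
      2 * (1 + (2 * Real.pi * ‖ξ - ζ‖) ^ 2) * (1 + (2 * Real.pi * ‖ζ‖) ^ 2) := by
  have h : ‖ξ‖ ≤ ‖ξ - ζ‖ + ‖ζ‖ := by simpa using norm_add_le (ξ - ζ) ζ
  have h2 : 2 * Real.pi * ‖ξ‖ ≤ 2 * Real.pi * ‖ξ - ζ‖ + 2 * Real.pi * ‖ζ‖ := by
    rw [← mul_add]; gcongr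
  have h0 : 0 ≤ 2 * Real.pi * ‖ξ‖ := by positivity
  set a := 2 * Real.pi * ‖ξ - ζ‖
  set b := 2 * Real.pi * ‖ζ‖
  have h3 : (2 * Real.pi * ‖ξ‖) ^ 2 ≤ (a + b) ^ 2 := by gcongr
  nlinarith [sq_nonneg (a - b), sq_nonneg (a * b)]

lemma weight_le_mul {s : ℝ} (hs : 0 ≤ s) (ξ ζ : Plane) :
    weight s ξ ≤ 2 ^ (s / 2) * (weight s (ξ - ζ) * weight s ζ) := by
  unfold weight
  rw [← Real.mul_rpow (bracket_pos _).le (bracket_pos _).le,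
    ← Real.mul_rpow two_pos.le (mul_pos (bracket_pos _) (bracket_pos _)).le, ← mul_assoc]
  exact Real.rpow_le_rpow (bracket_pos _).le (bracket_le_mul ξ ζ) (by linarith)

/-- The dimension enters here: decay of order four exceeds two. Hence `weight (-2)` is square
integrable, and a margin of two derivatives pays for every passage between sup, `L¹` and `L²` bounds
below. -/
lemma integrable_weight_neg_four : Integrable (weight (-4)) (volume : Measure Plane) := by
  have h : Integrable (fun x : Plane => (1 + ‖x‖) ^ (-4 : ℝ)) volume :=
    integrable_one_add_norm (by simp; norm_num)
  refine (h.const_mul 4).mono' (continuous_weight _).aestronglyMeasurable (ae_of_all _ fun ξ => ?_)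
  rw [Real.norm_of_nonneg (weight_nonneg _ _), weight]
  have h1 : (1 + ‖ξ‖) ^ 2 ≤ 2 * (1 + (2 * Real.pi * ‖ξ‖) ^ 2) := by
    have : ‖ξ‖ ^ 2 ≤ (2 * Real.pi * ‖ξ‖) ^ 2 := by
      have : ‖ξ‖ ≤ 2 * Real.pi * ‖ξ‖ := by nlinarith [Real.pi_gt_three, norm_nonneg ξ]
      gcongr
    nlinarith [sq_nonneg (1 - ‖ξ‖)]
  have h2 : (0 : ℝ) < 1 + ‖ξ‖ := by positivity
  rw [show (-4 : ℝ) / 2 = -(2 : ℕ) by norm_num, show (-4 : ℝ) = -(4 : ℕ) by norm_num,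
    Real.rpow_neg (bracket_pos _).le, Real.rpow_neg h2.le, Real.rpow_natCast, Real.rpow_natCast,
    ← div_eq_mul_inv, inv_le_iff_one_le_mul₀ (pow_pos (bracket_pos _) 2),
    div_mul_eq_mul_div, le_div_iff₀ (by positivity)]
  nlinarith [pow_pos h2 2]

lemma memLp_weight_neg_two : MemLp (weight (-2)) 2 (volume : Measure Plane) := by
  rw [memLp_two_iff_integrable_sq (continuous_weight _).aestronglyMeasurable]
  refine integrable_weight_neg_four.congr (ae_of_all _ fun ξ => ?_)
  simp only [sq, ← weight_add]; norm_num

/-- Functions all of whose Sobolev-weighted `L²` norms are finite. -/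
def Rapid (g : Plane → ℂ) : Prop :=
  ∀ s : ℝ, MemLp (fun ξ => (weight s ξ : ℂ) * g ξ) 2 (volume : Measure Plane)

lemma norm_weight_mul (s : ℝ) (g : Plane → ℂ) (ξ : Plane) :
    ‖(weight s ξ : ℂ) * g ξ‖ = weight s ξ * ‖g ξ‖ := by
  rw [norm_mul, Complex.norm_real, Real.norm_of_nonneg (weight_nonneg _ _)]

namespace Rapid

variable {f g : Plane → ℂ}

lemma memLp (hg : Rapid g) : MemLp g 2 volume := by
  simpa using hg 0

lemma aesm (hg : Rapid g) : AEStronglyMeasurable g volume := hg.memLp.1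

/-- Any polynomial growth of order `k` is absorbed by replacing `s` with `s + k`, because all
exponents are available. -/
lemma mono (hg : Rapid g) (hf : AEStronglyMeasurable f volume) {C k : ℝ}
    (h : ∀ ξ, ‖f ξ‖ ≤ C * (weight k ξ * ‖g ξ‖)) : Rapid f := fun s => by
  refine MemLp.of_le_mul (hg (s + k)) (c := C)
    ((Complex.continuous_ofReal.comp (continuous_weight s)).aestronglyMeasurable.mul hf)
    (ae_of_all _ fun ξ => ?_)
  rw [norm_weight_mul, norm_weight_mul, weight_add]
  calc weight s ξ * ‖f ξ‖ ≤ weight s ξ * (C * (weight k ξ * ‖g ξ‖)) := by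
        gcongr
        · exact weight_nonneg _ _
        · exact h ξ
    _ = _ := by ring

lemma add (hf : Rapid f) (hg : Rapid g) : Rapid (fun ξ => f ξ + g ξ) := fun s => by
  simp only [mul_add]; exact (hf s).add (hg s)

lemma const_mul (hg : Rapid g) (c : ℂ) : Rapid (fun ξ => c * g ξ) :=
  hg.mono (hg.aesm.const_mul c) (C := ‖c‖) (k := 0) fun ξ => by simp

/-- Cauchy–Schwarz against `weight (-2)`. -/
lemma integrable_weight (hg : Rapid g) (s : ℝ) :
    Integrable (fun ξ => (weight s ξ : ℂ) * g ξ) volume := by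
  have h1 : MemLp (fun ξ => (weight (-2) ξ : ℂ)) 2 (volume : Measure Plane) :=
    memLp_weight_neg_two.ofReal
  have h := (hg (s + 2)).integrable_mul h1
  refine h.congr (ae_of_all _ fun ξ => ?_)
  simp only [Pi.mul_apply]
  rw [weight_add, weight_neg]
  have : (weight 2 ξ : ℂ) ≠ 0 := by exact_mod_cast (weight_pos 2 ξ).ne'
  push_cast
  field_simp

lemma integrable (hg : Rapid g) : Integrable g volume := by simpa using hg.integrable_weight 0

lemma integrable_pow (hg : Rapid g) (n : ℕ) : Integrable (fun ξ => ‖ξ‖ ^ n * ‖g ξ‖) volume := by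
  refine (hg.integrable_weight n).norm.mono'
    ((continuous_norm.pow n).aestronglyMeasurable.mul hg.aesm.norm) (ae_of_all _ fun ξ => ?_)
  rw [norm_weight_mul, Real.norm_of_nonneg (by positivity)]
  gcongr
  have : weight n ξ = weight 1 ξ ^ n := by
    rw [weight, weight, ← Real.rpow_mul_natCast (bracket_pos _).le]; congr 1; ring
  rw [this]
  exact pow_le_pow_left₀ (norm_nonneg _) (norm_le_weight_one ξ) n

end Rapid

/-- Convolution of complex functions on the plane. -/
def conv (f g : Plane → ℂ) (ξ : Plane) : ℂ := ∫ ζ, f (ξ - ζ) * g ζ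

lemma conv_eq_convolution (f g : Plane → ℂ) :
    conv f g = convolution f g (ContinuousLinearMap.mul ℂ ℂ) volume := by
  funext ξ
  rw [convolution_eq_swap]; rfl

lemma measurePreserving_const_sub (ξ : Plane) :
    MeasurePreserving (fun ζ : Plane => ξ - ζ) volume volume :=
  Measure.measurePreserving_sub_left volume ξ

lemma integrable_conv_integrand {f g : Plane → ℂ} (hf : MemLp f 2 volume) (hg : MemLp g 2 volume)
    (ξ : Plane) : Integrable (fun ζ => f (ξ - ζ) * g ζ) volume :=
  (hf.comp_measurePreserving (measurePreserving_const_sub ξ)).integrable_mul hg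

lemma conv_conj_neg {f g : Plane → ℂ} (hf : ∀ ξ, f (-ξ) = starRingEnd ℂ (f ξ))
    (hg : ∀ ξ, g (-ξ) = starRingEnd ℂ (g ξ)) (ξ : Plane) :
    conv f g (-ξ) = starRingEnd ℂ (conv f g ξ) := by
  unfold conv
  rw [← integral_conj, ← integral_neg_eq_self]
  congr 1; funext ζ
  rw [map_mul, ← hf, ← hg]; congr 2; abel

lemma norm_conv_le {f g : Plane → ℂ} (hf : MemLp f 2 volume) (hg : MemLp g 2 volume)
    (ξ : Plane) : ‖conv f g ξ‖ ≤ (eLpNorm f 2 volume * eLpNorm g 2 volume).toReal := by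
  have h1 := hf.comp_measurePreserving (measurePreserving_const_sub ξ)
  have h3 : eLpNorm (fun ζ => f (ξ - ζ)) 2 volume = eLpNorm f 2 volume :=
    eLpNorm_comp_measurePreserving hf.1 (measurePreserving_const_sub ξ)
  have h2 := eLpNorm_le_eLpNorm_mul_eLpNorm_of_nnnorm (p := 2) (q := 2) (r := 1) h1.1 hg.1
    (fun a b : ℂ => a * b) 1 (ae_of_all _ fun x => by simp)
  simp only [Function.comp_def] at h2 h1
  rw [h3, ENNReal.coe_one, one_mul] at h2
  refine (norm_integral_le_integral_norm _).trans ?_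
  rw [integral_norm_eq_lintegral_enorm (integrable_conv_integrand hf hg ξ).1,
    ← eLpNorm_one_eq_lintegral_enorm]
  exact ENNReal.toReal_mono (ENNReal.mul_ne_top hf.2.ne hg.2.ne) h2

lemma memLp_two_of_integrable_of_bound {f : Plane → ℂ} (hf : Integrable f volume) {C : ℝ}
    (hC : ∀ ξ, ‖f ξ‖ ≤ C) : MemLp f 2 volume := by
  rw [memLp_two_iff_integrable_sq_norm hf.1]
  refine (hf.norm.const_mul C).mono' (hf.1.norm.pow 2) (ae_of_all _ fun ξ => ?_)
  rw [Real.norm_of_nonneg (by positivity), sq]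
  exact mul_le_mul_of_nonneg_right (hC ξ) (norm_nonneg _)

/-- Weighted comparison for convolutions. -/
lemma weight_mul_norm_conv_le {f g : Plane → ℂ} (hf : Rapid f) (hg : Rapid g) {s : ℝ}
    (hs : 0 ≤ s) (ξ : Plane) :
    weight s ξ * ‖conv f g ξ‖ ≤ 2 ^ (s / 2) *
      ‖conv (fun ξ => ((weight s ξ * ‖f ξ‖ : ℝ) : ℂ)) (fun ξ => ((weight s ξ * ‖g ξ‖ : ℝ) : ℂ)) ξ‖ := by
  have h1 : ‖conv f g ξ‖ ≤ ∫ ζ, ‖f (ξ - ζ)‖ * ‖g ζ‖ := by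
    refine (norm_integral_le_integral_norm _).trans (le_of_eq ?_)
    simp only [norm_mul]
  have hW : ∀ {g : Plane → ℂ}, Rapid g →
      MemLp (fun ξ => ((weight s ξ * ‖g ξ‖ : ℝ) : ℂ)) 2 (volume : Measure Plane) := by
    intro g hg
    have := (hg s).norm
    simp only [norm_weight_mul] at this
    exact this.ofReal
  have h2 : ‖conv (fun ξ => ((weight s ξ * ‖f ξ‖ : ℝ) : ℂ))
      (fun ξ => ((weight s ξ * ‖g ξ‖ : ℝ) : ℂ)) ξ‖ =
      ∫ ζ, (weight s (ξ - ζ) * ‖f (ξ - ζ)‖) * (weight s ζ * ‖g ζ‖) := by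
    unfold conv
    simp only [← Complex.ofReal_mul]
    rw [integral_complex_ofReal, Complex.norm_real, Real.norm_of_nonneg]
    exact integral_nonneg fun ζ => by
      have := weight_nonneg s ζ
      have := weight_nonneg s (ξ - ζ)
      positivity
  rw [h2]
  refine (mul_le_mul_of_nonneg_left h1 (weight_nonneg _ _)).trans ?_
  rw [← integral_const_mul, ← integral_const_mul]
  refine integral_mono ?_ ?_ fun ζ => ?_
  · have := (integrable_conv_integrand hf.memLp hg.memLp ξ).norm
    simp only [norm_mul] at this
    exact this.const_mul _
  · have := (integrable_conv_integrand (hW hf) (hW hg) ξ).re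
    simp only [← Complex.ofReal_mul] at this
    exact Integrable.const_mul this _
  · have := weight_le_mul hs ξ ζ
    calc weight s ξ * (‖f (ξ - ζ)‖ * ‖g ζ‖)
        ≤ 2 ^ (s / 2) * (weight s (ξ - ζ) * weight s ζ) * (‖f (ξ - ζ)‖ * ‖g ζ‖) := by gcongr
      _ = _ := by ring

lemma Rapid.weight_norm {g : Plane → ℂ} (hg : Rapid g) (s : ℝ) :
    Rapid (fun ξ => ((weight s ξ * ‖g ξ‖ : ℝ) : ℂ)) :=
  hg.mono (C := 1) (k := s)
    (Complex.continuous_ofReal.comp_aestronglyMeasurable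
      ((continuous_weight s).aestronglyMeasurable.mul hg.aesm.norm)) fun ξ => by
    rw [Complex.norm_real, Real.norm_of_nonneg (mul_nonneg (weight_nonneg _ _) (norm_nonneg _)),
      one_mul]

lemma integrable_conv {f g : Plane → ℂ} (hf : Rapid f) (hg : Rapid g) :
    Integrable (conv f g) volume := by
  rw [conv_eq_convolution]
  exact hf.integrable.integrable_convolution _ hg.integrable

lemma memLp_conv {f g : Plane → ℂ} (hf : Rapid f) (hg : Rapid g) :
    MemLp (conv f g) 2 volume :=
  memLp_two_of_integrable_of_bound (integrable_conv hf hg) (norm_conv_le hf.memLp hg.memLp)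

/-- For `s ≥ 0` Peetre's inequality distributes the weight over the two factors, and the convolution
of rapid functions is bounded and integrable, hence in `L²`. Negative exponents follow by
monotonicity of the weight. -/
lemma Rapid.conv {f g : Plane → ℂ} (hf : Rapid f) (hg : Rapid g) : Rapid (conv f g) := by
  have key : ∀ s : ℝ, 0 ≤ s →
      MemLp (fun ξ => (weight s ξ : ℂ) * Boussinesq.conv f g ξ) 2 volume := by
    intro s hs
    refine MemLp.of_le_mul (memLp_conv (hf.weight_norm s) (hg.weight_norm s)) (c := 2 ^ (s / 2))
      ((Complex.continuous_ofReal.comp (continuous_weight s)).aestronglyMeasurable.mul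
        (integrable_conv hf hg).1) (ae_of_all _ fun ξ => ?_)
    rw [norm_weight_mul]
    exact weight_mul_norm_conv_le hf hg hs ξ
  intro s
  refine MemLp.of_le_mul (key (max s 0) (le_max_right _ _)) (c := 1)
    ((Complex.continuous_ofReal.comp (continuous_weight s)).aestronglyMeasurable.mul
      (integrable_conv hf hg).1) (ae_of_all _ fun ξ => ?_)
  rw [norm_weight_mul, norm_weight_mul, one_mul]
  gcongr
  exact weight_mono (le_max_left _ _) ξ

end Boussinesq

end
-- Smooth functions with finite Sobolev norms, described by their transforms
noncomputable section

namespace Boussinesq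

/-- The inverse Fourier transform on `L²` agrees with the Fourier integral on `L¹ ∩ L²`. -/
lemma coeFn_fourierInv_toLp {g : Plane → ℂ} (h1 : Integrable g volume) (h2 : MemLp g 2 volume) :
    ((𝓕⁻ (h2.toLp g) : Lp ℂ 2 (volume : Measure Plane)) : Plane → ℂ) =ᵐ[volume] 𝓕⁻ g := by
  have hc : Continuous (𝓕⁻ g) := by
    rw [Real.fourierInv_eq_fourier_comp_neg]
    exact VectorFourier.fourierIntegral_continuous Real.continuous_fourierChar
      (by exact continuous_inner) h1.comp_neg
  refine ae_eq_of_integral_contDiff_smul_eq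
    ((Lp.memLp _).locallyIntegrable one_le_two) hc.locallyIntegrable fun φ hφ hφc => ?_
  have hφc' : HasCompactSupport (fun x => (φ x : ℂ)) :=
    hφc.comp_left (g := fun r : ℝ => (r : ℂ)) Complex.ofReal_zero
  have hφ' : ContDiff ℝ ∞ (fun x => (φ x : ℂ)) := Complex.ofRealCLM.contDiff.comp hφ
  set ψ : SchwartzMap Plane ℂ := hφc'.toSchwartzMap hφ' with hψ
  -- The transform on `L²` is determined by its pairing with Schwartz functions, and the Fourier
  -- integral satisfies the same duality formula by Fubini (`e2`). So both have the same integrals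
  -- against test functions.
  have e1 := congrArg (fun F : TemperedDistribution Plane ℂ => F ψ)
    (Lp.fourierInv_toTemperedDistribution_eq (h2.toLp g))
  simp only [TemperedDistribution.fourierInv_apply, Lp.toTemperedDistribution_apply,
    smul_eq_mul] at e1
  have hψv : ∀ x, ψ x = (φ x : ℂ) := fun x => rfl
  have e2 : ∫ x, (𝓕⁻ ψ) x * g x = ∫ x, ψ x * (𝓕⁻ g) x := by
    have := VectorFourier.integral_fourierIntegral_smul_eq_flip (L := innerₗ Plane)
      (μ := volume) (ν := volume) (f := ψ) (g := fun x => g (-x))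
      Real.continuous_fourierChar (by exact continuous_inner) ψ.integrable h1.comp_neg
    simp only [flip_innerₗ, smul_eq_mul] at this
    rw [Real.fourierInv_eq_fourier_comp_neg]
    refine Eq.trans ?_ this
    rw [← integral_neg_eq_self]
    congr 1; funext x
    rw [SchwartzMap.fourierInv_coe, Real.fourierInv_eq_fourier_neg, neg_neg]
    rfl
  have e3 : ∫ x, φ x • ((𝓕⁻ (h2.toLp g) : Lp ℂ 2 (volume : Measure Plane)) : Plane → ℂ) x =
      ∫ x, ψ x * (𝓕⁻ g) x := by
    rw [← e2]
    refine Eq.trans ?_ (e1.symm.trans ?_)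
    · refine integral_congr_ae (ae_of_all _ fun x => ?_)
      simp only [hψv, Complex.real_smul]
    · refine integral_congr_ae ?_
      filter_upwards [h2.coeFn_toLp] with x hx
      rw [hx]
  rw [e3]
  refine integral_congr_ae (ae_of_all _ fun x => ?_)
  simp only [hψv, Complex.real_smul]

/-- `f` is the real function with the rapidly decreasing Fourier transform `g`. -/
structure IsSpec (f : Plane → ℝ) (g : Plane → ℂ) : Prop where
  rapid : Rapid g
  eq : ∀ x, (f x : ℂ) = 𝓕⁻ g x

/-- The partial derivatives. -/
def pd (j : Fin 2) (f : Plane → ℝ) (x : Plane) : ℝ := fderiv ℝ f x (EuclideanSpace.single j 1)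

/-- The Laplacian as a sum of second partial derivatives. -/
def lap (f : Plane → ℝ) (x : Plane) : ℝ := pd 0 (pd 0 f) x + pd 1 (pd 1 f) x

/-- Smooth functions all of whose Sobolev norms are finite. -/
structure HInf (f : Plane → ℝ) : Prop where
  contDiff : ContDiff ℝ ∞ f
  finite : ∀ s, sobolevNorm s f < ⊤

lemma Rapid.contDiff_fourierInv {g : Plane → ℂ} (hg : Rapid g) : ContDiff ℝ ∞ (𝓕⁻ g) := by
  rw [Real.fourierInv_eq_fourier_comp_neg]
  refine Real.contDiff_fourier (N := ⊤) fun n _ => ?_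
  simpa using (hg.integrable_pow n).comp_neg

lemma Rapid.fderiv_fourierInv {g : Plane → ℂ} (hg : Rapid g) (j : Fin 2) (x : Plane) :
    fderiv ℝ (𝓕⁻ g) x (EuclideanSpace.single j 1) =
      𝓕⁻ (fun ξ : Plane => (2 * Real.pi * ξ j : ℝ) * Complex.I * g ξ) x := by
  have h0 : Integrable (fun ξ => g (-ξ)) volume := hg.integrable.comp_neg
  have h1 : Integrable (fun ξ : Plane => ‖ξ‖ * ‖g (-ξ)‖) volume := by
    simpa using (hg.integrable_pow 1).comp_neg
  rw [Real.fourierInv_eq_fourier_comp_neg, Real.fourierInv_eq_fourier_comp_neg,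
    Real.fderiv_fourier h0 h1]
  have h2 : Integrable (VectorFourier.fourierSMulRight (innerSL ℝ) fun ξ => g (-ξ)) volume := by
    refine (h1.const_mul (2 * Real.pi * ‖innerSL ℝ (E := Plane)‖)).mono'
      h0.1.fourierSMulRight (ae_of_all _ fun ξ => ?_)
    refine (VectorFourier.norm_fourierSMulRight_le _ _ _).trans (le_of_eq (by ring))
  refine (Real.fourier_continuousLinearMap_apply h2).trans ?_
  refine congrArg (fun F : Plane → ℂ => 𝓕 F x) (funext fun ξ => ?_)
  have h3 : innerSL ℝ ξ (EuclideanSpace.single j (1 : ℝ)) = ξ j := by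
    rw [innerSL_apply_apply, EuclideanSpace.inner_single_right]; simp
  simp only [VectorFourier.fourierSMulRight_apply, smul_eq_mul, Complex.real_smul,
    PiLp.neg_apply, h3]
  push_cast
  ring

lemma fourierInv_add' {f g : Plane → ℂ} (hf : Integrable f volume) (hg : Integrable g volume)
    (x : Plane) : 𝓕⁻ (fun ξ => f ξ + g ξ) x = 𝓕⁻ f x + 𝓕⁻ g x := by
  simp only [Real.fourierInv_eq, smul_add]
  refine integral_add ?_ ?_
  · simpa [neg_neg] using (Real.fourierIntegral_convergent_iff (-x)).2 hf
  · simpa [neg_neg] using (Real.fourierIntegral_convergent_iff (-x)).2 hg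

lemma fourierInv_const_mul' (c : ℂ) (f : Plane → ℂ) (x : Plane) :
    𝓕⁻ (fun ξ => c * f ξ) x = c * 𝓕⁻ f x := by
  simp only [Real.fourierInv_eq]
  rw [← integral_const_mul]
  congr 1; funext ξ
  simp only [Circle.smul_def, smul_eq_mul]; ring

lemma fourierInv_conv {f g : Plane → ℂ} (hf : Integrable f volume) (hg : Integrable g volume)
    (x : Plane) : 𝓕⁻ (conv f g) x = 𝓕⁻ f x * 𝓕⁻ g x := by
  simp only [Real.fourierInv_eq_fourier_neg]
  rw [conv_eq_convolution, Real.fourier_mul_convolution_eq hf hg]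

/-- The symbol of the partial derivative. -/
def sym (j : Fin 2) (ξ : Plane) : ℂ := (2 * Real.pi * ξ j : ℝ) * Complex.I

lemma continuous_sym (j : Fin 2) : Continuous (sym j) := by
  unfold sym; fun_prop

lemma norm_coord_le (j : Fin 2) (ξ : Plane) : ‖ξ j‖ ≤ ‖ξ‖ := PiLp.norm_apply_le ξ j

lemma norm_sym_le (j : Fin 2) (ξ : Plane) : ‖sym j ξ‖ ≤ weight 1 ξ := by
  refine le_trans ?_ (freq_le_weight_one ξ)
  have h := norm_coord_le j ξ
  rw [sym, norm_mul, Complex.norm_I, mul_one, Complex.norm_real, norm_mul,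
    Real.norm_of_nonneg (by positivity : 0 ≤ 2 * Real.pi)]
  gcongr

lemma Rapid.sym_mul {g : Plane → ℂ} (hg : Rapid g) (j : Fin 2) :
    Rapid (fun ξ => sym j ξ * g ξ) :=
  hg.mono ((continuous_sym j).aestronglyMeasurable.mul hg.aesm) (C := 1) (k := 1) fun ξ => by
    rw [norm_mul, one_mul]
    exact mul_le_mul_of_nonneg_right (norm_sym_le j ξ) (norm_nonneg _)

namespace IsSpec

variable {f f' : Plane → ℝ} {g g' : Plane → ℂ}

lemma ofReal_eq (h : IsSpec f g) : (fun x => (f x : ℂ)) = 𝓕⁻ g := funext h.eq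

lemma contDiff (h : IsSpec f g) : ContDiff ℝ ∞ f := by
  have : f = fun x => Complex.reCLM (𝓕⁻ g x) := by
    funext x; rw [← h.eq]; simp
  rw [this]
  exact Complex.reCLM.contDiff.comp h.rapid.contDiff_fourierInv

lemma differentiable (h : IsSpec f g) : Differentiable ℝ f :=
  h.contDiff.differentiable (by simp)

/-- This ties `g` to the Plancherel transform in the definition of `sobolevNorm`, so that norms can
be computed from `g`. -/
lemma toLp_eq (h : IsSpec f g) : ∃ hf : MemLp (fun x => (f x : ℂ)) 2 (volume : Measure Plane),
    𝓕 (hf.toLp) = h.rapid.memLp.toLp g := by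
  have key := coeFn_fourierInv_toLp h.rapid.integrable h.rapid.memLp
  rw [← h.ofReal_eq] at key
  have hf : MemLp (fun x => (f x : ℂ)) 2 (volume : Measure Plane) := (Lp.memLp _).ae_eq key
  refine ⟨hf, ?_⟩
  have : hf.toLp = 𝓕⁻ (h.rapid.memLp.toLp g) := by
    ext1
    exact hf.coeFn_toLp.trans key.symm
  rw [this, FourierTransform.fourier_fourierInv_eq]

lemma sobolevNorm_eq (h : IsSpec f g) (s : ℝ) :
    sobolevNorm s f = eLpNorm (fun ξ => (weight s ξ : ℂ) * g ξ) 2 volume := by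
  obtain ⟨hf, hg⟩ := h.toLp_eq
  rw [sobolevNorm, dif_pos hf, hg]
  refine eLpNorm_congr_ae ?_
  filter_upwards [h.rapid.memLp.coeFn_toLp] with ξ hξ
  rw [hξ]; rfl

lemma hInf (h : IsSpec f g) : HInf f :=
  ⟨h.contDiff, fun s => by rw [h.sobolevNorm_eq]; exact (h.rapid s).2⟩

lemma add (h : IsSpec f g) (h' : IsSpec f' g') :
    IsSpec (fun x => f x + f' x) (fun ξ => g ξ + g' ξ) :=
  ⟨h.rapid.add h'.rapid, fun x => by
    rw [fourierInv_add' h.rapid.integrable h'.rapid.integrable, ← h.eq, ← h'.eq]; push_cast; rfl⟩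

lemma const_mul (h : IsSpec f g) (c : ℝ) : IsSpec (fun x => c * f x) (fun ξ => (c : ℂ) * g ξ) :=
  ⟨h.rapid.const_mul c, fun x => by rw [fourierInv_const_mul', ← h.eq]; push_cast; rfl⟩

lemma neg (h : IsSpec f g) : IsSpec (fun x => -f x) (fun ξ => -g ξ) := by
  simpa using h.const_mul (-1)

lemma sub (h : IsSpec f g) (h' : IsSpec f' g') :
    IsSpec (fun x => f x - f' x) (fun ξ => g ξ - g' ξ) := by
  simpa only [sub_eq_add_neg] using h.add h'.neg

lemma mul (h : IsSpec f g) (h' : IsSpec f' g') :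
    IsSpec (fun x => f x * f' x) (conv g g') :=
  ⟨h.rapid.conv h'.rapid, fun x => by
    rw [fourierInv_conv h.rapid.integrable h'.rapid.integrable, ← h.eq, ← h'.eq]; push_cast; rfl⟩

lemma pd (h : IsSpec f g) (j : Fin 2) : IsSpec (pd j f) (fun ξ => sym j ξ * g ξ) :=
  ⟨h.rapid.sym_mul j, fun x => by
    have h1 : HasFDerivAt (fun x => (f x : ℂ)) (Complex.ofRealCLM ∘L fderiv ℝ f x) x :=
      Complex.ofRealCLM.hasFDerivAt.comp x (h.differentiable x).hasFDerivAt
    have h2 := h.rapid.fderiv_fourierInv j x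
    rw [← h.ofReal_eq, h1.fderiv] at h2
    exact h2⟩

lemma lap (h : IsSpec f g) :
    IsSpec (lap f) (fun ξ => -((2 * Real.pi * ‖ξ‖) ^ 2 : ℝ) * g ξ) := by
  have := ((h.pd 0).pd 0).add ((h.pd 1).pd 1)
  refine ⟨?_, fun x => ?_⟩
  · convert this.rapid using 2 with ξ
    simp only [sym, EuclideanSpace.norm_eq, mul_pow]
    rw [Real.sq_sqrt (by positivity)]
    simp only [Fin.sum_univ_two, Real.norm_eq_abs, sq_abs]
    push_cast
    linear_combination (-(2 * Real.pi * ξ 0 : ℂ) ^ 2 - (2 * Real.pi * ξ 1 : ℂ) ^ 2) * g ξ *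
      Complex.I_sq
  · refine (this.eq x).trans ?_
    refine congrArg (fun F : Plane → ℂ => 𝓕⁻ F x) (funext fun ξ => ?_)
    simp only [sym, EuclideanSpace.norm_eq, mul_pow]
    rw [Real.sq_sqrt (by positivity)]
    simp only [Fin.sum_univ_two, Real.norm_eq_abs, sq_abs]
    push_cast
    linear_combination ((2 * Real.pi * ξ 0 : ℂ) ^ 2 + (2 * Real.pi * ξ 1 : ℂ) ^ 2) * g ξ *
      Complex.I_sq

end IsSpec

lemma continuous_fourierInv {g : Plane → ℂ} (hg : Rapid g) : Continuous (𝓕⁻ g) :=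
  hg.contDiff_fourierInv.continuous

/-- Finiteness of the norm for `s = 0` excludes its value `⊤` outside `L²`. The Plancherel transform
is then rapid, and continuity upgrades the inversion formula from almost everywhere to everywhere.
-/
lemma HInf.exists_isSpec {f : Plane → ℝ} (h : HInf f) : ∃ g, IsSpec f g := by
  have hf : MemLp (fun x => (f x : ℂ)) 2 (volume : Measure Plane) := by
    by_contra hf
    have := h.finite 0
    rw [sobolevNorm, dif_neg hf] at this
    exact lt_irrefl _ this
  set G : Lp ℂ 2 (volume : Measure Plane) := 𝓕 (hf.toLp) with hG
  have hr : Rapid G := fun s => by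
    refine ⟨(Complex.continuous_ofReal.comp (continuous_weight s)).aestronglyMeasurable.mul
      (Lp.aestronglyMeasurable G), ?_⟩
    have := h.finite s
    rw [sobolevNorm, dif_pos hf] at this
    exact this
  refine ⟨G, hr, fun x => ?_⟩
  have h1 := coeFn_fourierInv_toLp hr.integrable hr.memLp
  rw [Lp.toLp_coeFn, hG, FourierTransform.fourierInv_fourier_eq] at h1
  have h2 := hf.coeFn_toLp.symm.trans h1
  have hc : Continuous (fun x => (f x : ℂ)) := Complex.continuous_ofReal.comp h.contDiff.continuous
  exact congrFun ((Continuous.ae_eq_iff_eq volume hc (continuous_fourierInv hr)).1 h2) x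

end Boussinesq

end
-- The algebra of such functions, and curves continuous in all Sobolev norms
noncomputable section

namespace Boussinesq

namespace HInf

variable {f g : Plane → ℝ}

lemma add (hf : HInf f) (hg : HInf g) : HInf (fun x => f x + g x) := by
  obtain ⟨_, h⟩ := hf.exists_isSpec
  obtain ⟨_, h'⟩ := hg.exists_isSpec
  exact (h.add h').hInf

lemma sub (hf : HInf f) (hg : HInf g) : HInf (fun x => f x - g x) := by
  obtain ⟨_, h⟩ := hf.exists_isSpec
  obtain ⟨_, h'⟩ := hg.exists_isSpec
  exact (h.sub h').hInf

lemma const_mul (hf : HInf f) (c : ℝ) : HInf (fun x => c * f x) := by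
  obtain ⟨_, h⟩ := hf.exists_isSpec
  exact (h.const_mul c).hInf

lemma mul (hf : HInf f) (hg : HInf g) : HInf (fun x => f x * g x) := by
  obtain ⟨_, h⟩ := hf.exists_isSpec
  obtain ⟨_, h'⟩ := hg.exists_isSpec
  exact (h.mul h').hInf

lemma pd (hf : HInf f) (j : Fin 2) : HInf (pd j f) := by
  obtain ⟨_, h⟩ := hf.exists_isSpec
  exact (h.pd j).hInf

lemma lap (hf : HInf f) : HInf (lap f) := by
  obtain ⟨_, h⟩ := hf.exists_isSpec
  exact h.lap.hInf

lemma differentiable (hf : HInf f) : Differentiable ℝ f := hf.contDiff.differentiable (by simp)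

lemma pd_add (hf : HInf f) (hg : HInf g) (j : Fin 2) :
    Boussinesq.pd j (fun x => f x + g x) =
      fun x => Boussinesq.pd j f x + Boussinesq.pd j g x := by
  funext x
  simp only [Boussinesq.pd]
  rw [fderiv_fun_add (hf.differentiable x) (hg.differentiable x)]; rfl

lemma pd_const_mul (hf : HInf f) (c : ℝ) (j : Fin 2) :
    Boussinesq.pd j (fun x => c * f x) = fun x => c * Boussinesq.pd j f x := by
  funext x
  simp only [Boussinesq.pd]
  rw [fderiv_const_mul (hf.differentiable x)]; rfl

lemma pd_sub (hf : HInf f) (hg : HInf g) (j : Fin 2) :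
    Boussinesq.pd j (fun x => f x - g x) =
      fun x => Boussinesq.pd j f x - Boussinesq.pd j g x := by
  funext x
  simp only [Boussinesq.pd]
  rw [fderiv_fun_sub (hf.differentiable x) (hg.differentiable x)]; rfl

lemma pd_mul (hf : HInf f) (hg : HInf g) (j : Fin 2) :
    Boussinesq.pd j (fun x => f x * g x) =
      fun x => f x * Boussinesq.pd j g x + g x * Boussinesq.pd j f x := by
  funext x
  simp only [Boussinesq.pd]
  rw [fderiv_fun_mul (hf.differentiable x) (hg.differentiable x)]; rfl

lemma lap_sub (hf : HInf f) (hg : HInf g) :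
    Boussinesq.lap (fun x => f x - g x) =
      fun x => Boussinesq.lap f x - Boussinesq.lap g x := by
  funext x
  simp only [Boussinesq.lap, hf.pd_sub hg, (hf.pd _).pd_sub (hg.pd _)]; ring

lemma memLp (hf : HInf f) : MemLp f 2 volume := by
  obtain ⟨_, h⟩ := hf.exists_isSpec
  obtain ⟨h1, _⟩ := h.toLp_eq
  exact h1.re

lemma eLpNorm_eq (hf : HInf f) : eLpNorm f 2 volume = sobolevNorm 0 f := by
  obtain ⟨g, h⟩ := hf.exists_isSpec
  obtain ⟨h1, h2⟩ := h.toLp_eq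
  rw [h.sobolevNorm_eq]
  simp only [weight_zero, Complex.ofReal_one, one_mul]
  have h3 := Lp.norm_fourier_eq (h1.toLp)
  rw [h2, Lp.norm_toLp, Lp.norm_toLp,
    ENNReal.toReal_eq_toReal_iff' h.rapid.memLp.2.ne h1.2.ne] at h3
  rw [h3]
  exact eLpNorm_congr_norm_ae (ae_of_all _ fun x => by simp)

lemma sobolevNorm_mono (hf : HInf f) {s t : ℝ} (h : s ≤ t) :
    sobolevNorm s f ≤ sobolevNorm t f := by
  obtain ⟨g, hg⟩ := hf.exists_isSpec
  rw [hg.sobolevNorm_eq, hg.sobolevNorm_eq]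
  refine eLpNorm_mono fun ξ => ?_
  rw [norm_weight_mul, norm_weight_mul]
  gcongr
  exact weight_mono h ξ

lemma sobolevNorm_add_le (hf : HInf f) (hg : HInf g) (s : ℝ) :
    sobolevNorm s (fun x => f x + g x) ≤ sobolevNorm s f + sobolevNorm s g := by
  obtain ⟨_, h⟩ := hf.exists_isSpec
  obtain ⟨_, h'⟩ := hg.exists_isSpec
  rw [h.sobolevNorm_eq, h'.sobolevNorm_eq, (h.add h').sobolevNorm_eq]
  simp only [mul_add]
  exact eLpNorm_add_le (h.rapid s).1 (h'.rapid s).1 one_le_two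

lemma sobolevNorm_const_mul (hf : HInf f) (c s : ℝ) :
    sobolevNorm s (fun x => c * f x) = ‖c‖ₑ * sobolevNorm s f := by
  obtain ⟨g, h⟩ := hf.exists_isSpec
  rw [h.sobolevNorm_eq, (h.const_mul c).sobolevNorm_eq,
    show ‖c‖ₑ = ‖(c : ℂ)‖ₑ by rw [← enorm_norm (c : ℂ), Complex.norm_real, enorm_norm],
    ← eLpNorm_const_smul]
  congr 1; funext ξ
  simp only [Pi.smul_apply, smul_eq_mul]; ring

lemma sobolevNorm_pd_le (hf : HInf f) (j : Fin 2) (s : ℝ) :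
    sobolevNorm s (Boussinesq.pd j f) ≤ sobolevNorm (s + 1) f := by
  obtain ⟨_, h⟩ := hf.exists_isSpec
  rw [h.sobolevNorm_eq, (h.pd j).sobolevNorm_eq]
  refine eLpNorm_mono fun ξ => ?_
  rw [norm_weight_mul s (fun ξ => sym j ξ * _), norm_weight_mul, weight_add, norm_mul, mul_assoc]
  gcongr
  · exact weight_nonneg _ _
  · exact norm_sym_le j ξ

/-- A deliberately lossy product estimate. With weight `s + 2` on both factors the convolution is
bounded pointwise by Cauchy–Schwarz, and the two spare derivatives leave the square integrable
factor `weight (-2)`. The loss is harmless since all exponents are available. -/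
lemma sobolevNorm_mul_le (hf : HInf f) (hg : HInf g) {s : ℝ} (hs : 0 ≤ s) :
    sobolevNorm s (fun x => f x * g x) ≤
      ENNReal.ofReal (2 ^ ((s + 2) / 2)) * eLpNorm (weight (-2)) 2 (volume : Measure Plane) *
        (sobolevNorm (s + 2) f * sobolevNorm (s + 2) g) := by
  obtain ⟨F, h⟩ := hf.exists_isSpec
  obtain ⟨G, h'⟩ := hg.exists_isSpec
  rw [h.sobolevNorm_eq, h'.sobolevNorm_eq, (h.mul h').sobolevNorm_eq]
  set A := eLpNorm (fun ξ => (weight (s + 2) ξ : ℂ) * F ξ) 2 volume with hA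
  set B := eLpNorm (fun ξ => (weight (s + 2) ξ : ℂ) * G ξ) 2 volume with hB
  have hA' : eLpNorm (fun ξ => ((weight (s + 2) ξ * ‖F ξ‖ : ℝ) : ℂ)) 2 volume = A :=
    eLpNorm_congr_norm_ae (ae_of_all _ fun ξ => by
      rw [norm_weight_mul, Complex.norm_real, Real.norm_of_nonneg
        (mul_nonneg (weight_nonneg _ _) (norm_nonneg _))])
  have hB' : eLpNorm (fun ξ => ((weight (s + 2) ξ * ‖G ξ‖ : ℝ) : ℂ)) 2 volume = B :=
    eLpNorm_congr_norm_ae (ae_of_all _ fun ξ => by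
      rw [norm_weight_mul, Complex.norm_real, Real.norm_of_nonneg
        (mul_nonneg (weight_nonneg _ _) (norm_nonneg _))])
  have hAB : A * B ≠ ⊤ := ENNReal.mul_ne_top (h.rapid _).2.ne (h'.rapid _).2.ne
  have key : ∀ ξ, ‖(weight s ξ : ℂ) * conv F G ξ‖ ≤
      (2 ^ ((s + 2) / 2) * (A * B).toReal) * ‖weight (-2) ξ‖ := by
    intro ξ
    have h1 := weight_mul_norm_conv_le h.rapid h'.rapid (by linarith : 0 ≤ s + 2) ξ
    have h2 := norm_conv_le (h.rapid.weight_norm (s + 2)).memLp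
      (h'.rapid.weight_norm (s + 2)).memLp ξ
    rw [hA', hB'] at h2
    rw [norm_weight_mul, Real.norm_of_nonneg (weight_nonneg _ _)]
    have h3 : weight s ξ = weight (s + 2) ξ * weight (-2) ξ := by
      rw [← weight_add]; congr 1; ring
    rw [h3]
    calc _ = weight (s + 2) ξ * ‖conv F G ξ‖ * weight (-2) ξ := by ring
      _ ≤ _ := by
        refine mul_le_mul_of_nonneg_right (h1.trans ?_) (weight_nonneg _ _)
        gcongr
  refine (eLpNorm_le_mul_eLpNorm_of_ae_le_mul (ae_of_all _ key) 2).trans (le_of_eq ?_)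
  rw [ENNReal.ofReal_mul (by positivity), ENNReal.ofReal_toReal hAB]
  ring

/-- Sobolev embedding into bounded functions. -/
lemma abs_le (hf : HInf f) (x : Plane) :
    |f x| ≤ (eLpNorm (weight (-2)) 2 (volume : Measure Plane) * sobolevNorm 2 f).toReal := by
  obtain ⟨g, h⟩ := hf.exists_isSpec
  have h1 := (h.rapid 2)
  have h2 := eLpNorm_le_eLpNorm_mul_eLpNorm_of_nnnorm (p := 2) (q := 2) (r := 1)
    memLp_weight_neg_two.1 h1.1 (fun a b => (a : ℂ) * b) 1 (ae_of_all _ fun x => by simp)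
  have h3 : (fun ξ => ((weight (-2) ξ : ℝ) : ℂ) * ((weight 2 ξ : ℂ) * g ξ)) = g := by
    funext ξ
    rw [← mul_assoc, ← Complex.ofReal_mul, ← weight_add]
    simp
  rw [h3, ENNReal.coe_one, one_mul, ← h.sobolevNorm_eq] at h2
  have h4 : |f x| = ‖𝓕⁻ g x‖ := by rw [← h.eq, Complex.norm_real, Real.norm_eq_abs]
  rw [h4, Real.fourierInv_eq]
  refine (norm_integral_le_integral_norm _).trans ?_
  simp only [Circle.norm_smul]
  rw [integral_norm_eq_lintegral_enorm h.rapid.aesm, ← eLpNorm_one_eq_lintegral_enorm]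
  exact ENNReal.toReal_mono
    (ENNReal.mul_ne_top memLp_weight_neg_two.2.ne (hf.finite 2).ne) h2

end HInf

/-- A curve on `[0, T]` that is continuous with values in every Sobolev space. -/
structure SobCurve (T : ℝ) (f : ℝ → Plane → ℝ) : Prop where
  hInf : ∀ t ∈ Icc 0 T, HInf (f t)
  tendsto : ∀ s : ℝ, ∀ t ∈ Icc 0 T,
    Tendsto (fun τ => sobolevNorm s (fun x => f τ x - f t x)) (𝓝[Icc 0 T] t) (𝓝 0)

namespace SobCurve

variable {T : ℝ} {f g : ℝ → Plane → ℝ}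

lemma congr (hf : SobCurve T f) (h : ∀ t ∈ Icc 0 T, ∀ x, f t x = g t x) : SobCurve T g where
  hInf t ht := by
    have : f t = g t := funext (h t ht)
    rw [← this]; exact hf.hInf t ht
  tendsto s t ht := by
    refine (hf.tendsto s t ht).congr' ?_
    filter_upwards [self_mem_nhdsWithin] with τ hτ
    simp only [h τ hτ, h t ht]

lemma add (hf : SobCurve T f) (hg : SobCurve T g) : SobCurve T (fun t x => f t x + g t x) where
  hInf t ht := (hf.hInf t ht).add (hg.hInf t ht)
  tendsto s t ht := by
    have h := (hf.tendsto s t ht).add (hg.tendsto s t ht)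
    rw [add_zero] at h
    refine tendsto_of_tendsto_of_tendsto_of_le_of_le' tendsto_const_nhds h
      (Eventually.of_forall fun _ => zero_le) ?_
    filter_upwards [self_mem_nhdsWithin] with τ hτ
    have := ((hf.hInf τ hτ).sub (hf.hInf t ht)).sobolevNorm_add_le
      ((hg.hInf τ hτ).sub (hg.hInf t ht)) s
    refine le_trans (le_of_eq ?_) this
    congr 1; funext x; ring

lemma const_mul (hf : SobCurve T f) (c : ℝ) : SobCurve T (fun t x => c * f t x) where
  hInf t ht := (hf.hInf t ht).const_mul c
  tendsto s t ht := by
    have h := ENNReal.Tendsto.const_mul (a := ‖c‖ₑ) (hf.tendsto s t ht) (Or.inr enorm_ne_top)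
    rw [mul_zero] at h
    refine h.congr' ?_
    filter_upwards [self_mem_nhdsWithin] with τ hτ
    rw [← ((hf.hInf τ hτ).sub (hf.hInf t ht)).sobolevNorm_const_mul]
    congr 1; funext x; ring

lemma neg (hf : SobCurve T f) : SobCurve T (fun t x => -f t x) :=
  (hf.const_mul (-1)).congr fun t _ x => by ring

lemma sub (hf : SobCurve T f) (hg : SobCurve T g) : SobCurve T (fun t x => f t x - g t x) :=
  (hf.add hg.neg).congr fun t _ x => by ring

lemma pd (hf : SobCurve T f) (j : Fin 2) : SobCurve T (fun t => pd j (f t)) where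
  hInf t ht := (hf.hInf t ht).pd j
  tendsto s t ht := by
    refine tendsto_of_tendsto_of_tendsto_of_le_of_le' tendsto_const_nhds (hf.tendsto (s + 1) t ht)
      (Eventually.of_forall fun _ => zero_le) ?_
    filter_upwards [self_mem_nhdsWithin] with τ hτ
    rw [← (hf.hInf τ hτ).pd_sub (hf.hInf t ht)]
    exact ((hf.hInf τ hτ).sub (hf.hInf t ht)).sobolevNorm_pd_le j s

lemma lap (hf : SobCurve T f) : SobCurve T (fun t => lap (f t)) :=
  ((hf.pd 0).pd 0).add ((hf.pd 1).pd 1)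

lemma mul (hf : SobCurve T f) (hg : SobCurve T g) : SobCurve T (fun t x => f t x * g t x) where
  hInf t ht := (hf.hInf t ht).mul (hg.hInf t ht)
  tendsto s t ht := by
    -- The product estimate needs a nonnegative exponent; the norm of exponent `s` is below that of
    -- exponent `max s 0`.
    set s' := max s 0 with hs'
    set C := ENNReal.ofReal (2 ^ ((s' + 2) / 2)) *
      eLpNorm (weight (-2)) 2 (volume : Measure Plane) with hC
    have hCt : C ≠ ⊤ := ENNReal.mul_ne_top ENNReal.ofReal_ne_top memLp_weight_neg_two.2.ne
    have h1 := hf.tendsto (s' + 2) t ht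
    have h2 := hg.tendsto (s' + 2) t ht
    have h3 := ENNReal.Tendsto.mul h1 (Or.inr ENNReal.zero_ne_top) h2 (Or.inr ENNReal.zero_ne_top)
    have h4 := ENNReal.Tendsto.mul_const (b := sobolevNorm (s' + 2) (g t)) h1
      (Or.inr ((hg.hInf t ht).finite _).ne)
    have h5 := ENNReal.Tendsto.const_mul (a := sobolevNorm (s' + 2) (f t)) h2
      (Or.inr ((hf.hInf t ht).finite _).ne)
    have h := ENNReal.Tendsto.const_mul (a := C) ((h3.add h4).add h5) (Or.inr hCt)
    simp only [mul_zero, zero_mul, add_zero] at h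
    refine tendsto_of_tendsto_of_tendsto_of_le_of_le' tendsto_const_nhds h
      (Eventually.of_forall fun _ => zero_le) ?_
    filter_upwards [self_mem_nhdsWithin] with τ hτ
    have hF := (hf.hInf τ hτ).sub (hf.hInf t ht)
    have hG := (hg.hInf τ hτ).sub (hg.hInf t ht)
    have e : (fun x => f τ x * g τ x - f t x * g t x) = fun x =>
        ((f τ x - f t x) * (g τ x - g t x) + (f τ x - f t x) * g t x) +
          f t x * (g τ x - g t x) := by
      funext x; ring
    have hs0 : 0 ≤ s' := le_max_right _ _
    rw [e]
    have i1 := (((hF.mul hG).add (hF.mul (hg.hInf t ht))).add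
      ((hf.hInf t ht).mul hG)).sobolevNorm_mono (le_max_left s 0)
    have i2 := ((hF.mul hG).add (hF.mul (hg.hInf t ht))).sobolevNorm_add_le
      ((hf.hInf t ht).mul hG) s'
    have i3 := (hF.mul hG).sobolevNorm_add_le (hF.mul (hg.hInf t ht)) s'
    have j1 := hF.sobolevNorm_mul_le hG hs0
    have j2 := hF.sobolevNorm_mul_le (hg.hInf t ht) hs0
    have j3 := (hf.hInf t ht).sobolevNorm_mul_le hG hs0
    rw [mul_add, mul_add]
    exact i1.trans (i2.trans (add_le_add (i3.trans (add_le_add j1 j2)) j3))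

/-- The `H²` norm is continuous on the compact interval, hence bounded, and it controls the
supremum. -/
lemma exists_bound (hf : SobCurve T f) : ∃ M : ℝ, 0 ≤ M ∧ ∀ t ∈ Icc 0 T, ∀ x, |f t x| ≤ M := by
  have hc : ContinuousOn (fun t => (sobolevNorm 2 (f t)).toReal) (Icc 0 T) := by
    intro t ht
    rw [ContinuousWithinAt, tendsto_iff_dist_tendsto_zero]
    have h := (ENNReal.tendsto_toReal ENNReal.zero_ne_top).comp (hf.tendsto 2 t ht)
    refine squeeze_zero' (Eventually.of_forall fun _ => dist_nonneg) ?_ h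
    filter_upwards [self_mem_nhdsWithin] with τ hτ
    have hF := (hf.hInf τ hτ).sub (hf.hInf t ht)
    have hF' := (hf.hInf t ht).sub (hf.hInf τ hτ)
    have e1 := hF.sobolevNorm_add_le (hf.hInf t ht) 2
    have e2 := hF'.sobolevNorm_add_le (hf.hInf τ hτ) 2
    have e3 : sobolevNorm 2 (fun x => f t x - f τ x) = sobolevNorm 2 (fun x => f τ x - f t x) := by
      have := hF.sobolevNorm_const_mul (-1) 2
      simp only [enorm_neg, enorm_one, one_mul, neg_mul, neg_sub] at this
      exact this
    simp only [sub_add_cancel] at e1 e2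
    rw [e3] at e2
    have f1 := (hF.finite 2).ne
    have f2 := ((hf.hInf t ht).finite 2).ne
    have f3 := ((hf.hInf τ hτ).finite 2).ne
    have e1' := ENNReal.toReal_mono (ENNReal.add_ne_top.2 ⟨f1, f2⟩) e1
    have e2' := ENNReal.toReal_mono (ENNReal.add_ne_top.2 ⟨f1, f3⟩) e2
    rw [ENNReal.toReal_add f1 f2] at e1'
    rw [ENNReal.toReal_add f1 f3] at e2'
    rw [Real.dist_eq, Function.comp_apply, _root_.abs_le]
    constructor <;> linarith
  obtain ⟨M, hM⟩ := isCompact_Icc.exists_bound_of_continuousOn hc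
  refine ⟨(eLpNorm (weight (-2)) 2 (volume : Measure Plane)).toReal * max M 0, by positivity,
    fun t ht x => ((hf.hInf t ht).abs_le x).trans ?_⟩
  rw [ENNReal.toReal_mul]
  gcongr
  exact (le_abs_self _).trans ((hM t ht).trans (le_max_left _ _))

lemma continuousOn_apply (hf : SobCurve T f) (x : Plane) :
    ContinuousOn (fun t => f t x) (Icc 0 T) := by
  intro t ht
  rw [ContinuousWithinAt, tendsto_iff_dist_tendsto_zero]
  have h := ENNReal.Tendsto.const_mul (a := eLpNorm (weight (-2)) 2 (volume : Measure Plane))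
    (hf.tendsto 2 t ht) (Or.inr memLp_weight_neg_two.2.ne)
  rw [mul_zero] at h
  have h' := (ENNReal.tendsto_toReal ENNReal.zero_ne_top).comp h
  refine squeeze_zero' (Eventually.of_forall fun _ => dist_nonneg) ?_ h'
  filter_upwards [self_mem_nhdsWithin] with τ hτ
  rw [Real.dist_eq]
  exact ((hf.hInf τ hτ).sub (hf.hInf t ht)).abs_le x

end SobCurve

end Boussinesq

end
-- The pairing in `L²` and its time derivative
noncomputable section

namespace Boussinesq

open Classical in
/-- The class in `L²` of a square integrable function. -/
def l2 (f : Plane → ℝ) : Lp ℝ 2 (volume : Measure Plane) :=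
  if h : MemLp f 2 volume then h.toLp f else 0

/-- The `L²` pairing of real functions. -/
def ip (f g : Plane → ℝ) : ℝ := ∫ x, f x * g x

lemma HInf.coeFn_l2 {f : Plane → ℝ} (hf : HInf f) : l2 f =ᵐ[volume] f := by
  rw [l2, dif_pos hf.memLp]; exact hf.memLp.coeFn_toLp

lemma inner_l2 {f g : Plane → ℝ} (hf : HInf f) (hg : HInf g) :
    inner ℝ (l2 f) (l2 g) = ip f g := by
  rw [L2.inner_def, ip]
  refine integral_congr_ae ?_
  filter_upwards [hf.coeFn_l2, hg.coeFn_l2] with x h1 h2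
  rw [h1, h2]; simp [mul_comm]

lemma l2_sub {f g : Plane → ℝ} (hf : HInf f) (hg : HInf g) :
    l2 f - l2 g = l2 (fun x => f x - g x) := by
  rw [l2, l2, l2, dif_pos hf.memLp, dif_pos hg.memLp, dif_pos (hf.sub hg).memLp,
    ← MemLp.toLp_sub]; rfl

lemma norm_l2 {f : Plane → ℝ} (hf : HInf f) : ‖l2 f‖ = (sobolevNorm 0 f).toReal := by
  rw [l2, dif_pos hf.memLp, Lp.norm_toLp, hf.eLpNorm_eq]

lemma HInf.integrable_mul {f g : Plane → ℝ} (hf : HInf f) (hg : HInf g) :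
    Integrable (fun x => f x * g x) volume := hf.memLp.integrable_mul hg.memLp

namespace SobCurve

variable {T : ℝ} {F F' G G' : ℝ → Plane → ℝ}

lemma continuousOn_l2 (hF : SobCurve T F) : ContinuousOn (fun t => l2 (F t)) (Icc 0 T) := by
  intro t ht
  rw [ContinuousWithinAt, tendsto_iff_dist_tendsto_zero]
  refine ((ENNReal.tendsto_toReal ENNReal.zero_ne_top).comp (hF.tendsto 0 t ht)).congr' ?_
  filter_upwards [self_mem_nhdsWithin] with τ hτ
  rw [dist_eq_norm, l2_sub (hF.hInf τ hτ) (hF.hInf t ht),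
    norm_l2 ((hF.hInf τ hτ).sub (hF.hInf t ht))]; rfl

/-- Integration in time of a curve that is the pointwise time derivative of another one. -/
lemma integral_deriv (hT : 0 ≤ T) (hF : SobCurve T F) (hF' : SobCurve T F')
    (hd : ∀ t ∈ Icc 0 T, ∀ x, HasDerivWithinAt (fun τ => F τ x) (F' t x) (Icc 0 T) t)
    {t : ℝ} (ht : t ∈ Icc 0 T) :
    l2 (F t) = l2 (F 0) + ∫ s in (0 : ℝ)..t, l2 (F' (projIcc 0 T hT s)) := by
  obtain ⟨M, hM0, hM⟩ := hF'.exists_bound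
  have h0 : (0 : ℝ) ∈ Icc 0 T := ⟨le_rfl, hT⟩
  -- Freezing the curve outside `[0, T]` makes it continuous on the whole line, so that interval
  -- integrals need no side conditions.
  set γ : ℝ → Lp ℝ 2 (volume : Measure Plane) := fun s => l2 (F' (projIcc 0 T hT s)) with hγ
  have hγc : Continuous γ := by
    have := (continuousOn_iff_continuous_domRestrict.1 hF'.continuousOn_l2).comp
      (continuous_projIcc (h := hT))
    exact this
  have hmem : ∀ s, (projIcc 0 T hT s : ℝ) ∈ Icc 0 T := fun s => (projIcc 0 T hT s).2
  set g : ℝ → Plane → ℝ := fun s x => F' (projIcc 0 T hT s) x with hg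
  have hgc : ∀ x, Continuous fun s => g s x := fun x => by
    have := (continuousOn_iff_continuous_domRestrict.1 (hF'.continuousOn_apply x)).comp
      (continuous_projIcc (h := hT))
    exact this
  have hgm : StronglyMeasurable (Function.uncurry g) :=
    stronglyMeasurable_uncurry_of_continuous_of_stronglyMeasurable hgc fun s =>
      (hF'.hInf _ (hmem s)).contDiff.continuous.stronglyMeasurable
  have hftc : ∀ x, F t x - F 0 x = ∫ s in (0 : ℝ)..t, g s x := by
    intro x
    symm
    refine intervalIntegral.integral_eq_sub_of_hasDeriv_right_of_le ht.1
      (fun s hs => ((hd s ⟨hs.1, hs.2.trans ht.2⟩ x).continuousWithinAt).mono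
        (Icc_subset_Icc_right ht.2)) (fun s hs => ?_) ((hgc x).intervalIntegrable _ _)
    have hs' : s ∈ Icc 0 T := ⟨hs.1.le, hs.2.le.trans ht.2⟩
    have : g s x = F' s x := by simp only [hg]; rw [projIcc_of_mem hT hs']
    rw [this]
    refine ((hd s hs' x).hasDerivAt ?_).hasDerivWithinAt
    exact Icc_mem_nhds hs.1 (lt_of_lt_of_le hs.2 ht.2)
  ext1
  have hint : ∀ f : Lp ℝ 2 (volume : Measure Plane), ∀ S, MeasurableSet S →
      volume S < ⊤ → IntegrableOn f S volume := fun f S _ hμ =>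
    integrableOn_Lp_of_measure_ne_top f one_le_two hμ.ne
  -- Both sides are tested on sets of finite measure. There the uniform bound `M` makes the
  -- derivative integrable in space and time, and Fubini reduces the claim to the pointwise
  -- fundamental theorem of calculus `hftc`.
  refine Lp.ae_eq_of_forall_setIntegral_eq _ _ two_ne_zero (by simp) (hint _) (hint _) ?_
  intro S hS hμS
  have : IsFiniteMeasure ((volume : Measure Plane).restrict S) := ⟨by simpa using hμS⟩
  set L : Lp ℝ 2 (volume : Measure Plane) →L[ℝ] ℝ :=
    innerSL ℝ (indicatorConstLp 2 hS hμS.ne (1 : ℝ)) with hL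
  have hLv : ∀ f : Lp ℝ 2 (volume : Measure Plane), L f = ∫ x in S, f x :=
    fun f => L2.inner_indicatorConstLp_one hS hμS.ne f
  have hLf : ∀ f : Plane → ℝ, HInf f → L (l2 f) = ∫ x in S, f x := fun f hf => by
    rw [hLv]
    exact integral_congr_ae (ae_restrict_of_ae hf.coeFn_l2)
  rw [← hLv, ← hLv, map_add, hLf _ (hF.hInf t ht), hLf _ (hF.hInf 0 h0),
    ← ContinuousLinearMap.intervalIntegral_comp_comm L (hγc.intervalIntegrable _ _)]
  have e1 : ∀ s, L (γ s) = ∫ x in S, g s x := fun s => hLf _ (hF'.hInf _ (hmem s))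
  simp only [e1]
  have hintS : ∀ {f : Plane → ℝ}, HInf f → IntegrableOn f S volume := fun hf => by
    have := (hint (l2 _) S hS hμS).congr (ae_restrict_of_ae hf.coeFn_l2)
    exact this
  rw [← sub_eq_iff_eq_add', ← integral_sub (hintS (hF.hInf t ht)) (hintS (hF.hInf 0 h0))]
  simp only [hftc]
  simp only [intervalIntegral.integral_of_le ht.1]
  refine integral_integral_swap (μ := volume.restrict S)
    (ν := (volume : Measure ℝ).restrict (Ioc 0 t)) (f := fun x s => g s x) ?_
  refine Integrable.of_bound (C := M) ?_ (ae_of_all _ fun p => ?_)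
  · exact (hgm.comp_measurable measurable_swap).aestronglyMeasurable
  · exact hM _ (hmem _) _

/-- Solutions are differentiable in time only pointwise in space; continuity of the derivative in
`L²` turns this into differentiability of the `L²`-valued curve, which energy estimates need. -/
lemma hasDerivWithinAt_l2 (hF : SobCurve T F) (hF' : SobCurve T F')
    (hd : ∀ t ∈ Icc 0 T, ∀ x, HasDerivWithinAt (fun τ => F τ x) (F' t x) (Icc 0 T) t)
    {t : ℝ} (ht : t ∈ Icc 0 T) :
    HasDerivWithinAt (fun t => l2 (F t)) (l2 (F' t)) (Icc 0 T) t := by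
  have hT : 0 ≤ T := ht.1.trans ht.2
  have hγc : Continuous fun s => l2 (F' (projIcc 0 T hT s)) := by
    have := (continuousOn_iff_continuous_domRestrict.1 hF'.continuousOn_l2).comp
      (continuous_projIcc (h := hT))
    exact this
  have h := ((hγc.integral_hasStrictDerivAt 0 t).hasDerivAt.const_add
    (l2 (F 0))).hasDerivWithinAt (s := Icc 0 T)
  rw [projIcc_of_mem hT ht] at h
  exact h.congr (fun s hs => hF.integral_deriv hT hF' hd hs) (hF.integral_deriv hT hF' hd ht)

lemma hasDerivWithinAt_ip (hF : SobCurve T F) (hF' : SobCurve T F') (hG : SobCurve T G)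
    (hG' : SobCurve T G')
    (hdF : ∀ t ∈ Icc 0 T, ∀ x, HasDerivWithinAt (fun τ => F τ x) (F' t x) (Icc 0 T) t)
    (hdG : ∀ t ∈ Icc 0 T, ∀ x, HasDerivWithinAt (fun τ => G τ x) (G' t x) (Icc 0 T) t)
    {t : ℝ} (ht : t ∈ Icc 0 T) :
    HasDerivWithinAt (fun t => ip (F t) (G t)) (ip (F t) (G' t) + ip (F' t) (G t))
      (Icc 0 T) t := by
  have h := (hF.hasDerivWithinAt_l2 hF' hdF ht).inner ℝ (hG.hasDerivWithinAt_l2 hG' hdG ht)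
  rw [inner_l2 (hF.hInf t ht) (hG'.hInf t ht), inner_l2 (hF'.hInf t ht) (hG.hInf t ht)] at h
  exact h.congr (fun s hs => (inner_l2 (hF.hInf s hs) (hG.hInf s hs)).symm)
    (inner_l2 (hF.hInf t ht) (hG.hInf t ht)).symm

/-- The derivative of a symmetric pairing, with only one of the factors differentiable. -/
lemma hasDerivWithinAt_ip_of_symm (hF : SobCurve T F) (hF' : SobCurve T F') (hG : SobCurve T G)
    (hdF : ∀ t ∈ Icc 0 T, ∀ x, HasDerivWithinAt (fun τ => F τ x) (F' t x) (Icc 0 T) t)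
    (hsymm : ∀ s ∈ Icc 0 T, ∀ t ∈ Icc 0 T, ip (F s) (G t) = ip (F t) (G s))
    {t : ℝ} (ht : t ∈ Icc 0 T) :
    HasDerivWithinAt (fun t => ip (F t) (G t)) (2 * ip (F' t) (G t)) (Icc 0 T) t := by
  have h := hF.hasDerivWithinAt_l2 hF' hdF ht
  rw [hasDerivWithinAt_iff_tendsto_slope] at h ⊢
  have hc := (hG.continuousOn_l2 t ht).mono_left
    (nhdsWithin_mono t (sdiff_subset (s := Icc 0 T) (t := {t})))
  -- By symmetry `⟨F s, G s⟩ - ⟨F t, G t⟩ = ⟨F s - F t, G s + G t⟩`, so continuity of `G` is enough.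
  -- This matters because the equations differentiate `(1 - bΔ)ζ` in time, and not `ζ` itself.
  have h2 := h.inner (𝕜 := ℝ) (hc.add_const (l2 (G t)))
  rw [inner_add_right, inner_l2 (hF'.hInf t ht) (hG.hInf t ht), ← two_mul] at h2
  refine h2.congr' ?_
  filter_upwards [self_mem_nhdsWithin] with s hs
  have hs' := hs.1
  rw [slope_def_module, slope_def_module, real_inner_smul_left, inner_sub_left, inner_add_right,
    inner_add_right, inner_l2 (hF.hInf s hs') (hG.hInf s hs'),
    inner_l2 (hF.hInf s hs') (hG.hInf t ht), inner_l2 (hF.hInf t ht) (hG.hInf s hs'),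
    inner_l2 (hF.hInf t ht) (hG.hInf t ht), hsymm s hs' t ht, smul_eq_mul]
  ring

end SobCurve

lemma ip_comm (f g : Plane → ℝ) : ip f g = ip g f := by
  simp only [ip, mul_comm]

lemma ip_add_left {f g h : Plane → ℝ} (hf : HInf f) (hg : HInf g) (hh : HInf h) :
    ip (fun x => f x + g x) h = ip f h + ip g h := by
  simp only [ip, add_mul]
  exact integral_add (hf.integrable_mul hh) (hg.integrable_mul hh)

lemma ip_const_mul_left (c : ℝ) (f h : Plane → ℝ) : ip (fun x => c * f x) h = c * ip f h := by
  simp only [ip, mul_assoc, integral_const_mul]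

lemma ip_neg_left (f h : Plane → ℝ) : ip (fun x => -f x) h = -ip f h := by
  simp only [ip, neg_mul, integral_neg]

lemma ip_add_right {f g h : Plane → ℝ} (hf : HInf f) (hg : HInf g) (hh : HInf h) :
    ip h (fun x => f x + g x) = ip h f + ip h g := by
  rw [ip_comm, ip_add_left hf hg hh, ip_comm f, ip_comm g]

lemma ip_const_mul_right (c : ℝ) (f h : Plane → ℝ) : ip h (fun x => c * f x) = c * ip h f := by
  rw [ip_comm, ip_const_mul_left, ip_comm f]

/-- Integration by parts has no boundary term because all the products involved are integrable. -/
lemma ip_pd_left {f g : Plane → ℝ} (hf : HInf f) (hg : HInf g) (j : Fin 2) :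
    ip (pd j f) g = -ip f (pd j g) := by
  have := integral_mul_fderiv_eq_neg_fderiv_mul_of_integrable (μ := volume)
    ((hf.pd j).integrable_mul hg) (hf.integrable_mul (hg.pd j)) (hf.integrable_mul hg)
    (fun x _ => hf.differentiable x) (fun x _ => hg.differentiable x)
  simp only [ip, pd]
  linarith

lemma ip_lap_left {f g : Plane → ℝ} (hf : HInf f) (hg : HInf g) :
    ip (lap f) g = -(ip (pd 0 f) (pd 0 g) + ip (pd 1 f) (pd 1 g)) := by
  have : lap f = fun x => pd 0 (pd 0 f) x + pd 1 (pd 1 f) x := rfl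
  rw [this, ip_add_left ((hf.pd 0).pd 0) ((hf.pd 1).pd 1) hg, ip_pd_left (hf.pd 0) hg,
    ip_pd_left (hf.pd 1) hg]; ring

lemma ip_lap_comm {f g : Plane → ℝ} (hf : HInf f) (hg : HInf g) :
    ip (lap f) g = ip f (lap g) := by
  rw [ip_lap_left hf hg, ip_comm f, ip_lap_left hg hf, ip_comm (pd 0 f), ip_comm (pd 1 f)]

lemma ip_self_nonneg (f : Plane → ℝ) : 0 ≤ ip f f :=
  integral_nonneg fun x => mul_self_nonneg (f x)

lemma HInf.eq_zero_of_ip {f : Plane → ℝ} (hf : HInf f) (h : ip f f = 0) (x : Plane) : f x = 0 := by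
  have h1 := (integral_eq_zero_iff_of_nonneg (fun x => mul_self_nonneg (f x))
    (hf.integrable_mul hf)).1 h
  have h2 := (Continuous.ae_eq_iff_eq volume
    (hf.contDiff.continuous.mul hf.contDiff.continuous) continuous_const).1 h1
  exact mul_self_eq_zero.1 (congrFun h2 x)

/-- Young's inequality for the pairing. -/
lemma abs_ip_le {f g : Plane → ℝ} (hf : HInf f) (hg : HInf g) :
    |ip f g| ≤ (ip f f + ip g g) / 2 := by
  -- The squared norms of `f + g` and `f - g` are nonnegative.
  have h1 : ∀ c : ℝ, c ^ 2 = 1 → 0 ≤ ip f f + 2 * c * ip f g + ip g g := fun c hc => by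
    have h := ip_self_nonneg fun x => f x + c * g x
    rw [ip_add_left hf (hg.const_mul c) (hf.add (hg.const_mul c)),
      ip_add_right hf (hg.const_mul c) hf, ip_add_right hf (hg.const_mul c) (hg.const_mul c),
      ip_const_mul_left, ip_const_mul_left, ip_const_mul_right, ip_const_mul_right,
      ip_comm g f, ← mul_assoc c c, ← sq, hc, one_mul] at h
    linarith
  have h2 := h1 1 (by norm_num)
  have h3 := h1 (-1) (by norm_num)
  rw [abs_le]
  constructor <;> linarith

/-- Pointwise comparison of the squares. -/
lemma ip_self_le {f g : Plane → ℝ} (hf : HInf f) (hg : HInf g) {M : ℝ} (h : ∀ x, |f x| ≤ M * |g x|) :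
    ip f f ≤ M ^ 2 * ip g g := by
  rw [ip, ip, ← integral_const_mul]
  refine integral_mono (hf.integrable_mul hf) ((hg.integrable_mul hg).const_mul _) fun x => ?_
  have := mul_self_le_mul_self (abs_nonneg (f x)) (h x)
  simp only [abs_mul_abs_self] at this
  calc f x * f x ≤ M * |g x| * (M * |g x|) := this
    _ = M ^ 2 * (|g x| * |g x|) := by ring
    _ = _ := by rw [abs_mul_abs_self]

end Boussinesq

end
-- The system in components
noncomputable section

namespace Boussinesq

lemma laplacian_eq_lap {f : Plane → ℝ} (hf : ContDiff ℝ ∞ f) (x : Plane) : Δ f x = lap f x := by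
  have h2 : Differentiable ℝ (fderiv ℝ f) :=
    (hf.fderiv_right (m := ∞) (by simp)).differentiable (by simp)
  rw [InnerProductSpace.laplacian_eq_iteratedFDeriv_orthonormalBasis f
    (EuclideanSpace.basisFun (Fin 2) ℝ)]
  have : ∀ j : Fin 2, iteratedFDeriv ℝ 2 f x ![EuclideanSpace.basisFun (Fin 2) ℝ j,
      EuclideanSpace.basisFun (Fin 2) ℝ j] = pd j (pd j f) x := fun j => by
    rw [iteratedFDeriv_two_apply]
    simp only [Matrix.cons_val_zero, Matrix.cons_val_one, EuclideanSpace.basisFun_apply]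
    have : pd j f = fun y => fderiv ℝ f y (EuclideanSpace.single j 1) := rfl
    rw [this, pd, fderiv_clm_apply (h2 x) (differentiableAt_const _)]
    simp
  simp only [Fin.sum_univ_two, this, lap]

lemma coord_fderiv {w : Plane → Plane} {x : Plane} (hw : DifferentiableAt ℝ w x) (i j : Fin 2) :
    fderiv ℝ w x (EuclideanSpace.single j 1) i = pd j (fun y => w y i) x := by
  have h : HasFDerivAt (fun y => w y i) ((EuclideanSpace.proj i : Plane →L[ℝ] ℝ) ∘L fderiv ℝ w x) x :=
    (EuclideanSpace.proj i : Plane →L[ℝ] ℝ).hasFDerivAt.comp x hw.hasFDerivAt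
  rw [pd, h.fderiv]; rfl

lemma divergence_eq {w : Plane → Plane} (hw : Differentiable ℝ w) (x : Plane) :
    divergence w x = ∑ j, pd j (fun y => w y j) x := by
  unfold divergence
  exact Finset.sum_congr rfl fun j _ => coord_fderiv (hw x) j j

lemma curl_eq {w : Plane → Plane} (hw : Differentiable ℝ w) (x : Plane) :
    curl w x = pd 0 (fun y => w y 1) x - pd 1 (fun y => w y 0) x := by
  unfold curl
  rw [coord_fderiv (hw x), coord_fderiv (hw x)]

lemma coord_laplacian {w : Plane → Plane} (hw : ContDiff ℝ ∞ w) (j : Fin 2) (x : Plane) :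
    (Δ w x) j = lap (fun y => w y j) x := by
  have h := (hw.contDiffAt (x := x)).of_le (m := 2) (by norm_cast)
  have h2 := h.laplacian_CLM_comp_left (l := (EuclideanSpace.proj j : Plane →L[ℝ] ℝ))
  exact h2.symm.trans
    (laplacian_eq_lap ((EuclideanSpace.proj j : Plane →L[ℝ] ℝ).contDiff.comp hw) x)

lemma coord_gradient (f : Plane → ℝ) (j : Fin 2) (x : Plane) :
    (gradient f x) j = pd j f x := by
  have := inner_gradient_left (𝕜 := ℝ) (f := f) (x := x) (y := EuclideanSpace.single j (1 : ℝ))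
  rw [EuclideanSpace.inner_single_right] at this
  simpa [pd] using this

/-- The system in components, for curves with values in all Sobolev spaces. -/
structure IsCurveSolution (a b c d T : ℝ) (η : ℝ → Plane → ℝ) (u : Fin 2 → ℝ → Plane → ℝ) :
    Prop where
  eta : SobCurve T η
  vel : ∀ j, SobCurve T (u j)
  eq_eta : ∀ t ∈ Icc 0 T, ∀ x, HasDerivWithinAt (fun τ => η τ x - b * lap (η τ) x)
    (-∑ j, pd j (fun y => a * lap (u j t) y + u j t y + η t y * u j t y) x) (Icc 0 T) t
  eq_vel : ∀ j, ∀ t ∈ Icc 0 T, ∀ x, HasDerivWithinAt (fun τ => u j τ x - d * lap (u j τ) x)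
    (-pd j (fun y => c * lap (η t) y + η t y + 1 / 2 * (u 0 t y ^ 2 + u 1 t y ^ 2)) x)
    (Icc 0 T) t

lemma sobolevNorm_fst_le (s : ℝ) (v : State) : sobolevNorm s v.1 ≤ State.sobolevNorm s v :=
  le_self_add

lemma sobolevNorm_snd_le (s : ℝ) (v : State) (j : Fin 2) :
    sobolevNorm s (fun x => v.2 x j) ≤ State.sobolevNorm s v :=
  (Finset.single_le_sum (f := fun j => sobolevNorm s (fun x => v.2 x j))
    (fun _ _ => zero_le) (Finset.mem_univ j)).trans le_add_self

variable {a b c d T : ℝ} {v : ℝ → State}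

lemma flux_coord (η : Plane → ℝ) {w : Plane → Plane} (hw : ContDiff ℝ ∞ w) (j : Fin 2)
    (y : Plane) : (a • Δ w y + w y + η y • w y) j =
      a * lap (fun y => w y j) y + w y j + η y * w y j := by
  simp only [PiLp.add_apply, PiLp.smul_apply, smul_eq_mul]
  rw [coord_laplacian hw]

lemma differentiable_flux {η : Plane → ℝ} {w : Plane → Plane} (hη : ContDiff ℝ ∞ η)
    (hw : ContDiff ℝ ∞ w) (hw' : ∀ j, HInf fun x => w x j) :
    Differentiable ℝ fun y => a • Δ w y + w y + η y • w y := by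
  rw [differentiable_euclidean]
  intro j
  simp only [flux_coord η hw]
  exact (((hw' j).lap.differentiable.const_mul a).add (hw' j).differentiable).add
    ((hη.differentiable (by simp)).mul (hw' j).differentiable)

lemma hasDerivWithinAt_plane {f : ℝ → Plane} {f' : Plane} {s : Set ℝ} {t : ℝ} :
    HasDerivWithinAt f f' s t ↔ ∀ j, HasDerivWithinAt (fun τ => f τ j) (f' j) s t := by
  simp only [hasDerivWithinAt_iff_hasFDerivWithinAt]
  rw [hasFDerivWithinAt_euclidean]
  refine forall_congr' fun j => ?_
  refine Eq.to_iff (congrArg₂ (fun A B => HasFDerivWithinAt A B s t) rfl ?_)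
  ext; simp

/-- The rest of the proof deals with scalar functions, for which the Fourier calculus of `IsSpec` is
available; this equivalence is the only bridge to the vector formulation. -/
lemma isSolution_iff : IsSolution a b c d T v ↔
    (∀ t ∈ Icc 0 T, ContDiff ℝ ∞ (v t).2) ∧
    IsCurveSolution a b c d T (fun t => (v t).1) (fun j t x => (v t).2 x j) ∧
    ∀ t ∈ Icc 0 T, ∀ x, pd 0 (fun y => (v t).2 y 1) x - pd 1 (fun y => (v t).2 y 0) x = 0 := by
  have hc : ∀ {w : Plane → Plane}, ContDiff ℝ ∞ w → ∀ j, ContDiff ℝ ∞ fun x => w x j :=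
    fun hw j => (EuclideanSpace.proj j : Plane →L[ℝ] ℝ).contDiff.comp hw
  have hdw : ∀ {w : Plane → Plane}, ContDiff ℝ ∞ w → Differentiable ℝ w :=
    fun hw => hw.differentiable (by simp)
  have hnorm : ∀ (w : Plane → Plane) (y : Plane), ‖w y‖ ^ 2 = w y 0 ^ 2 + w y 1 ^ 2 := by
    intro w y
    rw [EuclideanSpace.norm_sq_eq]; simp
  constructor
  · intro h
    have hη : ∀ t ∈ Icc 0 T, HInf (v t).1 := fun t ht => ⟨h.contDiff_eta t ht, fun s =>
      (sobolevNorm_fst_le s (v t)).trans_lt (h.finite s t ht)⟩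
    have hu : ∀ j, ∀ t ∈ Icc 0 T, HInf fun x => (v t).2 x j := fun j t ht =>
      ⟨hc (h.contDiff_u t ht) j, fun s =>
        (sobolevNorm_snd_le s (v t) j).trans_lt (h.finite s t ht)⟩
    refine ⟨h.contDiff_u, ⟨⟨hη, fun s t ht => ?_⟩, fun j => ⟨hu j, fun s t ht => ?_⟩,
      fun t ht x => ?_, fun j t ht x => ?_⟩, fun t ht x => ?_⟩
    · exact tendsto_of_tendsto_of_tendsto_of_le_of_le tendsto_const_nhds (h.continuous s t ht)
        (fun _ => zero_le) fun τ => sobolevNorm_fst_le s (v τ - v t)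
    · exact tendsto_of_tendsto_of_tendsto_of_le_of_le tendsto_const_nhds (h.continuous s t ht)
        (fun _ => zero_le) fun τ => sobolevNorm_snd_le s (v τ - v t) j
    · have := h.eq_eta t ht x
      rw [divergence_eq (differentiable_flux (h.contDiff_eta t ht) (h.contDiff_u t ht)
        fun j => hu j t ht)] at this
      simp only [flux_coord _ (h.contDiff_u t ht)] at this
      refine this.congr (fun τ hτ => ?_) ?_
      · rw [laplacian_eq_lap (h.contDiff_eta τ hτ)]
      · rw [laplacian_eq_lap (h.contDiff_eta t ht)]
    · have := hasDerivWithinAt_plane.1 (h.eq_u t ht x) j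
      rw [PiLp.neg_apply, coord_gradient] at this
      simp only [laplacian_eq_lap (h.contDiff_eta t ht), hnorm] at this
      refine this.congr (fun τ hτ => ?_) ?_
      · simp only [PiLp.sub_apply, PiLp.smul_apply, smul_eq_mul]
        rw [coord_laplacian (h.contDiff_u τ hτ)]
      · simp only [PiLp.sub_apply, PiLp.smul_apply, smul_eq_mul]
        rw [coord_laplacian (h.contDiff_u t ht)]
    · rw [← curl_eq (hdw (h.contDiff_u t ht))]
      exact h.irrotational t ht x
  · rintro ⟨hcu, h, hcurl⟩
    have hη := h.eta.hInf
    have hu := fun j => (h.vel j).hInf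
    refine ⟨fun t ht => (hη t ht).contDiff, hcu, fun s t ht => ?_, fun s t ht => ?_,
      fun t ht x => ?_, fun t ht x => ?_, fun t ht x => ?_⟩
    · refine ENNReal.add_lt_top.2 ⟨(hη t ht).finite s, ?_⟩
      exact ENNReal.sum_lt_top.2 fun j _ => (hu j t ht).finite s
    · have h1 := (h.eta.tendsto s t ht).add (tendsto_finsetSum Finset.univ
        fun j _ => (h.vel j).tendsto s t ht)
      rw [Finset.sum_const_zero, add_zero] at h1
      exact h1
    · rw [curl_eq (hdw (hcu t ht))]; exact hcurl t ht x
    · have := h.eq_eta t ht x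
      rw [divergence_eq (differentiable_flux (hη t ht).contDiff (hcu t ht) fun j => hu j t ht)]
      simp only [flux_coord _ (hcu t ht)]
      refine this.congr (fun τ hτ => ?_) ?_
      · rw [laplacian_eq_lap (hη τ hτ).contDiff]
      · rw [laplacian_eq_lap (hη t ht).contDiff]
    · rw [hasDerivWithinAt_plane]
      intro j
      rw [PiLp.neg_apply, coord_gradient]
      simp only [laplacian_eq_lap (hη t ht).contDiff, hnorm]
      refine (h.eq_vel j t ht x).congr (fun τ hτ => ?_) ?_
      · simp only [PiLp.sub_apply, PiLp.smul_apply, smul_eq_mul]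
        rw [coord_laplacian (hcu τ hτ)]
      · simp only [PiLp.sub_apply, PiLp.smul_apply, smul_eq_mul]
        rw [coord_laplacian (hcu t ht)]

end Boussinesq

end
-- The difference of two solutions and its energy
noncomputable section

namespace Boussinesq

/-- The symbols commute. -/
lemma pd_comm {f : Plane → ℝ} (hf : HInf f) (i j : Fin 2) : pd i (pd j f) = pd j (pd i f) := by
  obtain ⟨g, h⟩ := hf.exists_isSpec
  funext x
  have h1 := ((h.pd j).pd i).eq x
  have h2 := ((h.pd i).pd j).eq x
  have : (fun ξ => sym i ξ * (sym j ξ * g ξ)) = fun ξ => sym j ξ * (sym i ξ * g ξ) := by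
    funext ξ; ring
  rw [this, ← h2] at h1
  exact_mod_cast h1

lemma pd_lap {f : Plane → ℝ} (hf : HInf f) (j : Fin 2) : pd j (lap f) = lap (pd j f) := by
  have : lap f = fun x => pd 0 (pd 0 f) x + pd 1 (pd 1 f) x := rfl
  rw [this, ((hf.pd 0).pd 0).pd_add ((hf.pd 1).pd 1), pd_comm (hf.pd 0) j 0, pd_comm hf j 0,
    pd_comm (hf.pd 1) j 1, pd_comm hf j 1]
  rfl

/-- The square of the `H¹` norm. -/
def h1sq (f : Plane → ℝ) : ℝ := ip f f + ip (pd 0 f) (pd 0 f) + ip (pd 1 f) (pd 1 f)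

lemma ip_self_le_h1sq (f : Plane → ℝ) : ip f f ≤ h1sq f := by
  have := ip_self_nonneg (pd 0 f)
  have := ip_self_nonneg (pd 1 f)
  unfold h1sq; linarith

lemma h1sq_nonneg (f : Plane → ℝ) : 0 ≤ h1sq f := (ip_self_nonneg f).trans (ip_self_le_h1sq f)

lemma ip_pd_le_h1sq (f : Plane → ℝ) (j : Fin 2) : ip (pd j f) (pd j f) ≤ h1sq f := by
  have := ip_self_nonneg f
  have := ip_self_nonneg (pd 0 f)
  have := ip_self_nonneg (pd 1 f)
  unfold h1sq
  fin_cases j <;> simp <;> linarith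

lemma ip_add_self_le {f g : Plane → ℝ} (hf : HInf f) (hg : HInf g) :
    ip (fun x => f x + g x) (fun x => f x + g x) ≤ 2 * (ip f f + ip g g) := by
  rw [ip_add_left hf hg (hf.add hg), ip_add_right hf hg hf, ip_add_right hf hg hg, ip_comm g f]
  have := (abs_le.1 (abs_ip_le hf hg)).2
  linarith

lemma ip_mul_self_le {f m : Plane → ℝ} (hf : HInf f) (hm : HInf m) {M : ℝ}
    (h : ∀ x, |m x| ≤ M) :
    ip (fun x => f x * m x) (fun x => f x * m x) ≤ M ^ 2 * ip f f := by
  refine ip_self_le (hf.mul hm) hf fun x => ?_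
  rw [abs_mul, mul_comm]
  exact mul_le_mul_of_nonneg_right (h x) (abs_nonneg _)

lemma ip_pd_mul_self_le {f m : Plane → ℝ} (hf : HInf f) (hm : HInf m) {M : ℝ} (j : Fin 2)
    (h : ∀ x, |m x| ≤ M) (h' : ∀ x, |pd j m x| ≤ M) :
    ip (pd j fun x => f x * m x) (pd j fun x => f x * m x) ≤ 4 * M ^ 2 * h1sq f := by
  rw [hf.pd_mul hm]
  refine (ip_add_self_le (hf.mul (hm.pd j)) (hm.mul (hf.pd j))).trans ?_
  have h1 := ip_mul_self_le hf (hm.pd j) h'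
  have h2 := ip_mul_self_le (hf.pd j) hm h
  have e : (fun x => m x * pd j f x) = fun x => pd j f x * m x := by funext x; ring
  rw [e]
  have := mul_le_mul_of_nonneg_left (ip_self_le_h1sq f) (sq_nonneg M)
  have := mul_le_mul_of_nonneg_left (ip_pd_le_h1sq f j) (sq_nonneg M)
  linarith

/-- The equation for the difference `(ζ, w)` of two solutions with the average `(N, U)`. -/
structure IsDifference (a b c d T : ℝ) (ζ : ℝ → Plane → ℝ) (w : Fin 2 → ℝ → Plane → ℝ)
    (N : ℝ → Plane → ℝ) (U : Fin 2 → ℝ → Plane → ℝ) : Prop where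
  eta : SobCurve T ζ
  vel : ∀ j, SobCurve T (w j)
  avg_eta : SobCurve T N
  avg_vel : ∀ j, SobCurve T (U j)
  eq_eta : ∀ t ∈ Icc 0 T, ∀ x, HasDerivWithinAt (fun τ => ζ τ x - b * lap (ζ τ) x)
    (-(pd 0 (fun y => (w 0 t y + a * lap (w 0 t) y) + (ζ t y * U 0 t y + w 0 t y * N t y)) x +
      pd 1 (fun y => (w 1 t y + a * lap (w 1 t) y) + (ζ t y * U 1 t y + w 1 t y * N t y)) x))
    (Icc 0 T) t
  eq_vel : ∀ j, ∀ t ∈ Icc 0 T, ∀ x, HasDerivWithinAt (fun τ => w j τ x - d * lap (w j τ) x)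
    (-pd j (fun y => (ζ t y + c * lap (ζ t) y) + (w 0 t y * U 0 t y + w 1 t y * U 1 t y)) x)
    (Icc 0 T) t

variable {a b c d T : ℝ}

lemma SobCurve.flux {f p q r s : ℝ → Plane → ℝ} (hf : SobCurve T f) (a : ℝ) (hp : SobCurve T p)
    (hq : SobCurve T q) (hr : SobCurve T r) (hs : SobCurve T s) :
    SobCurve T fun t y => (f t y + a * Boussinesq.lap (f t) y) + (p t y * q t y + r t y * s t y) :=
  (hf.add (hf.lap.const_mul a)).add ((hp.mul hq).add (hr.mul hs))

/-- The nonlinearity is quadratic, so the difference of two values is exactly bilinear in the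
difference and the average: `ηu - η'u' = ζU + wN`. Choosing the average as coefficient leaves no
quadratic remainder and keeps the Hamiltonian structure of the linearized system. -/
lemma IsCurveSolution.isDifference {η η' : ℝ → Plane → ℝ} {u u' : Fin 2 → ℝ → Plane → ℝ}
    (h : IsCurveSolution a b c d T η u) (h' : IsCurveSolution a b c d T η' u') :
    IsDifference a b c d T (fun t x => η t x - η' t x) (fun j t x => u j t x - u' j t x)
      (fun t x => 1 / 2 * (η t x + η' t x)) (fun j t x => 1 / 2 * (u j t x + u' j t x)) := by
  refine ⟨h.eta.sub h'.eta, fun j => (h.vel j).sub (h'.vel j), (h.eta.add h'.eta).const_mul _,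
    fun j => ((h.vel j).add (h'.vel j)).const_mul _, fun t ht x => ?_, fun j t ht x => ?_⟩
  · have h0 := (h.eq_eta t ht x).sub (h'.eq_eta t ht x)
    have hη := h.eta.hInf t ht
    have hη' := h'.eta.hInf t ht
    have hu := fun j => (h.vel j).hInf t ht
    have hu' := fun j => (h'.vel j).hInf t ht
    have key : ∀ j, pd j (fun y => ((u j t y - u' j t y) +
        a * lap (fun x => u j t x - u' j t x) y) + ((η t y - η' t y) *
          (1 / 2 * (u j t y + u' j t y)) + (u j t y - u' j t y) * (1 / 2 * (η t y + η' t y)))) x =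
        pd j (fun y => a * lap (u j t) y + u j t y + η t y * u j t y) x -
        pd j (fun y => a * lap (u' j t) y + u' j t y + η' t y * u' j t y) x := by
      intro j
      have h1 := (((hu j).lap.const_mul a).add (hu j)).add (hη.mul (hu j))
      have h2 := (((hu' j).lap.const_mul a).add (hu' j)).add (hη'.mul (hu' j))
      refine Eq.trans ?_ (congrFun (h1.pd_sub h2 j) x)
      congr 1; funext y
      rw [(hu j).lap_sub (hu' j)]; ring
    refine (h0.congr_deriv ?_).congr (fun τ hτ => ?_) ?_
    · rw [key, key, Fin.sum_univ_two, Fin.sum_univ_two]; ring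
    · rw [(h.eta.hInf τ hτ).lap_sub (h'.eta.hInf τ hτ)]; simp only [Pi.sub_apply]; ring
    · rw [hη.lap_sub hη']; simp only [Pi.sub_apply]; ring
  · have h0 := (h.eq_vel j t ht x).sub (h'.eq_vel j t ht x)
    have hη := h.eta.hInf t ht
    have hη' := h'.eta.hInf t ht
    have hu := fun j => (h.vel j).hInf t ht
    have hu' := fun j => (h'.vel j).hInf t ht
    have e1 : ∀ (η : Plane → ℝ) (u : Fin 2 → Plane → ℝ),
        (fun y => c * lap η y + η y + 1 / 2 * (u 0 y ^ 2 + u 1 y ^ 2)) = fun y =>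
        c * lap η y + η y + 1 / 2 * (u 0 y * u 0 y + u 1 y * u 1 y) := fun η u => by
      funext y; ring
    have h1 := ((hη.lap.const_mul c).add hη).add
      ((((hu 0).mul (hu 0)).add ((hu 1).mul (hu 1))).const_mul (1 / 2))
    have h2 := ((hη'.lap.const_mul c).add hη').add
      ((((hu' 0).mul (hu' 0)).add ((hu' 1).mul (hu' 1))).const_mul (1 / 2))
    refine (h0.congr_deriv ?_).congr (fun τ hτ => ?_) ?_
    · rw [e1 (η t) (fun j => u j t), e1 (η' t) (fun j => u' j t), neg_sub_neg, ← neg_sub,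
        ← congrFun (h1.pd_sub h2 j) x]
      congr 2; funext y
      rw [hη.lap_sub hη']; ring
    · rw [((h.vel j).hInf τ hτ).lap_sub ((h'.vel j).hInf τ hτ)]; simp only [Pi.sub_apply]; ring
    · rw [(hu j).lap_sub (hu' j)]; simp only [Pi.sub_apply]; ring

namespace IsDifference

variable {ζ N : ℝ → Plane → ℝ} {w U : Fin 2 → ℝ → Plane → ℝ}

lemma exists_bound (h : IsDifference a b c d T ζ w N U) : ∃ M : ℝ, ∀ t ∈ Icc 0 T, ∀ x,
    |N t x| ≤ M ∧ (∀ j, |pd j (N t) x| ≤ M) ∧ (∀ i, |U i t x| ≤ M) ∧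
      ∀ i j, |pd j (U i t) x| ≤ M := by
  obtain ⟨M0, p0, h0⟩ := h.avg_eta.exists_bound
  choose M1 p1 h1 using fun j => (h.avg_eta.pd j).exists_bound
  choose M2 p2 h2 using fun i => (h.avg_vel i).exists_bound
  choose M3 p3 h3 using fun i j => ((h.avg_vel i).pd j).exists_bound
  have s1 := Finset.sum_nonneg fun j (_ : j ∈ Finset.univ) => p1 j
  have s2 := Finset.sum_nonneg fun j (_ : j ∈ Finset.univ) => p2 j
  have s3 := Finset.sum_nonneg fun i (_ : i ∈ Finset.univ) =>
    Finset.sum_nonneg fun j (_ : j ∈ Finset.univ) => p3 i j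
  refine ⟨M0 + ∑ j, M1 j + ∑ j, M2 j + ∑ i, ∑ j, M3 i j, fun t ht x =>
    ⟨?_, fun j => ?_, fun i => ?_, fun i j => ?_⟩⟩
  · linarith [h0 t ht x]
  · have := Finset.single_le_sum (f := M1) (fun j _ => p1 j) (Finset.mem_univ j)
    linarith [h1 j t ht x]
  · have := Finset.single_le_sum (f := M2) (fun j _ => p2 j) (Finset.mem_univ i)
    linarith [h2 i t ht x]
  · have e1 := Finset.single_le_sum (f := M3 i) (fun j _ => p3 i j) (Finset.mem_univ j)
    have e2 := Finset.single_le_sum (f := fun i => ∑ j, M3 i j)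
      (fun i _ => Finset.sum_nonneg fun j _ => p3 i j) (Finset.mem_univ i)
    linarith [h3 i j t ht x]

end IsDifference

/-- Divergence and minus the gradient are adjoint, so the linear fluxes cancel and only the products
with the averages survive. It is applied with `p = (1 + cΔ)ζ` and `q = (1 + aΔ)w`. -/
lemma ip_flux_cancel {p q0 q1 g0 g1 h : Plane → ℝ} (hp : HInf p) (hq0 : HInf q0) (hq1 : HInf q1)
    (hg0 : HInf g0) (hg1 : HInf g1) (hh : HInf h) :
    ip (fun x => -(pd 0 (fun y => q0 y + g0 y) x + pd 1 (fun y => q1 y + g1 y) x)) p +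
      (ip (fun x => -pd 0 (fun y => p y + h y) x) q0 +
        ip (fun x => -pd 1 (fun y => p y + h y) x) q1) =
    -(ip (pd 0 g0) p + ip (pd 1 g1) p + ip (pd 0 h) q0 + ip (pd 1 h) q1) := by
  rw [ip_neg_left, ip_neg_left, ip_neg_left, hq0.pd_add hg0, hq1.pd_add hg1, hp.pd_add hh,
    hp.pd_add hh, ip_add_left ((hq0.pd 0).add (hg0.pd 0)) ((hq1.pd 1).add (hg1.pd 1)) hp,
    ip_add_left (hq0.pd 0) (hg0.pd 0) hp, ip_add_left (hq1.pd 1) (hg1.pd 1) hp,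
    ip_add_left (hp.pd 0) (hh.pd 0) hq0, ip_add_left (hp.pd 1) (hh.pd 1) hq1,
    ip_pd_left hp hq0, ip_pd_left hp hq1, ip_comm p, ip_comm p]
  ring

lemma ip_symbols {f g : Plane → ℝ} (hf : HInf f) (hg : HInf g) (b c : ℝ) :
    ip (fun x => f x - b * lap f x) (fun x => g x + c * lap g x) =
      ip f g + (b - c) * (ip (pd 0 f) (pd 0 g) + ip (pd 1 f) (pd 1 g)) -
        b * c * ip (lap f) (lap g) := by
  have e : (fun x => f x - b * lap f x) = fun x => f x + (-b) * lap f x := by funext x; ring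
  rw [e, ip_add_left hf (hf.lap.const_mul _) (hg.add (hg.lap.const_mul _)),
    ip_add_right hg (hg.lap.const_mul _) hf,
    ip_add_right hg (hg.lap.const_mul _) (hf.lap.const_mul _), ip_const_mul_left,
    ip_const_mul_left, ip_const_mul_right, ip_const_mul_right, ← ip_lap_comm hf hg,
    ip_lap_left hf hg]
  ring

/-- The symmetry required by `SobCurve.hasDerivWithinAt_ip_of_symm`: both operators are functions of
the Laplacian. -/
lemma ip_symbols_comm {f g : Plane → ℝ} (hf : HInf f) (hg : HInf g) (b c : ℝ) :
    ip (fun x => f x - b * lap f x) (fun x => g x + c * lap g x) =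
      ip (fun x => g x - b * lap g x) (fun x => f x + c * lap f x) := by
  rw [ip_symbols hf hg, ip_symbols hg hf, ip_comm f, ip_comm (pd 0 f), ip_comm (pd 1 f),
    ip_comm (lap f)]

/-- With `b > 0 ≥ c` the pairing is a sum of nonnegative terms that contains `‖f‖² + b‖∇f‖²`; the
factor `1 + 1 / b` makes both coefficients at least one. -/
lemma h1sq_le_energy {f : Plane → ℝ} (hf : HInf f) {b c : ℝ} (hb : 0 < b) (hc : c ≤ 0) :
    h1sq f ≤ (1 + 1 / b) * ip (fun x => f x - b * lap f x) (fun x => f x + c * lap f x) := by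
  rw [ip_symbols hf hf]
  have h0 := ip_self_nonneg f
  have h1 := ip_self_nonneg (pd 0 f)
  have h2 := ip_self_nonneg (pd 1 f)
  have h3 := ip_self_nonneg (lap f)
  have hbc : 0 ≤ -(b * c) * ip (lap f) (lap f) := mul_nonneg (by nlinarith) h3
  have hE : ip f f + b * (ip (pd 0 f) (pd 0 f) + ip (pd 1 f) (pd 1 f)) ≤
      ip f f + (b - c) * (ip (pd 0 f) (pd 0 f) + ip (pd 1 f) (pd 1 f)) -
        b * c * ip (lap f) (lap f) := by nlinarith
  refine le_trans ?_ (mul_le_mul_of_nonneg_left hE (by positivity))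
  have e : (1 + 1 / b) * (ip f f + b * (ip (pd 0 f) (pd 0 f) + ip (pd 1 f) (pd 1 f))) =
      h1sq f + b * (ip (pd 0 f) (pd 0 f) + ip (pd 1 f) (pd 1 f)) + 1 / b * ip f f := by
    unfold h1sq; field_simp; ring
  rw [e]
  have : 0 ≤ 1 / b * ip f f := by positivity
  have : 0 ≤ b * (ip (pd 0 f) (pd 0 f) + ip (pd 1 f) (pd 1 f)) := by positivity
  linarith

/-- The second derivatives appear on the left only as `c²‖Δf‖²`, which is `-c / b` times the term
`-bc‖Δf‖²` of the energy. So the bound also holds for `c = 0`, when the energy does not see `Δf`. -/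
lemma ip_symbol_self_le_energy {f : Plane → ℝ} (hf : HInf f) {b c : ℝ} (hb : 0 < b) (hc : c ≤ 0) :
    ip (fun x => f x + c * lap f x) (fun x => f x + c * lap f x) ≤
      (2 + 2 * (-c / b)) * ip (fun x => f x - b * lap f x) (fun x => f x + c * lap f x) := by
  refine (ip_add_self_le hf (hf.lap.const_mul c)).trans ?_
  rw [ip_symbols hf hf, ip_const_mul_left, ip_const_mul_right]
  have h0 := ip_self_nonneg f
  have h1 := ip_self_nonneg (pd 0 f)
  have h2 := ip_self_nonneg (pd 1 f)
  have h3 := ip_self_nonneg (lap f)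
  have hcb : 0 ≤ -c / b := div_nonneg (by linarith) hb.le
  have e1 : c * (c * ip (lap f) (lap f)) = (-c / b) * (-(b * c) * ip (lap f) (lap f)) := by
    field_simp
  have hbc : 0 ≤ -(b * c) * ip (lap f) (lap f) := mul_nonneg (by nlinarith) h3
  have h4 : 0 ≤ (b - c) * (ip (pd 0 f) (pd 0 f) + ip (pd 1 f) (pd 1 f)) :=
    mul_nonneg (by linarith) (by linarith)
  rw [e1]
  have := mul_nonneg hcb h0
  have := mul_nonneg hcb h4
  nlinarith

end Boussinesq

end
-- Uniqueness by energy estimates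
noncomputable section

namespace Boussinesq

variable {a b c d T : ℝ} {ζ N : ℝ → Plane → ℝ} {w U : Fin 2 → ℝ → Plane → ℝ}

lemma two_mul_abs_ip_le {f g : Plane → ℝ} (hf : HInf f) (hg : HInf g) :
    2 * |ip f g| ≤ ip f f + ip g g := by
  have := abs_ip_le hf hg
  linarith

/-- The flux is linear in the difference with bounded smooth coefficients, so its derivative costs
one derivative of the difference. -/
lemma ip_pd_flux_le {f g m n : Plane → ℝ} (hf : HInf f) (hg : HInf g) (hm : HInf m) (hn : HInf n)
    {M : ℝ} (j : Fin 2) (h1 : ∀ x, |m x| ≤ M) (h2 : ∀ x, |pd j m x| ≤ M) (h3 : ∀ x, |n x| ≤ M)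
    (h4 : ∀ x, |pd j n x| ≤ M) :
    ip (pd j fun x => f x * m x + g x * n x) (pd j fun x => f x * m x + g x * n x) ≤
      8 * M ^ 2 * (h1sq f + h1sq g) := by
  rw [(hf.mul hm).pd_add (hg.mul hn)]
  refine (ip_add_self_le ((hf.mul hm).pd j) ((hg.mul hn).pd j)).trans ?_
  have := ip_pd_mul_self_le hf hm j h1 h2
  have := ip_pd_mul_self_le hg hn j h3 h4
  linarith

/-- Grönwall's inequality with zero initial value. -/
lemma eq_zero_of_energy {E E' : ℝ → ℝ} {K : ℝ}
    (hd : ∀ t ∈ Icc 0 T, HasDerivWithinAt E (E' t) (Icc 0 T) t)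
    (h0 : E 0 = 0) (hE : ∀ t ∈ Icc 0 T, |E' t| ≤ K * |E t|) : ∀ t ∈ Icc 0 T, E t = 0 := by
  refine eq_zero_of_abs_deriv_le_mul_abs_self_of_eq_zero_right
    (fun t ht => (hd t ht).continuousWithinAt) (fun t ht => ?_) h0
    fun t ht => hE t (Ico_subset_Icc_self ht)
  have := hd t (Ico_subset_Icc_self ht)
  exact this.mono_of_mem_nhdsWithin (Icc_mem_nhdsGE_of_mem ht)

lemma ip_zero_left (f : Plane → ℝ) : ip (fun _ => 0) f = 0 := by simp [ip]

lemma pd_zero (j : Fin 2) : pd j (fun _ => 0) = fun _ => 0 := by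
  funext x; simp [pd]

lemma lap_zero : lap (fun _ => 0) = fun _ => 0 := by
  funext x; simp [lap, pd_zero]

/-- Uniqueness when both equations are regularized. -/
lemma IsDifference.eq_zero_of_regularized (h : IsDifference a b c d T ζ w N U) (ha : a ≤ 0)
    (hc : c ≤ 0) (hb : 0 < b) (hd : 0 < d) (hζ0 : ∀ x, ζ 0 x = 0) (hw0 : ∀ j x, w j 0 x = 0) :
    ∀ t ∈ Icc 0 T, ∀ x, ζ t x = 0 ∧ ∀ j, w j t x = 0 := by
  obtain ⟨M, hM⟩ := h.exists_bound
  -- Each equation is paired with the variable dual to it in the linear system: mass with `(1 +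
  -- cΔ)ζ`, momentum with `(1 + aΔ)w`. This is what makes the unregularized linear fluxes, of third
  -- order, cancel.
  set E : ℝ → ℝ := fun t =>
    ip (fun x => ζ t x - b * lap (ζ t) x) (fun x => ζ t x + c * lap (ζ t) x) +
    (ip (fun x => w 0 t x - d * lap (w 0 t) x) (fun x => w 0 t x + a * lap (w 0 t) x) +
      ip (fun x => w 1 t x - d * lap (w 1 t) x) (fun x => w 1 t x + a * lap (w 1 t) x)) with hE
  have hY : ∀ j, SobCurve T fun t y => (w j t y + a * lap (w j t) y) +
      (ζ t y * U j t y + w j t y * N t y) := fun j =>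
    (h.vel j).flux a h.eta (h.avg_vel j) (h.vel j) h.avg_eta
  have hX : SobCurve T fun t y => (ζ t y + c * lap (ζ t) y) +
      (w 0 t y * U 0 t y + w 1 t y * U 1 t y) :=
    h.eta.flux c (h.vel 0) (h.avg_vel 0) (h.vel 1) (h.avg_vel 1)
  have hP : SobCurve T fun t x => ζ t x - b * lap (ζ t) x := h.eta.sub (h.eta.lap.const_mul b)
  have hC : SobCurve T fun t x => ζ t x + c * lap (ζ t) x := h.eta.add (h.eta.lap.const_mul c)
  have hQ : ∀ j, SobCurve T fun t x => w j t x - d * lap (w j t) x := fun j =>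
    (h.vel j).sub ((h.vel j).lap.const_mul d)
  have hA : ∀ j, SobCurve T fun t x => w j t x + a * lap (w j t) x := fun j =>
    (h.vel j).add ((h.vel j).lap.const_mul a)
  have d1 := fun t (ht : t ∈ Icc 0 T) => hP.hasDerivWithinAt_ip_of_symm
    (((hY 0).pd 0).add ((hY 1).pd 1)).neg hC h.eq_eta
    (fun s hs t ht => ip_symbols_comm (h.eta.hInf s hs) (h.eta.hInf t ht) b c) ht
  have d2 := fun j t (ht : t ∈ Icc 0 T) => (hQ j).hasDerivWithinAt_ip_of_symm
    (hX.pd j).neg (hA j) (h.eq_vel j)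
    (fun s hs t ht => ip_symbols_comm ((h.vel j).hInf s hs) ((h.vel j).hInf t ht) d a) ht
  have hK1 : 0 ≤ 1 / b := by positivity
  have hK1' : 0 ≤ 1 / d := by positivity
  have hK2 : 0 ≤ -c / b := div_nonneg (by linarith) hb.le
  have hK3 : 0 ≤ -a / d := div_nonneg (by linarith) hd.le
  have hEζ := fun t (ht : t ∈ Icc 0 T) => h1sq_le_energy (h.eta.hInf t ht) hb hc
  have hEw := fun j t (ht : t ∈ Icc 0 T) => h1sq_le_energy ((h.vel j).hInf t ht) hd ha
  -- The constant comes from `2|⟨f, g⟩| ≤ ‖f‖² + ‖g‖²` on the four surviving terms. Each squared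
  -- `H¹` norm then occurs at most three times with the factor `8M²`, and the squared norms of `(1 +
  -- cΔ)ζ` and `(1 + aΔ)w` at most twice.
  have key := eq_zero_of_energy (T := T) (E := E)
    (K := 24 * M ^ 2 * ((1 + 1 / b) + (1 + 1 / d)) + 2 * (2 + 2 * (-c / b)) + 2 * (2 + 2 * (-a / d)))
    (fun t ht => (d1 t ht).add ((d2 0 t ht).add (d2 1 t ht))) ?_ ?_
  · intro t ht x
    have hz := key t ht
    have e0 := (h1sq_nonneg _).trans (hEζ t ht)
    have e1 := fun j => (h1sq_nonneg _).trans (hEw j t ht)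
    have f0 := nonneg_of_mul_nonneg_right e0 (by positivity)
    have f1 := fun j => nonneg_of_mul_nonneg_right (e1 j) (by positivity)
    have g0 := f1 0
    have g1 := f1 1
    simp only [hE] at hz
    have z0 : ip (ζ t) (ζ t) = 0 := by
      refine le_antisymm ((ip_self_le_h1sq _).trans ((hEζ t ht).trans (le_of_eq ?_)))
        (ip_self_nonneg _)
      rw [mul_eq_zero]; right; linarith
    have z1 : ∀ j, ip (w j t) (w j t) = 0 := by
      intro j
      refine le_antisymm ((ip_self_le_h1sq _).trans ((hEw j t ht).trans (le_of_eq ?_)))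
        (ip_self_nonneg _)
      rw [mul_eq_zero]; right
      fin_cases j <;> simp only [Fin.zero_eta, Fin.mk_one] <;> linarith
    exact ⟨(h.eta.hInf t ht).eq_zero_of_ip z0 x, fun j => ((h.vel j).hInf t ht).eq_zero_of_ip (z1 j) x⟩
  · have i0 : ζ 0 = fun _ => 0 := funext hζ0
    have i1 : ∀ j, w j 0 = fun _ => 0 := fun j => funext (hw0 j)
    simp only [hE, i0, i1, lap_zero, mul_zero, sub_zero, ip_zero_left, add_zero]
  · intro t ht
    have hζ := h.eta.hInf t ht
    have hw := fun j => (h.vel j).hInf t ht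
    have hN := h.avg_eta.hInf t ht
    have hU := fun j => (h.avg_vel j).hInf t ht
    have hg := fun j => (hζ.mul (hU j)).add ((hw j).mul hN)
    have hh := ((hw 0).mul (hU 0)).add ((hw 1).mul (hU 1))
    have hp := hC.hInf t ht
    have hq := fun j => (hA j).hInf t ht
    have hM' := hM t ht
    have bg := fun j => ip_pd_flux_le hζ (hw j) (hU j) hN j (fun x => (hM' x).2.2.1 j)
      (fun x => (hM' x).2.2.2 j j) (fun x => (hM' x).1) (fun x => (hM' x).2.1 j)
    have bh := fun j => ip_pd_flux_le (hw 0) (hw 1) (hU 0) (hU 1) j (fun x => (hM' x).2.2.1 0)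
      (fun x => (hM' x).2.2.2 0 j) (fun x => (hM' x).2.2.1 1) (fun x => (hM' x).2.2.2 1 j)
    have bp := ip_symbol_self_le_energy hζ hb hc
    have bq := fun j => ip_symbol_self_le_energy (hw j) hd ha
    have a0 := two_mul_abs_ip_le ((hg 0).pd 0) hp
    have a1 := two_mul_abs_ip_le ((hg 1).pd 1) hp
    have a2 := two_mul_abs_ip_le (hh.pd 0) (hq 0)
    have a3 := two_mul_abs_ip_le (hh.pd 1) (hq 1)
    rw [← mul_add, ← mul_add, ip_flux_cancel hp (hq 0) (hq 1) (hg 0) (hg 1) hh, mul_neg, abs_neg,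
      abs_mul, abs_two]
    have bg0 := bg 0
    have bg1 := bg 1
    have bh0 := bh 0
    have bh1 := bh 1
    have bq0 := bq 0
    have bq1 := bq 1
    have c0 := hEζ t ht
    have c1 := hEw 0 t ht
    have c2 := hEw 1 t ht
    have n0 := nonneg_of_mul_nonneg_right ((h1sq_nonneg _).trans c0) (by positivity)
    have n1 := nonneg_of_mul_nonneg_right ((h1sq_nonneg _).trans c1) (by positivity)
    have n2 := nonneg_of_mul_nonneg_right ((h1sq_nonneg _).trans c2) (by positivity)
    have hEn : |E t| = E t := abs_of_nonneg (add_nonneg n0 (add_nonneg n1 n2))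
    rw [hEn]
    simp only [hE]
    set A := ip (fun x => ζ t x - b * lap (ζ t) x) (fun x => ζ t x + c * lap (ζ t) x)
    set B0 := ip (fun x => w 0 t x - d * lap (w 0 t) x) (fun x => w 0 t x + a * lap (w 0 t) x)
    set B1 := ip (fun x => w 1 t x - d * lap (w 1 t) x) (fun x => w 1 t x + a * lap (w 1 t) x)
    set α := 1 / b
    set β := 1 / d
    set γ := -c / b
    set δ := -a / d
    have tri := (abs_add_le (ip (pd 0 fun x => ζ t x * U 0 t x + w 0 t x * N t x)
      (fun x => ζ t x + c * lap (ζ t) x) +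
      ip (pd 1 fun x => ζ t x * U 1 t x + w 1 t x * N t x) (fun x => ζ t x + c * lap (ζ t) x) +
      ip (pd 0 fun x => w 0 t x * U 0 t x + w 1 t x * U 1 t x)
        (fun x => w 0 t x + a * lap (w 0 t) x))
      (ip (pd 1 fun x => w 0 t x * U 0 t x + w 1 t x * U 1 t x)
        (fun x => w 1 t x + a * lap (w 1 t) x)))
    have tri2 := abs_add_three (ip (pd 0 fun x => ζ t x * U 0 t x + w 0 t x * N t x)
      (fun x => ζ t x + c * lap (ζ t) x))
      (ip (pd 1 fun x => ζ t x * U 1 t x + w 1 t x * N t x) (fun x => ζ t x + c * lap (ζ t) x))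
      (ip (pd 0 fun x => w 0 t x * U 0 t x + w 1 t x * U 1 t x)
        (fun x => w 0 t x + a * lap (w 0 t) x))
    have m0 := mul_le_mul_of_nonneg_left c0 (sq_nonneg M)
    have m1 := mul_le_mul_of_nonneg_left c1 (sq_nonneg M)
    have m2 := mul_le_mul_of_nonneg_left c2 (sq_nonneg M)
    have p1 : 0 ≤ M ^ 2 * ((1 + α) * A) := by positivity
    have p2 : 0 ≤ M ^ 2 * ((1 + β) * A) := by positivity
    have p3 : 0 ≤ M ^ 2 * ((1 + α) * B0) := by positivity
    have p4 : 0 ≤ M ^ 2 * ((1 + β) * B0) := by positivity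
    have p5 : 0 ≤ M ^ 2 * ((1 + α) * B1) := by positivity
    have p6 : 0 ≤ M ^ 2 * ((1 + β) * B1) := by positivity
    have q1 : 0 ≤ γ * B0 := by positivity
    have q2 : 0 ≤ γ * B1 := by positivity
    have q3 : 0 ≤ δ * A := by positivity
    have q4 : 0 ≤ δ * B0 := by positivity
    have q5 : 0 ≤ δ * B1 := by positivity
    linarith

lemma ip_add_mul_self {f : Plane → ℝ} (hf : HInf f) (c : ℝ) :
    ip f (fun x => f x + c * lap f x) =
      ip f f - c * (ip (pd 0 f) (pd 0 f) + ip (pd 1 f) (pd 1 f)) := by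
  rw [ip_add_right hf (hf.lap.const_mul c) hf, ip_const_mul_right, ip_comm f (lap f),
    ip_lap_left hf hf]
  ring

lemma ip_mul_left_comm (f g h : Plane → ℝ) :
    ip f (fun x => g x * h x) = ip g (fun x => f x * h x) := by
  unfold ip; congr 1; funext x; ring

/-- Since both equations have the same dispersion coefficient, the linear flow preserves the plain
`L²` norm: `1 + cΔ` is self-adjoint and commutes with derivatives. -/
lemma ip_linear_flux_cancel {p q0 q1 : Plane → ℝ} (hp : HInf p) (hq0 : HInf q0) (hq1 : HInf q1)
    (c : ℝ) :
    ip (pd 0 fun y => q0 y + c * lap q0 y) p + ip (pd 1 fun y => q1 y + c * lap q1 y) p +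
      (ip (pd 0 fun y => p y + c * lap p y) q0 + ip (pd 1 fun y => p y + c * lap p y) q1) = 0 := by
  have e : ∀ {q : Plane → ℝ} (j : Fin 2), HInf q → ip (pd j fun y => q y + c * lap q y) p +
      ip (pd j fun y => p y + c * lap p y) q = 0 := by
    intro q j hq
    have e1 : ip (pd j (lap q)) p = ip (lap p) (pd j q) := by
      rw [ip_pd_left hq.lap hp, ip_lap_comm hq (hp.pd j), ← pd_lap hp, ip_comm,
        ip_pd_left hp.lap hq, neg_neg]
    rw [hq.pd_add (hq.lap.const_mul c), hp.pd_add (hp.lap.const_mul c),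
      hq.lap.pd_const_mul, hp.lap.pd_const_mul,
      ip_add_left (hq.pd j) ((hq.lap.pd j).const_mul c) hp,
      ip_add_left (hp.pd j) ((hp.lap.pd j).const_mul c) hq, ip_const_mul_left, ip_const_mul_left,
      e1, ip_pd_left hp.lap hq, ip_pd_left hq hp, ip_comm q]
    ring
  have := e 0 hq0
  have := e 1 hq1
  linarith

/-- The map `(p, q) ↦ (-div q, -∇p)` is skew-adjoint. With the variational derivatives of the
Hamiltonian for `p` and `q`, this is conservation of the Hamiltonian up to the time dependence of
its coefficients. -/
lemma ip_flux_skew {p q0 q1 : Plane → ℝ} (hp : HInf p) (hq0 : HInf q0) (hq1 : HInf q1) :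
    ip (fun x => -(pd 0 q0 x + pd 1 q1 x)) p +
      (ip (fun x => -pd 0 p x) q0 + ip (fun x => -pd 1 p x) q1) = 0 := by
  rw [ip_neg_left, ip_neg_left, ip_neg_left, ip_add_left (hq0.pd 0) (hq1.pd 1) hp,
    ip_pd_left hp hq0, ip_pd_left hp hq1, ip_comm p, ip_comm p]
  ring

lemma ip_flux_expand {p q0 q1 g0 g1 h : Plane → ℝ} (hp : HInf p) (hq0 : HInf q0) (hq1 : HInf q1)
    (hg0 : HInf g0) (hg1 : HInf g1) (hh : HInf h) (c : ℝ) :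
    ip (fun x => -(pd 0 (fun y => (q0 y + c * lap q0 y) + g0 y) x +
        pd 1 (fun y => (q1 y + c * lap q1 y) + g1 y) x)) p +
      (ip (fun x => -pd 0 (fun y => (p y + c * lap p y) + h y) x) q0 +
        ip (fun x => -pd 1 (fun y => (p y + c * lap p y) + h y) x) q1) =
    -(ip (pd 0 g0) p + ip (pd 1 g1) p + ip (pd 0 h) q0 + ip (pd 1 h) q1) := by
  have aq0 := hq0.add (hq0.lap.const_mul c)
  have aq1 := hq1.add (hq1.lap.const_mul c)
  have ap := hp.add (hp.lap.const_mul c)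
  have := ip_linear_flux_cancel hp hq0 hq1 c
  rw [ip_neg_left, ip_neg_left, ip_neg_left, aq0.pd_add hg0, aq1.pd_add hg1, ap.pd_add hh,
    ap.pd_add hh, ip_add_left ((aq0.pd 0).add (hg0.pd 0)) ((aq1.pd 1).add (hg1.pd 1)) hp,
    ip_add_left (aq0.pd 0) (hg0.pd 0) hp, ip_add_left (aq1.pd 1) (hg1.pd 1) hp,
    ip_add_left (ap.pd 0) (hh.pd 0) hq0, ip_add_left (ap.pd 1) (hh.pd 1) hq1]
  linarith

/-- Uniqueness for the unregularized system with positive equal dispersion coefficients. -/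
lemma IsDifference.eq_zero_of_unregularized (h : IsDifference c 0 c 0 T ζ w N U) (hc : 0 < c)
    {N' : ℝ → Plane → ℝ} {U' : Fin 2 → ℝ → Plane → ℝ} (hN' : SobCurve T N')
    (hU' : ∀ j, SobCurve T (U' j))
    (dN : ∀ t ∈ Icc 0 T, ∀ x, HasDerivWithinAt (fun τ => N τ x) (N' t x) (Icc 0 T) t)
    (dU : ∀ j, ∀ t ∈ Icc 0 T, ∀ x,
      HasDerivWithinAt (fun τ => U j τ x) (U' j t x) (Icc 0 T) t)
    (hζ0 : ∀ x, ζ 0 x = 0) (hw0 : ∀ j x, w j 0 x = 0) :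
    ∀ t ∈ Icc 0 T, ∀ x, ζ t x = 0 ∧ ∀ j, w j t x = 0 := by
  obtain ⟨M, hM⟩ := h.exists_bound
  obtain ⟨M1, pM1, hM1⟩ := hN'.exists_bound
  choose M2 pM2 hM2 using fun j => (hU' j).exists_bound
  -- `K` copies of the `L²` norm absorb, by Young's inequality, the negative zero order terms of the
  -- energy below and still leave one copy.
  set K : ℝ := 3 + 3 * M ^ 2 with hK
  have hA : ∀ {f : ℝ → Plane → ℝ}, SobCurve T f → SobCurve T fun t x => f t x + c * lap (f t) x :=
    fun hf => hf.add (hf.lap.const_mul c)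
  have hg : ∀ j, SobCurve T fun t y => ζ t y * U j t y + w j t y * N t y := fun j =>
    (h.eta.mul (h.avg_vel j)).add ((h.vel j).mul h.avg_eta)
  have hh : SobCurve T fun t y => w 0 t y * U 0 t y + w 1 t y * U 1 t y :=
    ((h.vel 0).mul (h.avg_vel 0)).add ((h.vel 1).mul (h.avg_vel 1))
  have hY : ∀ j, SobCurve T fun t y => (w j t y + c * lap (w j t) y) +
      (ζ t y * U j t y + w j t y * N t y) := fun j => (hA (h.vel j)).add (hg j)
  have hX : SobCurve T fun t y => (ζ t y + c * lap (ζ t) y) +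
      (w 0 t y * U 0 t y + w 1 t y * U 1 t y) := (hA h.eta).add hh
  set ζ' : ℝ → Plane → ℝ := fun t x =>
    -(pd 0 (fun y => (w 0 t y + c * lap (w 0 t) y) + (ζ t y * U 0 t y + w 0 t y * N t y)) x +
      pd 1 (fun y => (w 1 t y + c * lap (w 1 t) y) + (ζ t y * U 1 t y + w 1 t y * N t y)) x)
    with hζ'
  set w' : Fin 2 → ℝ → Plane → ℝ := fun j t x =>
    -pd j (fun y => (ζ t y + c * lap (ζ t) y) + (w 0 t y * U 0 t y + w 1 t y * U 1 t y)) x with hw'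
  have cζ' : SobCurve T ζ' := (((hY 0).pd 0).add ((hY 1).pd 1)).neg
  have cw' : ∀ j, SobCurve T (w' j) := fun j => (hX.pd j).neg
  have dζ : ∀ t ∈ Icc 0 T, ∀ x, HasDerivWithinAt (fun τ => ζ τ x) (ζ' t x) (Icc 0 T) t :=
    fun t ht x => by simpa only [zero_mul, sub_zero] using h.eq_eta t ht x
  have dw : ∀ j, ∀ t ∈ Icc 0 T, ∀ x,
      HasDerivWithinAt (fun τ => w j τ x) (w' j t x) (Icc 0 T) t :=
    fun j t ht x => by simpa only [zero_mul, sub_zero] using h.eq_vel j t ht x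
  have hsymm : ∀ {f : ℝ → Plane → ℝ}, SobCurve T f → ∀ s ∈ Icc 0 T, ∀ t ∈ Icc 0 T,
      ip (f s) (fun x => f t x + c * lap (f t) x) =
        ip (f t) (fun x => f s x + c * lap (f s) x) := by
    intro f hf s hs t ht
    have := ip_symbols_comm (hf.hInf s hs) (hf.hInf t ht) 0 c
    simpa only [zero_mul, sub_zero] using this
  have d1 := fun t (ht : t ∈ Icc 0 T) => h.eta.hasDerivWithinAt_ip_of_symm cζ' h.eta dζ
    (fun s _ t _ => ip_comm _ _) ht
  have d2 := fun j t (ht : t ∈ Icc 0 T) => (h.vel j).hasDerivWithinAt_ip_of_symm (cw' j)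
    (h.vel j) (dw j) (fun s _ t _ => ip_comm _ _) ht
  have d3 := fun t (ht : t ∈ Icc 0 T) => h.eta.hasDerivWithinAt_ip_of_symm cζ' (hA h.eta) dζ
    (hsymm h.eta) ht
  have d4 := fun j t (ht : t ∈ Icc 0 T) => (h.vel j).hasDerivWithinAt_ip_of_symm (cw' j)
    (hA (h.vel j)) (dw j) (hsymm (h.vel j)) ht
  have d5 := fun t (ht : t ∈ Icc 0 T) => h.eta.hasDerivWithinAt_ip cζ' hh
    ((((cw' 0).mul (h.avg_vel 0)).add ((h.vel 0).mul (hU' 0))).add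
      (((cw' 1).mul (h.avg_vel 1)).add ((h.vel 1).mul (hU' 1)))) dζ
    (fun t ht x => ((dw 0 t ht x).mul (dU 0 t ht x)).add ((dw 1 t ht x).mul (dU 1 t ht x))) ht
  have d6 := fun j t (ht : t ∈ Icc 0 T) => (h.vel j).hasDerivWithinAt_ip (cw' j)
    ((h.vel j).mul h.avg_eta) (((cw' j).mul h.avg_eta).add ((h.vel j).mul hN')) (dw j)
    (fun t ht x => (dw j t ht x).mul (dN t ht x)) ht
  -- The parenthesis is twice the quadratic Hamiltonian of the equation for the difference. Its
  -- variational derivatives are the full fluxes, including the products with `U` and `N`; without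
  -- these corrections the energy estimate would lose derivatives. Since `c > 0`, minus this
  -- Hamiltonian controls the gradient.
  set Φ : ℝ → ℝ := fun t =>
    K * (ip (ζ t) (ζ t) + (ip (w 0 t) (w 0 t) + ip (w 1 t) (w 1 t))) -
    (ip (ζ t) (fun x => ζ t x + c * lap (ζ t) x) +
      (ip (w 0 t) (fun x => w 0 t x + c * lap (w 0 t) x) +
        ip (w 1 t) (fun x => w 1 t x + c * lap (w 1 t) x)) +
      2 * ip (ζ t) (fun y => w 0 t y * U 0 t y + w 1 t y * U 1 t y) +
      (ip (w 0 t) (fun y => w 0 t y * N t y) + ip (w 1 t) (fun y => w 1 t y * N t y))) with hΦ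
  have hcoer : ∀ t ∈ Icc 0 T, (ip (ζ t) (ζ t) + (ip (w 0 t) (w 0 t) + ip (w 1 t) (w 1 t))) +
      c * ((h1sq (ζ t) - ip (ζ t) (ζ t)) + ((h1sq (w 0 t) - ip (w 0 t) (w 0 t)) +
        (h1sq (w 1 t) - ip (w 1 t) (w 1 t)))) ≤ Φ t := by
    intro t ht
    have hζ := h.eta.hInf t ht
    have hw := fun j => (h.vel j).hInf t ht
    have hN := h.avg_eta.hInf t ht
    have hU := fun j => (h.avg_vel j).hInf t ht
    have b1 := two_mul_abs_ip_le hζ (hh.hInf t ht)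
    have b2 := ip_add_self_le ((hw 0).mul (hU 0)) ((hw 1).mul (hU 1))
    have b3 := ip_mul_self_le (hw 0) (hU 0) fun x => (hM t ht x).2.2.1 0
    have b4 := ip_mul_self_le (hw 1) (hU 1) fun x => (hM t ht x).2.2.1 1
    have b5 := fun j => two_mul_abs_ip_le (hw j) ((hw j).mul hN)
    have b6 := fun j => ip_mul_self_le (hw j) hN fun x => (hM t ht x).1
    have b50 := b5 0
    have b51 := b5 1
    have b60 := b6 0
    have b61 := b6 1
    simp only [hΦ, hK]
    rw [ip_add_mul_self hζ, ip_add_mul_self (hw 0), ip_add_mul_self (hw 1)]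
    unfold h1sq
    have l1 := le_abs_self (ip (ζ t) fun y => w 0 t y * U 0 t y + w 1 t y * U 1 t y)
    have l2 := le_abs_self (ip (w 0 t) fun y => w 0 t y * N t y)
    have l3 := le_abs_self (ip (w 1 t) fun y => w 1 t y * N t y)
    have n0 := ip_self_nonneg (ζ t)
    have n1 := ip_self_nonneg (w 0 t)
    have n2 := ip_self_nonneg (w 1 t)
    have m0 := mul_nonneg (sq_nonneg M) n0
    have m1 := mul_nonneg (sq_nonneg M) n1
    have m2 := mul_nonneg (sq_nonneg M) n2
    linarith
  have hnn : ∀ t ∈ Icc 0 T, ip (ζ t) (ζ t) + (ip (w 0 t) (w 0 t) + ip (w 1 t) (w 1 t)) ≤ Φ t ∧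
      h1sq (ζ t) + (h1sq (w 0 t) + h1sq (w 1 t)) ≤ (1 + 1 / c) * Φ t := by
    intro t ht
    have h1 := hcoer t ht
    have p0 := sub_nonneg.2 (ip_self_le_h1sq (ζ t))
    have p1 := sub_nonneg.2 (ip_self_le_h1sq (w 0 t))
    have p2 := sub_nonneg.2 (ip_self_le_h1sq (w 1 t))
    have n0 := ip_self_nonneg (ζ t)
    have n1 := ip_self_nonneg (w 0 t)
    have n2 := ip_self_nonneg (w 1 t)
    set S := ip (ζ t) (ζ t) + (ip (w 0 t) (w 0 t) + ip (w 1 t) (w 1 t)) with hS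
    set D := (h1sq (ζ t) - ip (ζ t) (ζ t)) + ((h1sq (w 0 t) - ip (w 0 t) (w 0 t)) +
        (h1sq (w 1 t) - ip (w 1 t) (w 1 t))) with hD
    have hS0 : 0 ≤ S := by positivity
    have hD0 : 0 ≤ D := add_nonneg p0 (add_nonneg p1 p2)
    have hcD : 0 ≤ c * D := by positivity
    refine ⟨by linarith, ?_⟩
    have e : h1sq (ζ t) + (h1sq (w 0 t) + h1sq (w 1 t)) = S + D := by rw [hS, hD]; ring
    rw [e]
    have h2 := mul_le_mul_of_nonneg_left h1 (by positivity : 0 ≤ 1 + 1 / c)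
    have e2 : (1 + 1 / c) * (S + c * D) = S + D + (1 / c * S + c * D) := by field_simp; ring
    have : 0 ≤ 1 / c * S := by positivity
    linarith
  have key := eq_zero_of_energy (T := T) (E := Φ)
    (K := (2 * K * (16 * M ^ 2 + 1) + (M1 ^ 2 + M2 0 ^ 2 + M2 1 ^ 2 + 4)) * (1 + 1 / c))
    (fun t ht => ((((d1 t ht).add ((d2 0 t ht).add (d2 1 t ht))).const_mul K).sub
      ((((d3 t ht).add ((d4 0 t ht).add (d4 1 t ht))).add ((d5 t ht).const_mul 2)).add
        ((d6 0 t ht).add (d6 1 t ht))))) ?_ ?_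
  · intro t ht x
    have hz := key t ht
    have h1 := (hnn t ht).1
    rw [hz] at h1
    have n0 := ip_self_nonneg (ζ t)
    have n1 := ip_self_nonneg (w 0 t)
    have n2 := ip_self_nonneg (w 1 t)
    refine ⟨(h.eta.hInf t ht).eq_zero_of_ip (by linarith) x, fun j =>
      ((h.vel j).hInf t ht).eq_zero_of_ip ?_ x⟩
    fin_cases j <;> simp only [Fin.zero_eta, Fin.mk_one] <;> linarith
  · have i0 : ζ 0 = fun _ => 0 := funext hζ0
    have i1 : ∀ j, w j 0 = fun _ => 0 := fun j => funext (hw0 j)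
    simp only [hΦ, i0, i1, lap_zero, mul_zero, sub_zero, ip_zero_left, add_zero]
  · intro t ht
    have hζ := h.eta.hInf t ht
    have hw := fun j => (h.vel j).hInf t ht
    have hN := h.avg_eta.hInf t ht
    have hU := fun j => (h.avg_vel j).hInf t ht
    have zζ := cζ'.hInf t ht
    have zw := fun j => (cw' j).hInf t ht
    have zN := hN'.hInf t ht
    have zU := fun j => (hU' j).hInf t ht
    have gg := fun j => (hg j).hInf t ht
    have gh := hh.hInf t ht
    have aζ := (hA h.eta).hInf t ht
    have aw := fun j => (hA (h.vel j)).hInf t ht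
    have hM' := hM t ht
    -- `f1` removes from the derivative of the Hamiltonian every term with a time derivative of `ζ`
    -- or `w`. `f2` leaves in the derivative of the `L²` norm only terms with one space derivative.
    have f1 := ip_flux_skew (hX.hInf t ht) ((hY 0).hInf t ht) ((hY 1).hInf t ht)
    have f2 := ip_flux_expand hζ (hw 0) (hw 1) (gg 0) (gg 1) gh c
    rw [ip_add_right aζ gh zζ, ip_add_right (aw 0) (gg 0) (zw 0), ip_add_right (aw 1) (gg 1) (zw 1),
      ip_add_right (hζ.mul (hU 0)) ((hw 0).mul hN) (zw 0),
      ip_add_right (hζ.mul (hU 1)) ((hw 1).mul hN) (zw 1)] at f1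
    have f3 : ip (ζ t) (fun x => (w' 0 t x * U 0 t x + w 0 t x * U' 0 t x) +
        (w' 1 t x * U 1 t x + w 1 t x * U' 1 t x)) =
        (ip (w' 0 t) (fun x => ζ t x * U 0 t x) + ip (ζ t) (fun x => w 0 t x * U' 0 t x)) +
        (ip (w' 1 t) (fun x => ζ t x * U 1 t x) + ip (ζ t) (fun x => w 1 t x * U' 1 t x)) := by
      rw [ip_add_right (((zw 0).mul (hU 0)).add ((hw 0).mul (zU 0)))
        (((zw 1).mul (hU 1)).add ((hw 1).mul (zU 1))) hζ,
        ip_add_right ((zw 0).mul (hU 0)) ((hw 0).mul (zU 0)) hζ,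
        ip_add_right ((zw 1).mul (hU 1)) ((hw 1).mul (zU 1)) hζ, ip_mul_left_comm,
        ip_mul_left_comm _ (w' 1 t)]
    have f4 : ∀ j, ip (w j t) (fun x => w' j t x * N t x + w j t x * N' t x) =
        ip (w' j t) (fun x => w j t x * N t x) + ip (w j t) (fun x => w j t x * N' t x) := fun j => by
      rw [ip_add_right ((zw j).mul hN) ((hw j).mul zN) (hw j), ip_mul_left_comm]
    rw [f3, f4, f4]
    have bg := fun j => ip_pd_flux_le hζ (hw j) (hU j) hN j (fun x => (hM' x).2.2.1 j)
      (fun x => (hM' x).2.2.2 j j) (fun x => (hM' x).1) (fun x => (hM' x).2.1 j)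
    have bh := fun j => ip_pd_flux_le (hw 0) (hw 1) (hU 0) (hU 1) j (fun x => (hM' x).2.2.1 0)
      (fun x => (hM' x).2.2.2 0 j) (fun x => (hM' x).2.2.1 1) (fun x => (hM' x).2.2.2 1 j)
    have a0 := two_mul_abs_ip_le ((gg 0).pd 0) hζ
    have a1 := two_mul_abs_ip_le ((gg 1).pd 1) hζ
    have a2 := two_mul_abs_ip_le (gh.pd 0) (hw 0)
    have a3 := two_mul_abs_ip_le (gh.pd 1) (hw 1)
    have a4 := fun j => two_mul_abs_ip_le hζ ((hw j).mul (zU j))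
    have a5 := fun j => ip_mul_self_le (hw j) (zU j) (hM2 j t ht)
    have a6 := fun j => two_mul_abs_ip_le (hw j) ((hw j).mul zN)
    have a7 := fun j => ip_mul_self_le (hw j) zN (hM1 t ht)
    have bg0 := bg 0
    have bg1 := bg 1
    have bh0 := bh 0
    have bh1 := bh 1
    have a40 := a4 0
    have a41 := a4 1
    have a50 := a5 0
    have a51 := a5 1
    have a60 := a6 0
    have a61 := a6 1
    have a70 := a7 0
    have a71 := a7 1
    have i0 := ip_self_le_h1sq (ζ t)
    have i1 := ip_self_le_h1sq (w 0 t)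
    have i2 := ip_self_le_h1sq (w 1 t)
    have n0 := h1sq_nonneg (ζ t)
    have n1 := h1sq_nonneg (w 0 t)
    have n2 := h1sq_nonneg (w 1 t)
    have hD := (hnn t ht).2
    have hΦ0 : 0 ≤ Φ t := nonneg_of_mul_nonneg_right ((add_nonneg n0 (add_nonneg n1 n2)).trans hD)
      (by positivity)
    rw [abs_of_nonneg hΦ0]
    set R : ℝ := -(ip (pd 0 fun x => ζ t x * U 0 t x + w 0 t x * N t x) (ζ t) +
      ip (pd 1 fun x => ζ t x * U 1 t x + w 1 t x * N t x) (ζ t) +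
      ip (pd 0 fun x => w 0 t x * U 0 t x + w 1 t x * U 1 t x) (w 0 t) +
      ip (pd 1 fun x => w 0 t x * U 0 t x + w 1 t x * U 1 t x) (w 1 t)) with hR
    set D := h1sq (ζ t) + (h1sq (w 0 t) + h1sq (w 1 t)) with hDdef
    have hR' : |2 * R| ≤ 2 * (16 * M ^ 2 + 1) * D := by
      rw [abs_mul, abs_two, hR, abs_neg]
      have t1 := abs_add_le (ip (pd 0 fun x => ζ t x * U 0 t x + w 0 t x * N t x) (ζ t) +
        ip (pd 1 fun x => ζ t x * U 1 t x + w 1 t x * N t x) (ζ t) +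
        ip (pd 0 fun x => w 0 t x * U 0 t x + w 1 t x * U 1 t x) (w 0 t))
        (ip (pd 1 fun x => w 0 t x * U 0 t x + w 1 t x * U 1 t x) (w 1 t))
      have t2 := abs_add_three (ip (pd 0 fun x => ζ t x * U 0 t x + w 0 t x * N t x) (ζ t))
        (ip (pd 1 fun x => ζ t x * U 1 t x + w 1 t x * N t x) (ζ t))
        (ip (pd 0 fun x => w 0 t x * U 0 t x + w 1 t x * U 1 t x) (w 0 t))
      have p0 := mul_nonneg (sq_nonneg M) n0
      have p1 := mul_nonneg (sq_nonneg M) n1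
      have p2 := mul_nonneg (sq_nonneg M) n2
      linarith
    set S : ℝ := 2 * ip (ζ t) (fun x => w 0 t x * U' 0 t x) +
      2 * ip (ζ t) (fun x => w 1 t x * U' 1 t x) + (ip (w 0 t) (fun x => w 0 t x * N' t x) +
        ip (w 1 t) (fun x => w 1 t x * N' t x)) with hS
    have hS' : |S| ≤ (M1 ^ 2 + M2 0 ^ 2 + M2 1 ^ 2 + 4) * D := by
      have p0 := mul_nonneg (sq_nonneg M1) n0
      have p1 := mul_le_mul_of_nonneg_left i1 (sq_nonneg M1)
      have p2 := mul_le_mul_of_nonneg_left i2 (sq_nonneg M1)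
      have p3 := mul_le_mul_of_nonneg_left i1 (sq_nonneg (M2 0))
      have p4 := mul_le_mul_of_nonneg_left i2 (sq_nonneg (M2 1))
      have p5 := mul_nonneg (sq_nonneg (M2 0)) n0
      have p6 := mul_nonneg (sq_nonneg (M2 0)) n2
      have p7 := mul_nonneg (sq_nonneg (M2 1)) n0
      have p8 := mul_nonneg (sq_nonneg (M2 1)) n1
      have p9 := mul_nonneg (sq_nonneg M1) n1
      have p10 := mul_nonneg (sq_nonneg M1) n2
      have q1 := abs_le.1 (le_refl |ip (ζ t) (fun x => w 0 t x * U' 0 t x)|)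
      have q2 := abs_le.1 (le_refl |ip (ζ t) (fun x => w 1 t x * U' 1 t x)|)
      have q3 := abs_le.1 (le_refl |ip (w 0 t) (fun x => w 0 t x * N' t x)|)
      have q4 := abs_le.1 (le_refl |ip (w 1 t) (fun x => w 1 t x * N' t x)|)
      rw [hS, abs_le]
      constructor <;> linarith [q1.1, q1.2, q2.1, q2.2, q3.1, q3.2, q4.1, q4.2]
    have hK0 : 0 ≤ K := by positivity
    -- `R` collects the nonlinear fluxes in the `L²` estimate, and `S` the terms in which the time
    -- derivative falls on the averages.
    refine le_trans (le_of_eq (congrArg abs (a₂ := K * (2 * R) - S) ?_)) ?_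
    · rw [← f2, hS]
      linear_combination (-2) * f1
    · calc |K * (2 * R) - S| ≤ |K * (2 * R)| + |S| := abs_sub _ _
        _ = K * |2 * R| + |S| := by rw [abs_mul, abs_of_nonneg hK0]
        _ ≤ K * (2 * (16 * M ^ 2 + 1) * D) + (M1 ^ 2 + M2 0 ^ 2 + M2 1 ^ 2 + 4) * D :=
          add_le_add (mul_le_mul_of_nonneg_left hR' hK0) hS'
        _ = (2 * K * (16 * M ^ 2 + 1) + (M1 ^ 2 + M2 0 ^ 2 + M2 1 ^ 2 + 4)) * D := by ring
        _ ≤ (2 * K * (16 * M ^ 2 + 1) + (M1 ^ 2 + M2 0 ^ 2 + M2 1 ^ 2 + 4)) *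
            ((1 + 1 / c) * Φ t) := by gcongr
        _ = _ := by ring

end Boussinesq

end
-- Solutions determine the flow
noncomputable section

namespace Boussinesq

variable {a b c d T : ℝ} {η η' : ℝ → Plane → ℝ} {u u' : Fin 2 → ℝ → Plane → ℝ}

namespace IsCurveSolution

lemma exists_deriv_eta (h : IsCurveSolution a 0 c 0 T η u) : ∃ N : ℝ → Plane → ℝ,
    SobCurve T N ∧ ∀ t ∈ Icc 0 T, ∀ x, HasDerivWithinAt (fun τ => η τ x) (N t x) (Icc 0 T) t := by
  refine ⟨fun t x => -(pd 0 (fun y => a * lap (u 0 t) y + u 0 t y + η t y * u 0 t y) x +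
    pd 1 (fun y => a * lap (u 1 t) y + u 1 t y + η t y * u 1 t y) x), ?_, fun t ht x => ?_⟩
  · have hj : ∀ j, SobCurve T
        fun t => pd j (fun y => a * lap (u j t) y + u j t y + η t y * u j t y) := fun j =>
      ((((h.vel j).lap.const_mul a).add (h.vel j)).add (h.eta.mul (h.vel j))).pd j
    exact ((hj 0).add (hj 1)).neg
  · simpa [Fin.sum_univ_two] using h.eq_eta t ht x

lemma exists_deriv_vel (h : IsCurveSolution a 0 c 0 T η u) (j : Fin 2) : ∃ U : ℝ → Plane → ℝ,
    SobCurve T U ∧ ∀ t ∈ Icc 0 T, ∀ x, HasDerivWithinAt (fun τ => u j τ x) (U t x) (Icc 0 T) t := by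
  refine ⟨fun t x => -pd j (fun y => c * lap (η t) y + η t y +
    1 / 2 * (u 0 t y ^ 2 + u 1 t y ^ 2)) x, ?_, fun t ht x => ?_⟩
  · have h1 := ((h.eta.lap.const_mul c).add h.eta).add
      ((((h.vel 0).mul (h.vel 0)).add ((h.vel 1).mul (h.vel 1))).const_mul (1 / 2))
    refine ((h1.congr fun t _ x => ?_).pd j).neg
    simp only [sq]
  · simpa using h.eq_vel j t ht x

lemma unique_of_regularized (h : IsCurveSolution a b c d T η u)
    (h' : IsCurveSolution a b c d T η' u') (ha : a ≤ 0) (hc : c ≤ 0) (hb : 0 < b) (hd : 0 < d)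
    (hη : ∀ x, η 0 x = η' 0 x) (hu : ∀ j x, u j 0 x = u' j 0 x) :
    ∀ t ∈ Icc 0 T, ∀ x, η t x = η' t x ∧ ∀ j, u j t x = u' j t x := by
  intro t ht x
  have := (h.isDifference h').eq_zero_of_regularized ha hc hb hd
    (fun x => sub_eq_zero.2 (hη x)) (fun j x => sub_eq_zero.2 (hu j x)) t ht x
  exact ⟨sub_eq_zero.1 this.1, fun j => sub_eq_zero.1 (this.2 j)⟩

lemma unique_of_unregularized (h : IsCurveSolution c 0 c 0 T η u)
    (h' : IsCurveSolution c 0 c 0 T η' u') (hc : 0 < c)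
    (hη : ∀ x, η 0 x = η' 0 x) (hu : ∀ j x, u j 0 x = u' j 0 x) :
    ∀ t ∈ Icc 0 T, ∀ x, η t x = η' t x ∧ ∀ j, u j t x = u' j t x := by
  obtain ⟨N, hN, dN⟩ := h.exists_deriv_eta
  obtain ⟨N', hN', dN'⟩ := h'.exists_deriv_eta
  choose U hU dU using h.exists_deriv_vel
  choose U' hU' dU' using h'.exists_deriv_vel
  intro t ht x
  have := (h.isDifference h').eq_zero_of_unregularized hc
    ((hN.add hN').const_mul (1 / 2)) (fun j => ((hU j).add (hU' j)).const_mul (1 / 2))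
    (fun t ht x => ((dN t ht x).add (dN' t ht x)).const_mul (1 / 2))
    (fun j t ht x => ((dU j t ht x).add (dU' j t ht x)).const_mul (1 / 2))
    (fun x => sub_eq_zero.2 (hη x)) (fun j x => sub_eq_zero.2 (hu j x)) t ht x
  exact ⟨sub_eq_zero.1 this.1, fun j => sub_eq_zero.1 (this.2 j)⟩

end IsCurveSolution

/-- The regimes in which the flow is well defined by the energy method: both equations are
regularized, or neither is and the dispersion is that of the KdV-KdV system. -/
def Admissible (a b c d : ℝ) : Prop :=
  (a ≤ 0 ∧ c ≤ 0 ∧ 0 < b ∧ 0 < d) ∨ (a = c ∧ 0 < c ∧ b = 0 ∧ d = 0)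

lemma IsSolution.isFlow {v : ℝ → State} (h : IsSolution a b c d T v)
    (hadm : Admissible a b c d) : IsFlow a b c d T (v 0) v := by
  refine ⟨h, rfl, fun w hw h0 t ht => ?_⟩
  have h1 := (isSolution_iff.1 hw).2.1
  have h2 := (isSolution_iff.1 h).2.1
  have key : ∀ x, (w t).1 x = (v t).1 x ∧ ∀ j, (w t).2 x j = (v t).2 x j := by
    rcases hadm with ⟨ha, hc, hb, hd⟩ | ⟨rfl, hc, rfl, rfl⟩
    · exact h1.unique_of_regularized h2 ha hc hb hd (fun x => by rw [h0]) (fun j x => by rw [h0])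
        t ht
    · exact h1.unique_of_unregularized h2 hc (fun x => by rw [h0]) (fun j x => by rw [h0]) t ht
  refine Prod.ext (funext fun x => (key x).1) (funext fun x => ?_)
  ext j
  exact (key x).2 j

end Boussinesq

end
-- Majorants on the Fourier side
noncomputable section

namespace Boussinesq

/-- Convolution of real-valued functions on the plane. -/
def rconv (f g : Plane → ℝ) (ξ : Plane) : ℝ := ∫ ζ, f (ξ - ζ) * g ζ

/-- The functions that bound the terms of the iteration on the Fourier side. -/
structure IsMajorant (F : Plane → ℝ) : Prop where
  measurable : Measurable F
  nonneg : ∀ ξ, 0 ≤ F ξ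
  even : ∀ ξ, F (-ξ) = F ξ
  integrable : Integrable F
  bounded : ∃ B, ∀ ξ, F ξ ≤ B

namespace IsMajorant

variable {F G : Plane → ℝ}

lemma integrable_integrand (hF : IsMajorant F) (hG : IsMajorant G) (ξ : Plane) :
    Integrable fun ζ => F (ξ - ζ) * G ζ := by
  obtain ⟨B, hB⟩ := hF.bounded
  refine (hG.integrable.const_mul B).mono'
    ((hF.measurable.comp (measurable_const.sub measurable_id)).mul
      hG.measurable).aestronglyMeasurable (Eventually.of_forall fun ζ => ?_)
  rw [Real.norm_of_nonneg (mul_nonneg (hF.nonneg _) (hG.nonneg _))]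
  exact mul_le_mul_of_nonneg_right (hB _) (hG.nonneg _)

lemma rconv_nonneg (hF : IsMajorant F) (hG : IsMajorant G) (ξ : Plane) : 0 ≤ rconv F G ξ :=
  integral_nonneg fun _ => mul_nonneg (hF.nonneg _) (hG.nonneg _)

lemma rconv_le (hF : IsMajorant F) (hG : IsMajorant G) {B : ℝ} (hB : ∀ ξ, F ξ ≤ B) (ξ : Plane) :
    rconv F G ξ ≤ B * ∫ ζ, G ζ := by
  rw [← integral_const_mul]
  exact integral_mono (hF.integrable_integrand hG ξ) (hG.integrable.const_mul B)
    fun ζ => mul_le_mul_of_nonneg_right (hB _) (hG.nonneg _)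

lemma integrable_uncurry (hF : IsMajorant F) (hG : IsMajorant G) :
    Integrable (fun p : Plane × Plane => F (p.1 - p.2) * G p.2) (volume.prod volume) := by
  have := hG.integrable.convolution_integrand (ContinuousLinearMap.mul ℝ ℝ) hF.integrable
  refine this.congr (Eventually.of_forall fun p => ?_)
  simp [mul_comm]

/-- For nonnegative functions the mass is multiplicative under convolution, without any loss; the
Catalan count below relies on it. -/
lemma integral_rconv (hF : IsMajorant F) (hG : IsMajorant G) :
    ∫ ξ, rconv F G ξ = (∫ ξ, F ξ) * ∫ ξ, G ξ := by
  have h := integral_integral_swap (f := fun ξ ζ => F (ξ - ζ) * G ζ) (hF.integrable_uncurry hG)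
  refine h.trans ?_
  simp_rw [integral_mul_const, integral_sub_right_eq_self F]
  rw [integral_const_mul]

protected lemma rconv (hF : IsMajorant F) (hG : IsMajorant G) : IsMajorant (rconv F G) where
  measurable := by
    have : Measurable (Function.uncurry fun ξ ζ : Plane => F (ξ - ζ) * G ζ) :=
      (hF.measurable.comp (measurable_fst.sub measurable_snd)).mul
        (hG.measurable.comp measurable_snd)
    exact (this.stronglyMeasurable.integral_prod_right (ν := volume)).measurable
  nonneg := hF.rconv_nonneg hG
  even ξ := by
    rw [rconv, rconv, ← integral_neg_eq_self]
    refine integral_congr_ae (Eventually.of_forall fun ζ => ?_)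
    simp only [hG.even]
    rw [← hF.even (ξ - ζ)]; congr 2; abel
  integrable := (hF.integrable_uncurry hG).integral_prod_left
  bounded := by
    obtain ⟨B, hB⟩ := hF.bounded
    exact ⟨_, hF.rconv_le hG hB⟩

lemma const_mul (hF : IsMajorant F) {c : ℝ} (hc : 0 ≤ c) : IsMajorant fun ξ => c * F ξ where
  measurable := hF.measurable.const_mul c
  nonneg ξ := mul_nonneg hc (hF.nonneg ξ)
  even ξ := by rw [hF.even]
  integrable := hF.integrable.const_mul c
  bounded := by
    obtain ⟨B, hB⟩ := hF.bounded
    exact ⟨c * B, fun ξ => mul_le_mul_of_nonneg_left (hB ξ) hc⟩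

lemma sum {α : Type*} {s : Finset α} {F : α → Plane → ℝ} (hF : ∀ i ∈ s, IsMajorant (F i)) :
    IsMajorant fun ξ => ∑ i ∈ s, F i ξ where
  measurable := Finset.measurable_fun_sum _ fun i hi => (hF i hi).measurable
  nonneg ξ := Finset.sum_nonneg fun i hi => (hF i hi).nonneg ξ
  even ξ := Finset.sum_congr rfl fun i hi => (hF i hi).even ξ
  integrable := integrable_finsetSum _ fun i hi => (hF i hi).integrable
  bounded := by
    choose! B hB using fun i (hi : i ∈ s) => (hF i hi).bounded
    exact ⟨∑ i ∈ s, B i, fun ξ => Finset.sum_le_sum fun i hi => hB i hi ξ⟩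

end IsMajorant

lemma rconv_const_mul (c c' : ℝ) (F G : Plane → ℝ) (ξ : Plane) :
    rconv (fun ξ => c * F ξ) (fun ξ => c' * G ξ) ξ = c * c' * rconv F G ξ := by
  rw [rconv, rconv, ← integral_const_mul]
  refine integral_congr_ae (Eventually.of_forall fun ζ => ?_)
  simp only; ring

/-- A time dependent profile, continuous in time, measurable in frequency and of size at most
`|t| ^ k * F ξ`. -/
structure MajorizedBy (k : ℕ) (F : Plane → ℝ) (f : ℝ → Plane → ℂ) : Prop where
  measurable : ∀ t, Measurable (f t)
  continuous : ∀ ξ, Continuous fun t => f t ξ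
  bound : ∀ t ξ, ‖f t ξ‖ ≤ |t| ^ k * F ξ

namespace MajorizedBy

variable {k l : ℕ} {F G : Plane → ℝ} {f g : ℝ → Plane → ℂ}

lemma mono (hf : MajorizedBy k F f) (h : ∀ ξ, F ξ ≤ G ξ) : MajorizedBy k G f :=
  ⟨hf.measurable, hf.continuous, fun t ξ => (hf.bound t ξ).trans
    (mul_le_mul_of_nonneg_left (h ξ) (by positivity))⟩

lemma uncurry_measurable (hf : MajorizedBy k F f) : Measurable (Function.uncurry f) :=
  measurable_uncurry_of_continuous_of_measurable hf.continuous hf.measurable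

/-- The combination `c (t, ξ) f (t, ξ) + d (t, ξ) conj (f (t, -ξ))`. -/
def comb (c d f : ℝ → Plane → ℂ) (t : ℝ) (ξ : Plane) : ℂ :=
  c t ξ * f t ξ + d t ξ * starRingEnd ℂ (f t (-ξ))

lemma comb_majorizedBy (hf : MajorizedBy k F f) (hF : IsMajorant F) {c d : ℝ → Plane → ℂ} {κ : ℝ}
    (mc : ∀ t, Measurable (c t)) (md : ∀ t, Measurable (d t))
    (cc : ∀ ξ, Continuous fun t => c t ξ) (cd : ∀ ξ, Continuous fun t => d t ξ)
    (hc : ∀ t ξ, ‖c t ξ‖ ≤ κ) (hd : ∀ t ξ, ‖d t ξ‖ ≤ κ) :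
    MajorizedBy k (fun ξ => 2 * κ * F ξ) (comb c d f) where
  measurable t := ((mc t).mul (hf.measurable t)).add ((md t).mul
    (Complex.continuous_conj.measurable.comp ((hf.measurable t).comp measurable_neg)))
  continuous ξ := ((cc ξ).mul (hf.continuous ξ)).add ((cd ξ).mul
    (Complex.continuous_conj.comp (hf.continuous (-ξ))))
  bound t ξ := by
    have h1 := hf.bound t ξ
    have h2 := hf.bound t (-ξ)
    rw [hF.even] at h2
    have hκ : 0 ≤ κ := (norm_nonneg _).trans (hc t ξ)
    calc ‖comb c d f t ξ‖ ≤ ‖c t ξ‖ * ‖f t ξ‖ + ‖d t ξ‖ * ‖f t (-ξ)‖ := by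
          refine (norm_add_le _ _).trans ?_
          rw [norm_mul, norm_mul, RCLike.norm_conj]
      _ ≤ κ * (|t| ^ k * F ξ) + κ * (|t| ^ k * F ξ) := by
          gcongr
          · exact hc t ξ
          · exact hd t ξ
      _ = _ := by ring

lemma norm_integrand_le (hf : MajorizedBy k F f) (hg : MajorizedBy l G g) (t : ℝ) (ξ ζ : Plane) :
    ‖f t (ξ - ζ) * g t ζ‖ ≤ |t| ^ (k + l) * (F (ξ - ζ) * G ζ) := by
  rw [norm_mul]
  refine (mul_le_mul (hf.bound t _) (hg.bound t _) (norm_nonneg _)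
    ((norm_nonneg _).trans (hf.bound t _))).trans (le_of_eq ?_)
  rw [pow_add]; ring

lemma measurable_integrand (hf : MajorizedBy k F f) (hg : MajorizedBy l G g) (t : ℝ) (ξ : Plane) :
    Measurable fun ζ => f t (ξ - ζ) * g t ζ :=
  ((hf.measurable t).comp (measurable_const.sub measurable_id)).mul (hg.measurable t)

lemma integrable_integrand (hf : MajorizedBy k F f) (hg : MajorizedBy l G g) (hF : IsMajorant F)
    (hG : IsMajorant G) (t : ℝ) (ξ : Plane) : Integrable fun ζ => f t (ξ - ζ) * g t ζ :=
  ((hF.integrable_integrand hG ξ).const_mul (|t| ^ (k + l))).mono'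
    (hf.measurable_integrand hg t ξ).aestronglyMeasurable
    (Eventually.of_forall fun ζ => hf.norm_integrand_le hg t ξ ζ)

lemma conv (hf : MajorizedBy k F f) (hg : MajorizedBy l G g) (hF : IsMajorant F)
    (hG : IsMajorant G) : MajorizedBy (k + l) (rconv F G) fun t => conv (f t) (g t) where
  measurable t := by
    have : Measurable (Function.uncurry fun ξ ζ : Plane => f t (ξ - ζ) * g t ζ) :=
      ((hf.measurable t).comp (measurable_fst.sub measurable_snd)).mul
        ((hg.measurable t).comp measurable_snd)
    exact (this.stronglyMeasurable.integral_prod_right (ν := volume)).measurable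
  continuous ξ := by
    rw [continuous_iff_continuousAt]
    intro t
    refine continuousAt_of_dominated
      (bound := fun ζ => (|t| + 1) ^ (k + l) * (F (ξ - ζ) * G ζ))
      (Eventually.of_forall fun s => (hf.measurable_integrand hg s ξ).aestronglyMeasurable) ?_
      ((hF.integrable_integrand hG ξ).const_mul _) (Eventually.of_forall fun ζ =>
        ((hf.continuous _).mul (hg.continuous _)).continuousAt)
    have : ∀ᶠ s : ℝ in 𝓝 t, |s| < |t| + 1 :=
      continuous_abs.continuousAt.eventually_lt continuousAt_const (by simp)
    filter_upwards [this] with s hs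
    refine Eventually.of_forall fun ζ => (hf.norm_integrand_le hg s ξ ζ).trans ?_
    have := mul_nonneg (hF.nonneg (ξ - ζ)) (hG.nonneg ζ)
    gcongr
  bound t ξ := by
    refine (norm_integral_le_integral_norm _).trans ?_
    rw [rconv, ← integral_const_mul]
    exact integral_mono (hf.integrable_integrand hg hF hG t ξ).norm
      ((hF.integrable_integrand hG ξ).const_mul _) fun ζ => hf.norm_integrand_le hg t ξ ζ

lemma mul (hf : MajorizedBy k F f) {M : ℝ → Plane → ℂ} {m : Plane → ℝ}
    (hM : ∀ t, Measurable (M t)) (cM : ∀ ξ, Continuous fun t => M t ξ)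
    (hm : ∀ t ξ, ‖M t ξ‖ ≤ m ξ) : MajorizedBy k (fun ξ => m ξ * F ξ) fun t ξ => M t ξ * f t ξ where
  measurable t := (hM t).mul (hf.measurable t)
  continuous ξ := (cM ξ).mul (hf.continuous ξ)
  bound t ξ := by
    rw [norm_mul]
    refine (mul_le_mul (hm t ξ) (hf.bound t ξ) (norm_nonneg _)
      ((norm_nonneg _).trans (hm t ξ))).trans (le_of_eq (by ring))

lemma sum {α : Type*} {s : Finset α} {F : α → Plane → ℝ} {f : α → ℝ → Plane → ℂ}
    (hf : ∀ i ∈ s, MajorizedBy k (F i) (f i)) :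
    MajorizedBy k (fun ξ => ∑ i ∈ s, F i ξ) fun t ξ => ∑ i ∈ s, f i t ξ where
  measurable t := Finset.measurable_fun_sum _ fun i hi => (hf i hi).measurable t
  continuous ξ := continuous_finsetSum _ fun i hi => (hf i hi).continuous ξ
  bound t ξ := by
    refine (norm_sum_le _ _).trans ?_
    rw [Finset.mul_sum]
    exact Finset.sum_le_sum fun i hi => (hf i hi).bound t ξ

lemma hasDerivAt_integral (hf : MajorizedBy k F f) (t : ℝ) (ξ : Plane) :
    HasDerivAt (fun t => ∫ s in (0 : ℝ)..t, f s ξ) (f t ξ) t :=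
  intervalIntegral.integral_hasDerivAt_right ((hf.continuous ξ).intervalIntegrable _ _)
    ((hf.continuous ξ).stronglyMeasurableAtFilter _ _) (hf.continuous ξ).continuousAt

/-- The gain `1 / (k + 1)` is decisive: it compensates the derivative in the nonlinearity, which
costs a factor linear in the order. -/
lemma integral (hf : MajorizedBy k F f) :
    MajorizedBy (k + 1) (fun ξ => F ξ / (k + 1)) fun t ξ => ∫ s in (0 : ℝ)..t, f s ξ where
  measurable t := by
    have h : ∀ a b : ℝ, Measurable fun ξ => ∫ s in Ioc a b, f s ξ := fun a b =>
      (hf.uncurry_measurable.stronglyMeasurable.integral_prod_left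
        (μ := volume.restrict (Ioc a b))).measurable
    exact (h 0 t).sub (h t 0)
  continuous ξ := continuous_iff_continuousAt.2 fun t => (hf.hasDerivAt_integral t ξ).continuousAt
  bound t ξ := by
    refine (intervalIntegral.norm_integral_le_integral_norm_uIoc).trans ?_
    have h1 : ∫ s in uIoc 0 t, |s| ^ k = |t| ^ (k + 1) / (k + 1) := by
      simpa using integral_pow_abs_sub_uIoc (a := 0) (b := t) k
    have h2 : |t| ^ (k + 1) * (F ξ / (k + 1)) = ∫ s in uIoc 0 t, |s| ^ k * F ξ := by
      rw [integral_mul_const, h1]; ring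
    rw [h2]
    refine setIntegral_mono ?_ ?_ fun s => hf.bound s ξ
    · exact (intervalIntegrable_iff.1 ((hf.continuous ξ).norm.intervalIntegrable _ _))
    · exact (intervalIntegrable_iff.1
        (((continuous_abs.pow k).mul continuous_const).intervalIntegrable _ _))

end MajorizedBy

end Boussinesq

end
-- Expansion of the solution in powers of the datum
noncomputable section

namespace Boussinesq

/-- The majorants of the iteration: `h`, and the sums of convolutions of the previous ones. -/
def majorant (h : Plane → ℝ) : ℕ → Plane → ℝ
  | 0 => h
  | n + 1 => fun ξ => ∑ i : Fin (n + 1), rconv (majorant h i) (majorant h (n - i)) ξ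

/-- A bound for the initial datum on the Fourier side. -/
structure IsDatum (h : Plane → ℝ) (A P R : ℝ) : Prop extends IsMajorant h where
  le_sup : ∀ ξ, h ξ ≤ A
  integral_le : ∫ ξ, h ξ ≤ P
  support : ∀ ξ, R < ‖ξ‖ → h ξ = 0

namespace IsDatum

variable {h : Plane → ℝ} {A P R : ℝ}

lemma nonneg_sup (hh : IsDatum h A P R) : 0 ≤ A := (hh.nonneg 0).trans (hh.le_sup 0)

lemma nonneg_mass (hh : IsDatum h A P R) : 0 ≤ P := (integral_nonneg hh.nonneg).trans hh.integral_le

lemma isMajorant (hh : IsDatum h A P R) (n : ℕ) : IsMajorant (majorant h n) := by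
  induction n using Nat.strong_induction_on with
  | _ n ih =>
    cases n with
    | zero => rw [majorant]; exact hh.toIsMajorant
    | succ n =>
      rw [majorant]
      exact .sum fun i _ => (ih i i.2).rconv (ih _ (by omega))

/-- The recursion of the majorants is that of the Catalan numbers, and masses multiply. -/
lemma integral_majorant_le (hh : IsDatum h A P R) (n : ℕ) :
    ∫ ξ, majorant h n ξ ≤ catalan n * P ^ (n + 1) := by
  have hP := hh.nonneg_mass
  induction n using Nat.strong_induction_on with
  | _ n ih =>
    cases n with
    | zero => simpa [majorant] using hh.integral_le
    | succ n =>
      simp only [majorant]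
      rw [integral_finsetSum _ fun (i : Fin (n + 1)) _ =>
        ((hh.isMajorant i).rconv (hh.isMajorant (n - i))).integrable, catalan_succ]
      push_cast
      rw [Finset.sum_mul]
      refine Finset.sum_le_sum fun i _ => ?_
      rw [(hh.isMajorant i).integral_rconv (hh.isMajorant _)]
      refine (mul_le_mul (ih i i.2) (ih (n - i) (by omega))
        (integral_nonneg (hh.isMajorant _).nonneg) (by positivity)).trans (le_of_eq ?_)
      have : n + 1 + 1 = (i + 1) + (n - i + 1) := by omega
      rw [this, pow_add]; ring

/-- In each convolution one factor is taken in the sup norm and the other one in `L¹`, so that `A`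
enters only once. -/
lemma majorant_le_catalan (hh : IsDatum h A P R) (n : ℕ) (ξ : Plane) :
    majorant h n ξ ≤ catalan n * A * P ^ n := by
  have hP := hh.nonneg_mass
  have hA := hh.nonneg_sup
  induction n using Nat.strong_induction_on generalizing ξ with
  | _ n ih =>
    cases n with
    | zero => simpa [majorant] using hh.le_sup ξ
    | succ n =>
      rw [majorant, catalan_succ]
      push_cast
      rw [Finset.sum_mul, Finset.sum_mul]
      refine Finset.sum_le_sum fun i _ => ?_
      refine ((hh.isMajorant i).rconv_le (hh.isMajorant _) (ih i i.2) ξ).trans ?_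
      refine (mul_le_mul_of_nonneg_left (hh.integral_majorant_le (n - i))
        (by positivity)).trans (le_of_eq ?_)
      have : P ^ (n + 1) = P ^ (i : ℕ) * P ^ (n - (i : ℕ) + 1) := by
        rw [← pow_add]; congr 1; omega
      rw [this]; ring

lemma catalan_le (n : ℕ) : (catalan n : ℝ) ≤ 4 ^ n := by
  have h1 : catalan n ≤ 4 ^ n := by
    rw [catalan_eq_centralBinom_div]
    refine (Nat.div_le_self _ _).trans ?_
    rw [Nat.centralBinom, show 4 ^ n = 2 ^ (2 * n) by rw [pow_mul]; norm_num]
    exact Nat.choose_le_two_pow _ _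
  exact_mod_cast h1

lemma majorant_le (hh : IsDatum h A P R) (n : ℕ) (ξ : Plane) :
    majorant h n ξ ≤ A * (4 * P) ^ n := by
  have hP := hh.nonneg_mass
  have hA := hh.nonneg_sup
  refine (hh.majorant_le_catalan n ξ).trans ?_
  calc (catalan n : ℝ) * A * P ^ n ≤ 4 ^ n * A * P ^ n := by gcongr; exact catalan_le n
    _ = _ := by rw [mul_pow]; ring

/-- Radii of supports add under convolution, and `(i + 1) + (n - i + 1) = n + 2`. -/
lemma majorant_support (hh : IsDatum h A P R) (n : ℕ) (ξ : Plane) (hξ : (n + 1) * R < ‖ξ‖) :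
    majorant h n ξ = 0 := by
  induction n using Nat.strong_induction_on generalizing ξ with
  | _ n ih =>
    cases n with
    | zero => rw [majorant]; exact hh.support ξ (by simpa using hξ)
    | succ n =>
      rw [majorant]
      refine Finset.sum_eq_zero fun i _ => ?_
      rw [rconv, ← integral_zero Plane ℝ]
      refine integral_congr_ae (Eventually.of_forall fun ζ => ?_)
      simp only
      by_cases h1 : ((i : ℕ) + 1) * R < ‖ξ - ζ‖
      · rw [ih i i.2 _ h1, zero_mul]
      · rw [ih (n - i) (by omega) ζ, mul_zero]
        have h2 := norm_sub_norm_le ξ ζ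
        have h3 : ((n - i : ℕ) : ℝ) = n - i := by
          rw [Nat.cast_sub (by omega)]
        rw [h3]
        push_cast at hξ
        linarith

end IsDatum

/-- A sum of quadratic interactions of a scalar unknown with itself on the Fourier side:
`Q z (t, ξ) = ∑ l, M l (t, ξ) ∫ L l z (t, ξ - ζ) * R l z (t, ζ) dζ`, where `L l z` and `R l z` are
combinations of `z (t, ξ)` and of `conj (z (t, -ξ))`. -/
structure Interaction (ι : Type) where
  /-- the first coefficient on the left -/
  cl : ι → ℝ → Plane → ℂ
  /-- the second coefficient on the left -/
  dl : ι → ℝ → Plane → ℂ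
  /-- the first coefficient on the right -/
  cr : ι → ℝ → Plane → ℂ
  /-- the second coefficient on the right -/
  dr : ι → ℝ → Plane → ℂ
  /-- the multiplier -/
  M : ι → ℝ → Plane → ℂ

set_option linter.unusedSectionVars false

namespace Interaction

variable {ι : Type} [Fintype ι] (J : Interaction ι)

/-- The left factor of the interaction `l`. -/
def left (l : ι) (f : ℝ → Plane → ℂ) : ℝ → Plane → ℂ := MajorizedBy.comb (J.cl l) (J.dl l) f

/-- The right factor of the interaction `l`. -/
def right (l : ι) (f : ℝ → Plane → ℂ) : ℝ → Plane → ℂ := MajorizedBy.comb (J.cr l) (J.dr l) f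

/-- The bilinear form of the interaction. -/
def form (f g : ℝ → Plane → ℂ) (t : ℝ) (ξ : Plane) : ℂ :=
  ∑ l, J.M l t ξ * conv (J.left l f t) (J.right l g t) ξ

/-- The coefficients are measurable in frequency, continuous in time and bounded by `κ`; the
multipliers are bounded by `m`. -/
structure IsBounded (κ : ℝ) (m : Plane → ℝ) : Prop where
  meas : ∀ l t, Measurable (J.cl l t) ∧ Measurable (J.dl l t) ∧ Measurable (J.cr l t) ∧
    Measurable (J.dr l t) ∧ Measurable (J.M l t)
  cont : ∀ l ξ, (Continuous fun t => J.cl l t ξ) ∧ (Continuous fun t => J.dl l t ξ) ∧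
    (Continuous fun t => J.cr l t ξ) ∧ (Continuous fun t => J.dr l t ξ) ∧
    (Continuous fun t => J.M l t ξ)
  norm_cl : ∀ l t ξ, ‖J.cl l t ξ‖ ≤ κ
  norm_dl : ∀ l t ξ, ‖J.dl l t ξ‖ ≤ κ
  norm_cr : ∀ l t ξ, ‖J.cr l t ξ‖ ≤ κ
  norm_dr : ∀ l t ξ, ‖J.dr l t ξ‖ ≤ κ
  norm_M : ∀ l t ξ, ‖J.M l t ξ‖ ≤ m ξ
  nonneg : 0 ≤ κ

/-- The terms of the expansion of the solution in powers of the datum. -/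
def iter (z₀ : Plane → ℂ) : ℕ → ℝ → Plane → ℂ
  | 0 => fun _ ξ => z₀ ξ
  | n + 1 => fun t ξ => ∫ s in (0 : ℝ)..t,
      ∑ i : Fin (n + 1), J.form (iter z₀ i) (iter z₀ (n - i)) s ξ

variable {J} {κ : ℝ} {m : Plane → ℝ} {k l : ℕ} {F G : Plane → ℝ} {f g : ℝ → Plane → ℂ}

namespace IsBounded

lemma left_majorizedBy (hJ : J.IsBounded κ m) (i : ι) (hf : MajorizedBy k F f)
    (hF : IsMajorant F) : MajorizedBy k (fun ξ => 2 * κ * F ξ) (J.left i f) :=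
  hf.comb_majorizedBy hF (fun t => (hJ.meas i t).1) (fun t => (hJ.meas i t).2.1)
    (fun ξ => (hJ.cont i ξ).1) (fun ξ => (hJ.cont i ξ).2.1) (hJ.norm_cl i) (hJ.norm_dl i)

lemma right_majorizedBy (hJ : J.IsBounded κ m) (i : ι) (hf : MajorizedBy k F f)
    (hF : IsMajorant F) : MajorizedBy k (fun ξ => 2 * κ * F ξ) (J.right i f) :=
  hf.comb_majorizedBy hF (fun t => (hJ.meas i t).2.2.1) (fun t => (hJ.meas i t).2.2.2.1)
    (fun ξ => (hJ.cont i ξ).2.2.1) (fun ξ => (hJ.cont i ξ).2.2.2.1) (hJ.norm_cr i) (hJ.norm_dr i)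

lemma form_majorizedBy (hJ : J.IsBounded κ m) (hf : MajorizedBy k F f) (hF : IsMajorant F)
    (hg : MajorizedBy l G g) (hG : IsMajorant G) :
    MajorizedBy (k + l) (fun ξ => m ξ * (Fintype.card ι * (4 * κ ^ 2)) * rconv F G ξ)
      (J.form f g) := by
  have hκ := hJ.nonneg
  have h := MajorizedBy.sum (s := Finset.univ) fun i (_ : i ∈ Finset.univ) =>
    ((hJ.left_majorizedBy i hf hF).conv (hJ.right_majorizedBy i hg hG)
      (hF.const_mul (by positivity)) (hG.const_mul (by positivity))).mul
      (fun t => (hJ.meas i t).2.2.2.2) (fun ξ => (hJ.cont i ξ).2.2.2.2) (hJ.norm_M i)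
  refine h.mono fun ξ => le_of_eq ?_
  simp only [rconv_const_mul]
  rw [Finset.sum_const, Finset.card_univ, nsmul_eq_mul]
  ring

variable {h : Plane → ℝ} {A P R Λ : ℝ} {z₀ : Plane → ℂ}

/-- The growth rate of the terms of the expansion. -/
def rate (ι : Type) [Fintype ι] (κ Λ : ℝ) : ℝ := 8 * Fintype.card ι * κ ^ 2 * Λ

/-- The hypotheses under which the expansion is controlled by the majorants. -/
structure Controls (J : Interaction ι) (κ : ℝ) (m : Plane → ℝ) (h : Plane → ℝ) (A P R Λ : ℝ)
    (z₀ : Plane → ℂ) : Prop where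
  bounded : J.IsBounded κ m
  datum : IsDatum h A P R
  nonneg_mult : ∀ ξ, 0 ≤ m ξ
  mult_le : ∀ (n : ℕ) ξ, ‖ξ‖ ≤ (n + 2) * R → m ξ ≤ Λ * (n + 2)
  nonneg_rate : 0 ≤ Λ
  measurable : Measurable z₀
  norm_le : ∀ ξ, ‖z₀ ξ‖ ≤ h ξ

namespace Controls

/-- The multiplier acts on a function supported in the ball of radius `(n + 2) * R`, where it is at
most `Λ * (n + 2)`. -/
lemma mult_mul_majorant_le (hc : Controls J κ m h A P R Λ z₀) (n : ℕ) (ξ : Plane) :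
    m ξ * majorant h (n + 1) ξ ≤ Λ * (n + 2) * majorant h (n + 1) ξ := by
  by_cases hξ : ‖ξ‖ ≤ (n + 2) * R
  · exact mul_le_mul_of_nonneg_right (hc.mult_le n ξ hξ) ((hc.datum.isMajorant _).nonneg ξ)
  · rw [hc.datum.majorant_support (n + 1) ξ, mul_zero, mul_zero]
    push_cast
    push Not at hξ
    linarith

/-- The term of order `n + 1` before the integration in time. -/
def _root_.Boussinesq.Interaction.source (J : Interaction ι) (z₀ : Plane → ℂ) (n : ℕ) (t : ℝ)
    (ξ : Plane) : ℂ := ∑ i : Fin (n + 1), J.form (J.iter z₀ i) (J.iter z₀ (n - i)) t ξ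

lemma source_majorizedBy_of (hc : Controls J κ m h A P R Λ z₀) (n : ℕ)
    (ih : ∀ i ≤ n, MajorizedBy i (fun ξ => rate ι κ Λ ^ i * majorant h i ξ) (J.iter z₀ i)) :
    MajorizedBy n (fun ξ => m ξ * (Fintype.card ι * (4 * κ ^ 2)) * rate ι κ Λ ^ n *
      majorant h (n + 1) ξ) (J.source z₀ n) := by
  have hΛ := hc.nonneg_rate
  have hr : 0 ≤ rate ι κ Λ := by unfold rate; positivity
  have h1 := MajorizedBy.sum (k := n) (s := Finset.univ) (f := fun (i : Fin (n + 1)) =>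
    J.form (J.iter z₀ i) (J.iter z₀ (n - i))) (F := fun (i : Fin (n + 1)) ξ =>
      m ξ * (Fintype.card ι * (4 * κ ^ 2)) * rconv (fun ξ => rate ι κ Λ ^ (i : ℕ) * majorant h i ξ)
        (fun ξ => rate ι κ Λ ^ (n - (i : ℕ)) * majorant h (n - i) ξ) ξ) fun i _ => by
    have := hc.bounded.form_majorizedBy (ih i (by omega))
      ((hc.datum.isMajorant i).const_mul (by positivity)) (ih (n - i) (by omega))
      ((hc.datum.isMajorant (n - i)).const_mul (by positivity))
    rwa [show (i : ℕ) + (n - i) = n by omega] at this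
  refine h1.mono fun ξ => le_of_eq ?_
  rw [majorant, Finset.mul_sum]
  refine Finset.sum_congr rfl fun i _ => ?_
  rw [rconv_const_mul, ← pow_add, show (i : ℕ) + (n - i) = n by omega]
  ring

/-- The loss `Λ * (n + 2)` from the multiplier meets the gain `1 / (n + 1)` from the time
integration. Their product is at most `2 * Λ`, so the terms grow only geometrically. -/
lemma iter_majorizedBy (hc : Controls J κ m h A P R Λ z₀) (n : ℕ) :
    MajorizedBy n (fun ξ => rate ι κ Λ ^ n * majorant h n ξ) (J.iter z₀ n) := by
  have hΛ := hc.nonneg_rate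
  have hr : 0 ≤ rate ι κ Λ := by unfold rate; positivity
  induction n using Nat.strong_induction_on with
  | _ n ih =>
    cases n with
    | zero =>
      rw [iter]
      refine ⟨fun t => hc.measurable, fun ξ => continuous_const, fun t ξ => ?_⟩
      simpa [majorant] using hc.norm_le ξ
    | succ n =>
      rw [iter]
      refine (hc.source_majorizedBy_of n fun i hi => ih i (by omega)).integral.mono fun ξ => ?_
      rw [div_le_iff₀ (by positivity)]
      have h1 := hc.mult_mul_majorant_le n ξ
      have h2 := (hc.datum.isMajorant (n + 1)).nonneg ξ
      calc m ξ * (Fintype.card ι * (4 * κ ^ 2)) * rate ι κ Λ ^ n * majorant h (n + 1) ξ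
          = (Fintype.card ι * (4 * κ ^ 2)) * rate ι κ Λ ^ n * (m ξ * majorant h (n + 1) ξ) := by
            ring
        _ ≤ (Fintype.card ι * (4 * κ ^ 2)) * rate ι κ Λ ^ n *
            (Λ * (n + 2) * majorant h (n + 1) ξ) := by gcongr
        -- `n + 2 ≤ 2 * (n + 1)`, and `4 * 2` is the constant `8` in `rate`.
        _ ≤ (Fintype.card ι * (4 * κ ^ 2)) * rate ι κ Λ ^ n *
            (Λ * (2 * (n + 1)) * majorant h (n + 1) ξ) := by gcongr; linarith
        _ = _ := by rw [pow_succ, rate]; ring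

lemma source_majorizedBy (hc : Controls J κ m h A P R Λ z₀) (n : ℕ) :
    MajorizedBy n (fun ξ => m ξ * (Fintype.card ι * (4 * κ ^ 2)) * rate ι κ Λ ^ n *
      majorant h (n + 1) ξ) (J.source z₀ n) :=
  hc.source_majorizedBy_of n fun i _ => hc.iter_majorizedBy i

lemma hasDerivAt_iter (hc : Controls J κ m h A P R Λ z₀) (n : ℕ) (t : ℝ) (ξ : Plane) :
    HasDerivAt (fun t => J.iter z₀ (n + 1) t ξ) (J.source z₀ n t ξ) t := by
  simp only [iter]
  exact (hc.source_majorizedBy n).hasDerivAt_integral t ξ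

/-- The outermost multiplier is kept as `m ξ` and not bounded by `Λ * (n + 2)`: at low frequency `m`
is of order one, while `Λ` may grow with the packet frequency. -/
lemma norm_iter_succ_le (hc : Controls J κ m h A P R Λ z₀) (n : ℕ) (t : ℝ) (ξ : Plane) :
    ‖J.iter z₀ (n + 1) t ξ‖ ≤ m ξ * (Fintype.card ι * (16 * κ ^ 2)) * A * P * |t| *
      (4 * rate ι κ Λ * |t| * P) ^ n := by
  have hΛ := hc.nonneg_rate
  have hr : 0 ≤ rate ι κ Λ := by unfold rate; positivity
  have hm := hc.nonneg_mult ξ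
  simp only [iter]
  refine ((hc.source_majorizedBy n).integral.bound t ξ).trans ?_
  have h2 := (hc.datum.isMajorant (n + 1)).nonneg ξ
  have h3 := hc.datum.majorant_le (n + 1) ξ
  calc |t| ^ (n + 1) * (m ξ * (Fintype.card ι * (4 * κ ^ 2)) * rate ι κ Λ ^ n *
        majorant h (n + 1) ξ / (n + 1))
      ≤ |t| ^ (n + 1) * (m ξ * (Fintype.card ι * (4 * κ ^ 2)) * rate ι κ Λ ^ n *
        majorant h (n + 1) ξ) := by
        gcongr
        exact div_le_self (by positivity) (by linarith [Nat.cast_nonneg (α := ℝ) n])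
    _ ≤ |t| ^ (n + 1) * (m ξ * (Fintype.card ι * (4 * κ ^ 2)) * rate ι κ Λ ^ n *
        (A * (4 * P) ^ (n + 1))) := by gcongr
    _ = _ := by simp only [pow_succ, mul_pow]; ring

end Controls

end IsBounded

end Interaction

end Boussinesq

end
-- Convergence of the expansion
noncomputable section

namespace Boussinesq

lemma weight_natCast (k : ℕ) (ξ : Plane) : weight k ξ = weight 1 ξ ^ k := by
  induction k with
  | zero => simp
  | succ k ih => rw [Nat.cast_succ, weight_add, ih, pow_succ]

lemma weight_one_le (ξ : Plane) : weight 1 ξ ≤ 1 + 2 * Real.pi * ‖ξ‖ := by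
  have h : 0 ≤ 2 * Real.pi * ‖ξ‖ := by positivity
  rw [weight, ← Real.sqrt_eq_rpow, Real.sqrt_le_left (by positivity)]
  nlinarith

lemma summable_succ_pow_mul_half (k : ℕ) :
    Summable fun n : ℕ => ((n : ℝ) + 1) ^ k * (1 / 2) ^ n := by
  have h := summable_pow_mul_geometric_of_norm_lt_one (R := ℝ) (r := 1 / 2) k
    (by rw [Real.norm_of_nonneg] <;> norm_num)
  have h2 := ((summable_nat_add_iff 1).2 h).mul_left 2
  refine h2.congr fun n => ?_
  push_cast; rw [pow_succ]; ring

lemma summable_half_pow : Summable fun n : ℕ => (1 / 2 : ℝ) ^ n :=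
  summable_geometric_of_lt_one (by norm_num) (by norm_num)

/-- On the support of the n-th majorant a Sobolev weight is polynomial in `n`, which a geometric
series absorbs. Hence the sum is rapidly decreasing although the supports grow. -/
lemma IsDatum.weight_mul_majorant_le {h : Plane → ℝ} {A P R : ℝ} (hh : IsDatum h A P R) (k n : ℕ)
    (ξ : Plane) : weight k ξ * majorant h n ξ ≤
      (1 + 2 * Real.pi * |R|) ^ k * (n + 1) ^ k * (A * (4 * P) ^ n) := by
  have hP := hh.nonneg_mass
  have hA := hh.nonneg_sup
  by_cases hξ : ‖ξ‖ ≤ (n + 1) * R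
  · refine mul_le_mul ?_ (hh.majorant_le n ξ) ((hh.isMajorant n).nonneg ξ) (by positivity)
    rw [weight_natCast, ← mul_pow]
    refine pow_le_pow_left₀ (weight_nonneg _ _) ((weight_one_le ξ).trans ?_) k
    have h1 : ‖ξ‖ ≤ (n + 1) * |R| :=
      hξ.trans (mul_le_mul_of_nonneg_left (le_abs_self R) (by positivity))
    have h2 := mul_le_mul_of_nonneg_left h1 (by positivity : 0 ≤ 2 * Real.pi)
    nlinarith [Nat.cast_nonneg (α := ℝ) n]
  · rw [hh.majorant_support n ξ (not_le.1 hξ), mul_zero]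
    positivity

set_option linter.unusedSectionVars false

namespace Interaction

variable {ι : Type} [Fintype ι] {J : Interaction ι} {κ : ℝ} {m : Plane → ℝ}
  {h : Plane → ℝ} {A P R Λ τ : ℝ} {z₀ : Plane → ℂ}

/-- The sum of the expansion. -/
def sol (J : Interaction ι) (z₀ : Plane → ℂ) (t : ℝ) (ξ : Plane) : ℂ := ∑' n, J.iter z₀ n t ξ

namespace IsBounded.Controls

lemma ratio_pow_le (hc : Controls J κ m h A P R Λ z₀) (hτ : 4 * rate ι κ Λ * τ * P ≤ 1 / 2)
    {t : ℝ} (ht : |t| ≤ τ) (n : ℕ) :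
    |t| ^ n * rate ι κ Λ ^ n * (4 * P) ^ n ≤ (1 / 2) ^ n := by
  have hP := hc.datum.nonneg_mass
  have hΛ := hc.nonneg_rate
  have hr : 0 ≤ rate ι κ Λ := by unfold rate; positivity
  rw [← mul_pow, ← mul_pow]
  refine pow_le_pow_left₀ (by positivity) (le_trans ?_ hτ) n
  calc |t| * rate ι κ Λ * (4 * P) ≤ τ * rate ι κ Λ * (4 * P) := by gcongr
    _ = _ := by ring

lemma weight_mul_iter_le (hc : Controls J κ m h A P R Λ z₀)
    (hτ : 4 * rate ι κ Λ * τ * P ≤ 1 / 2) {t : ℝ} (ht : |t| ≤ τ) (k n : ℕ) (ξ : Plane) :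
    weight k ξ * ‖J.iter z₀ n t ξ‖ ≤
      (1 + 2 * Real.pi * |R|) ^ k * A * ((n + 1) ^ k * (1 / 2) ^ n) := by
  have hP := hc.datum.nonneg_mass
  have hA := hc.datum.nonneg_sup
  have hΛ := hc.nonneg_rate
  have hr : 0 ≤ rate ι κ Λ := by unfold rate; positivity
  have hw := weight_nonneg k ξ
  calc weight k ξ * ‖J.iter z₀ n t ξ‖
      ≤ weight k ξ * (|t| ^ n * (rate ι κ Λ ^ n * majorant h n ξ)) := by
        gcongr; exact (hc.iter_majorizedBy n).bound t ξ
    _ = |t| ^ n * rate ι κ Λ ^ n * (weight k ξ * majorant h n ξ) := by ring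
    _ ≤ |t| ^ n * rate ι κ Λ ^ n *
        ((1 + 2 * Real.pi * |R|) ^ k * (n + 1) ^ k * (A * (4 * P) ^ n)) :=
        mul_le_mul_of_nonneg_left (hc.datum.weight_mul_majorant_le k n ξ) (by positivity)
    _ = (1 + 2 * Real.pi * |R|) ^ k * (n + 1) ^ k * A *
        (|t| ^ n * rate ι κ Λ ^ n * (4 * P) ^ n) := by ring
    _ ≤ (1 + 2 * Real.pi * |R|) ^ k * (n + 1) ^ k * A * (1 / 2) ^ n := by
        gcongr; exact hc.ratio_pow_le hτ ht n
    _ = _ := by ring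

lemma norm_iter_le (hc : Controls J κ m h A P R Λ z₀)
    (hτ : 4 * rate ι κ Λ * τ * P ≤ 1 / 2) {t : ℝ} (ht : |t| ≤ τ) (n : ℕ) (ξ : Plane) :
    ‖J.iter z₀ n t ξ‖ ≤ A * (1 / 2) ^ n := by
  simpa using hc.weight_mul_iter_le hτ ht 0 n ξ

lemma weight_mul_source_le (hc : Controls J κ m h A P R Λ z₀)
    (hτ : 4 * rate ι κ Λ * τ * P ≤ 1 / 2) {t : ℝ} (ht : |t| ≤ τ) (k n : ℕ) (ξ : Plane) :
    weight k ξ * ‖J.source z₀ n t ξ‖ ≤ (1 + 2 * Real.pi * |R|) ^ k * 2 ^ (k + 1) *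
      (Fintype.card ι * (4 * κ ^ 2)) * Λ * A * (4 * P) * ((n + 1) ^ (k + 1) * (1 / 2) ^ n) := by
  have hP := hc.datum.nonneg_mass
  have hA := hc.datum.nonneg_sup
  have hΛ := hc.nonneg_rate
  have hr : 0 ≤ rate ι κ Λ := by unfold rate; positivity
  have hw := weight_nonneg k ξ
  have h2 : ((n + 2 : ℝ)) ^ (k + 1) ≤ 2 ^ (k + 1) * (n + 1) ^ (k + 1) := by
    rw [← mul_pow]
    exact pow_le_pow_left₀ (by positivity) (by linarith [Nat.cast_nonneg (α := ℝ) n]) _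
  have h3 := hc.datum.weight_mul_majorant_le k (n + 1) ξ
  push_cast at h3
  rw [add_assoc, one_add_one_eq_two] at h3
  calc weight k ξ * ‖J.source z₀ n t ξ‖
      ≤ weight k ξ * (|t| ^ n * (m ξ * (Fintype.card ι * (4 * κ ^ 2)) * rate ι κ Λ ^ n *
      majorant h (n + 1) ξ)) := by
        gcongr; exact (hc.source_majorizedBy n).bound t ξ
    _ = weight k ξ * (|t| ^ n * ((Fintype.card ι * (4 * κ ^ 2)) * rate ι κ Λ ^ n *
        (m ξ * majorant h (n + 1) ξ))) := by ring
    _ ≤ weight k ξ * (|t| ^ n * ((Fintype.card ι * (4 * κ ^ 2)) * rate ι κ Λ ^ n *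
        (Λ * (n + 2) * majorant h (n + 1) ξ))) := by
        gcongr weight k ξ * (|t| ^ n * (_ * ?_)); exact hc.mult_mul_majorant_le n ξ
    _ = |t| ^ n * rate ι κ Λ ^ n * ((Fintype.card ι * (4 * κ ^ 2)) * Λ * (n + 2)) *
        (weight k ξ * majorant h (n + 1) ξ) := by ring
    _ ≤ |t| ^ n * rate ι κ Λ ^ n * ((Fintype.card ι * (4 * κ ^ 2)) * Λ * (n + 2)) *
        ((1 + 2 * Real.pi * |R|) ^ k * (n + 2) ^ k * (A * (4 * P) ^ (n + 1))) := by gcongr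
    _ = (1 + 2 * Real.pi * |R|) ^ k * (Fintype.card ι * (4 * κ ^ 2)) * Λ * A * (4 * P) *
        (n + 2) ^ (k + 1) * (|t| ^ n * rate ι κ Λ ^ n * (4 * P) ^ n) := by ring
    _ ≤ (1 + 2 * Real.pi * |R|) ^ k * (Fintype.card ι * (4 * κ ^ 2)) * Λ * A * (4 * P) *
        (2 ^ (k + 1) * (n + 1) ^ (k + 1)) * (1 / 2) ^ n := by
        gcongr; exact hc.ratio_pow_le hτ ht n
    _ = _ := by ring

lemma summable_norm_iter (hc : Controls J κ m h A P R Λ z₀)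
    (hτ : 4 * rate ι κ Λ * τ * P ≤ 1 / 2) {t : ℝ} (ht : |t| ≤ τ) (ξ : Plane) :
    Summable fun n => ‖J.iter z₀ n t ξ‖ :=
  .of_nonneg_of_le (fun _ => norm_nonneg _) (fun n => hc.norm_iter_le hτ ht n ξ)
    (summable_half_pow.mul_left A)

lemma hasSum_iter (hc : Controls J κ m h A P R Λ z₀)
    (hτ : 4 * rate ι κ Λ * τ * P ≤ 1 / 2) {t : ℝ} (ht : |t| ≤ τ) (ξ : Plane) :
    HasSum (fun n => J.iter z₀ n t ξ) (J.sol z₀ t ξ) :=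
  (hc.summable_norm_iter hτ ht ξ).of_norm.hasSum

lemma measurable_sol (hc : Controls J κ m h A P R Λ z₀)
    (hτ : 4 * rate ι κ Λ * τ * P ≤ 1 / 2) {t : ℝ} (ht : |t| ≤ τ) : Measurable (J.sol z₀ t) := by
  refine measurable_of_tendsto_metrizable
    (f := fun N ξ => ∑ n ∈ Finset.range N, J.iter z₀ n t ξ)
    (fun N => Finset.measurable_fun_sum _ fun n _ => (hc.iter_majorizedBy n).measurable t) ?_
  rw [tendsto_pi_nhds]
  exact fun ξ => (hc.hasSum_iter hτ ht ξ).tendsto_sum_nat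

/-- The exponent `p` allows for the extra power of `n` that the source terms carry because of the
multiplier. -/
lemma exists_weight_mul_tsum_le {f : ℕ → ℝ → Plane → ℂ} {τ : ℝ} {p : ℕ}
    (hf : ∀ k : ℕ, ∃ K : ℝ, ∀ (n : ℕ) (t : ℝ) ξ, |t| ≤ τ →
      weight k ξ * ‖f n t ξ‖ ≤ K * ((n + 1) ^ (k + p) * (1 / 2) ^ n)) (s : ℝ) :
    ∃ K : ℝ, ∀ t ξ, |t| ≤ τ → weight s ξ * ‖∑' n, f n t ξ‖ ≤ K := by
  obtain ⟨k, hk⟩ := exists_nat_ge s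
  obtain ⟨K, hK⟩ := hf k
  have hs := (summable_succ_pow_mul_half (k + p)).mul_left K
  refine ⟨∑' n : ℕ, K * ((n + 1) ^ (k + p) * (1 / 2) ^ n), fun t ξ ht => ?_⟩
  have hw := weight_pos k ξ
  have h1 := tsum_of_norm_bounded (f := fun n => f n t ξ) (hs.hasSum.mul_left (weight k ξ)⁻¹)
    fun n => by
      rw [← div_eq_inv_mul, le_div_iff₀ hw, mul_comm]
      exact hK n t ξ ht
  calc weight s ξ * ‖∑' n, f n t ξ‖ ≤ weight k ξ * ‖∑' n, f n t ξ‖ :=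
        mul_le_mul_of_nonneg_right (weight_mono hk ξ) (norm_nonneg _)
    _ ≤ _ := by
        rwa [← div_eq_inv_mul, le_div_iff₀ hw, mul_comm] at h1

lemma exists_weight_mul_sol_le (hc : Controls J κ m h A P R Λ z₀)
    (hτ : 4 * rate ι κ Λ * τ * P ≤ 1 / 2) (s : ℝ) :
    ∃ K : ℝ, ∀ t ξ, |t| ≤ τ → weight s ξ * ‖J.sol z₀ t ξ‖ ≤ K :=
  exists_weight_mul_tsum_le (p := 0)
    (fun k => ⟨_, fun n _ ξ ht => hc.weight_mul_iter_le hτ ht k n ξ⟩) s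

lemma left_sol (hc : Controls J κ m h A P R Λ z₀)
    (hτ : 4 * rate ι κ Λ * τ * P ≤ 1 / 2) {t : ℝ} (ht : |t| ≤ τ) (l : ι) (ξ : Plane) :
    HasSum (fun n => J.left l (J.iter z₀ n) t ξ) (J.left l (J.sol z₀) t ξ) :=
  ((hc.hasSum_iter hτ ht ξ).mul_left _).add ((hc.hasSum_iter hτ ht (-ξ)).star.mul_left _)

lemma right_sol (hc : Controls J κ m h A P R Λ z₀)
    (hτ : 4 * rate ι κ Λ * τ * P ≤ 1 / 2) {t : ℝ} (ht : |t| ≤ τ) (l : ι) (ξ : Plane) :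
    HasSum (fun n => J.right l (J.iter z₀ n) t ξ) (J.right l (J.sol z₀) t ξ) :=
  ((hc.hasSum_iter hτ ht ξ).mul_left _).add ((hc.hasSum_iter hτ ht (-ξ)).star.mul_left _)

lemma left_iter (hc : Controls J κ m h A P R Λ z₀) (l : ι) (n : ℕ) :
    MajorizedBy n (fun ξ => 2 * κ * rate ι κ Λ ^ n * majorant h n ξ) (J.left l (J.iter z₀ n)) := by
  have hΛ := hc.nonneg_rate
  have hr : 0 ≤ rate ι κ Λ := by unfold rate; positivity
  exact (hc.bounded.left_majorizedBy l (hc.iter_majorizedBy n)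
    ((hc.datum.isMajorant n).const_mul (by positivity))).mono fun ξ => (mul_assoc _ _ _).ge

lemma right_iter (hc : Controls J κ m h A P R Λ z₀) (l : ι) (n : ℕ) :
    MajorizedBy n (fun ξ => 2 * κ * rate ι κ Λ ^ n * majorant h n ξ)
      (J.right l (J.iter z₀ n)) := by
  have hΛ := hc.nonneg_rate
  have hr : 0 ≤ rate ι κ Λ := by unfold rate; positivity
  exact (hc.bounded.right_majorizedBy l (hc.iter_majorizedBy n)
    ((hc.datum.isMajorant n).const_mul (by positivity))).mono fun ξ => (mul_assoc _ _ _).ge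

lemma majorant_two_mul (hc : Controls J κ m h A P R Λ z₀) (n : ℕ) :
    IsMajorant fun ξ => 2 * κ * rate ι κ Λ ^ n * majorant h n ξ := by
  have hΛ := hc.nonneg_rate
  have hκ := hc.bounded.nonneg
  have hr : 0 ≤ rate ι κ Λ := by unfold rate; positivity
  exact (hc.datum.isMajorant n).const_mul (by positivity)

lemma summable_norm_left (hc : Controls J κ m h A P R Λ z₀)
    (hτ : 4 * rate ι κ Λ * τ * P ≤ 1 / 2) {t : ℝ} (ht : |t| ≤ τ) {f : ℕ → ℝ → Plane → ℂ}
    (hf : ∀ n, MajorizedBy n (fun ξ => 2 * κ * rate ι κ Λ ^ n * majorant h n ξ) (f n))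
    (ξ : Plane) : Summable fun n => ‖f n t ξ‖ := by
  have hA := hc.datum.nonneg_sup
  have hΛ := hc.nonneg_rate
  have hκ := hc.bounded.nonneg
  have hr : 0 ≤ rate ι κ Λ := by unfold rate; positivity
  refine .of_nonneg_of_le (fun _ => norm_nonneg _) (fun n => ?_)
    (summable_half_pow.mul_left (2 * κ * A))
  calc ‖f n t ξ‖ ≤ |t| ^ n * (2 * κ * rate ι κ Λ ^ n * majorant h n ξ) := (hf n).bound t ξ
    _ ≤ |t| ^ n * (2 * κ * rate ι κ Λ ^ n * (A * (4 * P) ^ n)) := by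
        gcongr; exact hc.datum.majorant_le n ξ
    _ = 2 * κ * A * (|t| ^ n * rate ι κ Λ ^ n * (4 * P) ^ n) := by ring
    _ ≤ _ := by gcongr; exact hc.ratio_pow_le hτ ht n

/-- Under the integral this is the Cauchy product of two absolutely convergent series; the majorants
provide the summable bound for exchanging sum and integral. -/
lemma conv_sol (hc : Controls J κ m h A P R Λ z₀)
    (hτ : 4 * rate ι κ Λ * τ * P ≤ 1 / 2) {t : ℝ} (ht : |t| ≤ τ) (l : ι) (ξ : Plane) :
    HasSum (fun n => ∑ i : Fin (n + 1), conv (J.left l (J.iter z₀ i) t)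
      (J.right l (J.iter z₀ (n - i)) t) ξ)
      (conv (J.left l (J.sol z₀) t) (J.right l (J.sol z₀) t) ξ) := by
  have hA := hc.datum.nonneg_sup
  have hP := hc.datum.nonneg_mass
  have hΛ := hc.nonneg_rate
  have hκ := hc.bounded.nonneg
  have hr : 0 ≤ rate ι κ Λ := by unfold rate; positivity
  have hint : ∀ (n : ℕ) (i : Fin (n + 1)), Integrable fun ζ =>
      J.left l (J.iter z₀ i) t (ξ - ζ) * J.right l (J.iter z₀ (n - i)) t ζ := fun n i =>
    (hc.left_iter l i).integrable_integrand (hc.right_iter l _) (hc.majorant_two_mul i)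
      (hc.majorant_two_mul _) t ξ
  have hsum := hasSum_integral_of_summable_integral_norm
    (F := fun (n : ℕ) ζ => ∑ i : Fin (n + 1),
      J.left l (J.iter z₀ i) t (ξ - ζ) * J.right l (J.iter z₀ (n - i)) t ζ) (μ := volume)
    (fun n => integrable_finsetSum _ fun (i : Fin (n + 1)) _ => hint n i) ?_
  · have e1 : ∀ n : ℕ, ∫ ζ, ∑ i : Fin (n + 1),
        J.left l (J.iter z₀ i) t (ξ - ζ) * J.right l (J.iter z₀ (n - i)) t ζ =
        ∑ i : Fin (n + 1), conv (J.left l (J.iter z₀ i) t) (J.right l (J.iter z₀ (n - i)) t) ξ :=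
      fun n => integral_finsetSum _ fun (i : Fin (n + 1)) _ => hint n i
    have e2 : ∀ ζ, ∑' n : ℕ, ∑ i : Fin (n + 1),
        J.left l (J.iter z₀ i) t (ξ - ζ) * J.right l (J.iter z₀ (n - i)) t ζ =
        J.left l (J.sol z₀) t (ξ - ζ) * J.right l (J.sol z₀) t ζ := fun ζ => by
      rw [← (hc.left_sol hτ ht l (ξ - ζ)).tsum_eq, ← (hc.right_sol hτ ht l ζ).tsum_eq,
        tsum_mul_tsum_eq_tsum_sum_range_of_summable_norm
          (hc.summable_norm_left hτ ht (hc.left_iter l) _)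
          (hc.summable_norm_left hτ ht (hc.right_iter l) _)]
      exact tsum_congr fun n => (Finset.sum_range fun i =>
        J.left l (J.iter z₀ i) t (ξ - ζ) * J.right l (J.iter z₀ (n - i)) t ζ).symm
    simp only [e1, e2] at hsum
    exact hsum
  · refine .of_nonneg_of_le (fun _ => integral_nonneg fun _ => norm_nonneg _) (fun n => ?_)
      (summable_half_pow.mul_left (4 * κ ^ 2 * A * (4 * P)))
    have hH : ∀ i : Fin (n + 1), Integrable fun ζ =>
        majorant h i (ξ - ζ) * majorant h (n - i) ζ := fun i =>
      (hc.datum.isMajorant i).integrable_integrand (hc.datum.isMajorant _) ξ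
    calc ∫ ζ, ‖∑ i : Fin (n + 1),
          J.left l (J.iter z₀ i) t (ξ - ζ) * J.right l (J.iter z₀ (n - i)) t ζ‖
        ≤ ∫ ζ, |t| ^ n * rate ι κ Λ ^ n * (4 * κ ^ 2) * ∑ i : Fin (n + 1),
          majorant h i (ξ - ζ) * majorant h (n - i) ζ := by
          refine integral_mono (integrable_finsetSum _ fun (i : Fin (n + 1)) _ => hint n i).norm
            ((integrable_finsetSum _ fun (i : Fin (n + 1)) _ => hH i).const_mul _) fun ζ => ?_
          refine (norm_sum_le _ _).trans ?_
          rw [Finset.mul_sum]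
          refine Finset.sum_le_sum fun i _ => ?_
          refine ((hc.left_iter l i).norm_integrand_le (hc.right_iter l (n - i)) t ξ ζ).trans
            (le_of_eq ?_)
          have e1 : rate ι κ Λ ^ n = rate ι κ Λ ^ (i : ℕ) * rate ι κ Λ ^ (n - (i : ℕ)) := by
            rw [← pow_add]; congr 1; omega
          rw [e1, show (i : ℕ) + (n - i) = n by omega]; ring
      _ = |t| ^ n * rate ι κ Λ ^ n * (4 * κ ^ 2) * majorant h (n + 1) ξ := by
          rw [integral_const_mul, integral_finsetSum _ fun (i : Fin (n + 1)) _ => hH i, majorant]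
          rfl
      _ ≤ |t| ^ n * rate ι κ Λ ^ n * (4 * κ ^ 2) * (A * (4 * P) ^ (n + 1)) := by
          gcongr; exact hc.datum.majorant_le _ ξ
      _ = 4 * κ ^ 2 * A * (4 * P) * (|t| ^ n * rate ι κ Λ ^ n * (4 * P) ^ n) := by ring
      _ ≤ _ := by gcongr; exact hc.ratio_pow_le hτ ht n

lemma source_sol (hc : Controls J κ m h A P R Λ z₀)
    (hτ : 4 * rate ι κ Λ * τ * P ≤ 1 / 2) {t : ℝ} (ht : |t| ≤ τ) (ξ : Plane) :
    ∑' n, J.source z₀ n t ξ = J.form (J.sol z₀) (J.sol z₀) t ξ := by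
  have h1 := hasSum_sum (s := Finset.univ) fun l (_ : l ∈ Finset.univ) =>
    (hc.conv_sol hτ ht l ξ).mul_left (J.M l t ξ)
  refine Eq.trans (tsum_congr fun n => ?_) h1.tsum_eq
  simp only [source, form, Finset.mul_sum]
  exact Finset.sum_comm

/-- Termwise differentiation: the series of derivatives is dominated by a fixed summable series on
`(-τ, τ)`, and its sum is the full quadratic form by `source_sol`. -/
lemma hasDerivAt_sol (hc : Controls J κ m h A P R Λ z₀)
    (hτ : 4 * rate ι κ Λ * τ * P ≤ 1 / 2) {t : ℝ} (ht : |t| < τ) (ξ : Plane) :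
    HasDerivAt (fun t => J.sol z₀ t ξ) (J.form (J.sol z₀) (J.sol z₀) t ξ) t := by
  rw [← hc.source_sol hτ ht.le]
  have hs : Summable fun n => J.iter z₀ n t ξ := (hc.summable_norm_iter hτ ht.le ξ).of_norm
  have hmem : ∀ {t : ℝ}, t ∈ Ioo (-τ) τ → |t| ≤ τ := fun h => (abs_lt.2 h).le
  have h1 : HasDerivAt (fun t => ∑' n, J.iter z₀ (n + 1) t ξ) (∑' n, J.source z₀ n t ξ) t := by
    obtain ⟨K, hK⟩ : ∃ K : ℝ, ∀ (n : ℕ) (y : ℝ), |y| ≤ τ →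
        ‖J.source z₀ n y ξ‖ ≤ K * (((n : ℝ) + 1) ^ 1 * (1 / 2) ^ n) := ⟨_, fun n y hy => by
      have := hc.weight_mul_source_le hτ hy 0 n ξ
      rw [Nat.cast_zero, weight_zero, one_mul] at this
      exact this⟩
    exact hasDerivAt_tsum_of_isPreconnected ((summable_succ_pow_mul_half 1).mul_left K) isOpen_Ioo
      isPreconnected_Ioo (fun n y _ => hc.hasDerivAt_iter n y ξ) (fun n y hy => hK n y (hmem hy))
      (abs_lt.1 ht) ((summable_nat_add_iff 1).2 hs) (abs_lt.1 ht)
  refine (h1.const_add (z₀ ξ)).congr_of_eventuallyEq ?_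
  filter_upwards [isOpen_Ioo.mem_nhds (abs_lt.1 ht)] with y hy
  have := ((hc.summable_norm_iter hτ (hmem hy) ξ).of_norm).tsum_eq_zero_add
  simpa [sol, iter] using this

lemma exists_weight_mul_form_le (hc : Controls J κ m h A P R Λ z₀)
    (hτ : 4 * rate ι κ Λ * τ * P ≤ 1 / 2) (s : ℝ) :
    ∃ K : ℝ, ∀ t ξ, |t| ≤ τ → weight s ξ * ‖J.form (J.sol z₀) (J.sol z₀) t ξ‖ ≤ K := by
  obtain ⟨K, hK⟩ := exists_weight_mul_tsum_le (f := J.source z₀) (τ := τ) (p := 1)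
    (fun k => ⟨_, fun n _ ξ ht => hc.weight_mul_source_le hτ ht k n ξ⟩) s
  exact ⟨K, fun t ξ ht => by rw [← hc.source_sol hτ ht]; exact hK t ξ ht⟩

lemma sol_zero (J : Interaction ι) (z₀ : Plane → ℂ) (ξ : Plane) : J.sol z₀ 0 ξ = z₀ ξ := by
  have h0 : ∀ n, n ≠ 0 → J.iter z₀ n 0 ξ = 0 := fun n hn => by
    obtain ⟨n, rfl⟩ := Nat.exists_eq_succ_of_ne_zero hn
    simp [iter]
  rw [sol, tsum_eq_single 0 h0, iter]

/-- The solution is close to its expansion to second order in the datum. -/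
lemma norm_sol_sub_le (hc : Controls J κ m h A P R Λ z₀) {t : ℝ} (ht : 0 ≤ t)
    (hτ : 4 * rate ι κ Λ * t * P ≤ 1 / 2) (ξ : Plane) :
    ‖J.sol z₀ t ξ - z₀ ξ - ∫ s in (0 : ℝ)..t, J.form (fun _ => z₀) (fun _ => z₀) s ξ‖ ≤
      m ξ * (Fintype.card ι * (32 * κ ^ 2)) * A * P * t * (4 * rate ι κ Λ * t * P) := by
  have hA := hc.datum.nonneg_sup
  have hP := hc.datum.nonneg_mass
  have hΛ := hc.nonneg_rate
  have hκ := hc.bounded.nonneg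
  have hr : 0 ≤ rate ι κ Λ := by unfold rate; positivity
  have hm := hc.nonneg_mult ξ
  set θ := 4 * rate ι κ Λ * t * P with hθ
  have hθ0 : 0 ≤ θ := by positivity
  have hs := (hc.summable_norm_iter hτ (abs_of_nonneg ht).le ξ).of_norm
  -- The terms of index `0` and `1` are the datum and its quadratic interaction. The rest starts at
  -- third order in the datum, and is dominated by a geometric series of ratio `θ ≤ 1 / 2` that
  -- starts with one factor `θ`.
  have e1 : J.sol z₀ t ξ - z₀ ξ - ∫ s in (0 : ℝ)..t, J.form (fun _ => z₀) (fun _ => z₀) s ξ =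
      ∑' n, J.iter z₀ (n + 2) t ξ := by
    rw [sol, ← hs.sum_add_tsum_nat_add 2, Finset.sum_range_succ, Finset.sum_range_one]
    have i0 : J.iter z₀ 0 = fun _ => z₀ := by funext t ξ; rw [iter]
    have i1 : J.iter z₀ 1 t ξ = ∫ s in (0 : ℝ)..t, J.form (fun _ => z₀) (fun _ => z₀) s ξ := by
      rw [iter]; simp [i0]
    rw [i1, i0]; ring
  rw [e1]
  have h2 := ((hasSum_geometric_of_lt_one hθ0 (by linarith)).mul_left
    (m ξ * (Fintype.card ι * (16 * κ ^ 2)) * A * P * t * θ))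
  refine (tsum_of_norm_bounded h2 fun n => ?_).trans ?_
  · have := hc.norm_iter_succ_le (n + 1) t ξ
    rw [abs_of_nonneg ht, ← hθ, pow_succ θ n] at this
    linarith
  · have h3 : (1 - θ)⁻¹ ≤ 2 := by
      rw [inv_le_comm₀ (by linarith) (by norm_num)]; linarith
    calc _ ≤ m ξ * (Fintype.card ι * (16 * κ ^ 2)) * A * P * t * θ * 2 := by gcongr
      _ = _ := by ring

end IsBounded.Controls

end Interaction

end Boussinesq

end
-- From curves on the Fourier side to curves of functions
noncomputable section

namespace Boussinesq

/-- The unimodular complex number with argument `θ`. -/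
def osc (θ : ℝ) : ℂ := Complex.exp (θ * Complex.I)

@[simp] lemma norm_osc (θ : ℝ) : ‖osc θ‖ = 1 := Complex.norm_exp_ofReal_mul_I θ

lemma conj_osc (θ : ℝ) : starRingEnd ℂ (osc θ) = osc (-θ) := by
  simp [osc, ← Complex.exp_conj]

lemma osc_add (θ φ : ℝ) : osc (θ + φ) = osc θ * osc φ := by
  rw [osc, osc, osc, ← Complex.exp_add]; push_cast; ring_nf

@[simp] lemma osc_zero : osc 0 = 1 := by simp [osc]

@[simp] lemma osc_neg_mul (θ : ℝ) : osc (-θ) * osc θ = 1 := by rw [← osc_add]; simp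

lemma continuous_osc : Continuous osc :=
  Complex.continuous_exp.comp (Complex.continuous_ofReal.mul continuous_const)

lemma hasDerivAt_osc_mul (l t : ℝ) :
    HasDerivAt (fun t => osc (l * t)) (Complex.I * l * osc (l * t)) t := by
  have h1 : HasDerivAt (fun t : ℝ => ((l * t : ℝ) : ℂ) * Complex.I) (l * Complex.I) t := by
    have := ((hasDerivAt_id t).const_mul l).ofReal_comp.mul_const Complex.I
    simpa using this
  refine h1.cexp.congr_deriv ?_
  rw [osc]; ring

/-- Functions with a real inverse Fourier transform. -/
def Hermitian (g : Plane → ℂ) : Prop := ∀ ξ, g (-ξ) = starRingEnd ℂ (g ξ)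

lemma fourierInv_eq_integral (g : Plane → ℂ) (x : Plane) :
    𝓕⁻ g x = ∫ ξ, osc (2 * Real.pi * inner ℝ ξ x) * g ξ := by
  rw [Real.fourierInv_eq']
  rfl

lemma Hermitian.ofReal_re_fourierInv {g : Plane → ℂ} (h : Hermitian g) (x : Plane) :
    (((𝓕⁻ g x).re : ℝ) : ℂ) = 𝓕⁻ g x := by
  rw [← Complex.conj_eq_iff_re, fourierInv_eq_integral, ← integral_conj, ← integral_neg_eq_self]
  refine integral_congr_ae (Eventually.of_forall fun ξ => ?_)
  simp only [map_mul, conj_osc, h ξ, Complex.conj_conj, inner_neg_left]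
  congr 2; ring

/-- Curves of rapidly decreasing functions on the Fourier side, differentiable in time for each
frequency with derivative `g'`. -/
structure RapidCurve (τ : ℝ) (g g' : ℝ → Plane → ℂ) : Prop where
  measurable : ∀ t, |t| < τ → Measurable (g t)
  hasDerivAt : ∀ t, |t| < τ → ∀ ξ, HasDerivAt (fun t => g t ξ) (g' t ξ) t
  bound : ∀ s : ℝ, ∃ K : ℝ, ∀ t ξ, |t| < τ → weight s ξ * ‖g t ξ‖ ≤ K
  bound_deriv : ∀ s : ℝ, ∃ K : ℝ, ∀ t ξ, |t| < τ → weight s ξ * ‖g' t ξ‖ ≤ K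

lemma rapid_of_bound {g : Plane → ℂ} (hg : Measurable g)
    (h : ∀ s : ℝ, ∃ K : ℝ, ∀ ξ, weight s ξ * ‖g ξ‖ ≤ K) : Rapid g := by
  intro s
  obtain ⟨K, hK⟩ := h (s + 2)
  refine MemLp.of_le_mul (c := K) memLp_weight_neg_two
    ((Complex.continuous_ofReal.comp (continuous_weight s)).aestronglyMeasurable.mul
      hg.aestronglyMeasurable) (Eventually.of_forall fun ξ => ?_)
  rw [norm_weight_mul, Real.norm_of_nonneg (weight_nonneg _ _), weight_neg, ← div_eq_mul_inv,
    le_div_iff₀ (weight_pos _ _)]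
  refine le_trans (le_of_eq ?_) (hK ξ)
  rw [weight_add]; ring

namespace RapidCurve

variable {τ : ℝ} {g g' f f' : ℝ → Plane → ℂ}

/-- The derivative is a pointwise limit of difference quotients, along a sequence of times that
stays in `(-τ, τ)`. -/
lemma measurable_deriv (h : RapidCurve τ g g') {t : ℝ} (ht : |t| < τ) : Measurable (g' t) := by
  set u : ℕ → ℝ := fun n => t + (τ - |t|) / (n + 2) with hu
  have hpos : ∀ n : ℕ, 0 < (τ - |t|) / (n + 2) := fun n => div_pos (by linarith) (by positivity)
  have hlt : ∀ n, |u n| < τ := fun n => by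
    have h1 : (τ - |t|) / (n + 2) < τ - |t| := by
      rw [div_lt_iff₀ (by positivity)]
      nlinarith [Nat.cast_nonneg (α := ℝ) n]
    calc |u n| ≤ |t| + |(τ - |t|) / (n + 2)| := abs_add_le _ _
      _ < τ := by rw [abs_of_pos (hpos n)]; linarith
  have hlim : Tendsto u atTop (𝓝[≠] t) := by
    refine tendsto_nhdsWithin_iff.2 ⟨?_, Eventually.of_forall fun n => ?_⟩
    · have h2 : Tendsto (fun n : ℕ => (n : ℝ) + 2) atTop atTop :=
        tendsto_atTop_add_const_right _ _ tendsto_natCast_atTop_atTop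
      simpa using (tendsto_const_nhds (x := t)).add (h2.const_div_atTop (τ - |t|))
    · exact (by linarith [hpos n] : t < t + _).ne'
  refine measurable_of_tendsto_metrizable (f := fun n ξ => slope (fun t => g t ξ) t (u n))
    (fun n => ?_) (tendsto_pi_nhds.2 fun ξ =>
      ((hasDerivAt_iff_tendsto_slope.1 (h.hasDerivAt t ht ξ)).comp hlim))
  simp only [slope_def_module]
  exact ((h.measurable _ (hlt n)).sub (h.measurable _ ht)).const_smul _

lemma rapid (h : RapidCurve τ g g') {t : ℝ} (ht : |t| < τ) : Rapid (g t) :=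
  rapid_of_bound (h.measurable t ht) fun s => by
    obtain ⟨K, hK⟩ := h.bound s
    exact ⟨K, fun ξ => hK t ξ ht⟩

lemma rapid_deriv (h : RapidCurve τ g g') {t : ℝ} (ht : |t| < τ) : Rapid (g' t) :=
  rapid_of_bound (h.measurable_deriv ht) fun s => by
    obtain ⟨K, hK⟩ := h.bound_deriv s
    exact ⟨K, fun ξ => hK t ξ ht⟩

lemma add (h : RapidCurve τ g g') (k : RapidCurve τ f f') :
    RapidCurve τ (fun t ξ => g t ξ + f t ξ) (fun t ξ => g' t ξ + f' t ξ) where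
  measurable t ht := (h.measurable t ht).add (k.measurable t ht)
  hasDerivAt t ht ξ := (h.hasDerivAt t ht ξ).add (k.hasDerivAt t ht ξ)
  bound s := by
    obtain ⟨K, hK⟩ := h.bound s
    obtain ⟨L, hL⟩ := k.bound s
    refine ⟨K + L, fun t ξ ht => ?_⟩
    have := mul_le_mul_of_nonneg_left (norm_add_le (g t ξ) (f t ξ)) (weight_nonneg s ξ)
    linarith [hK t ξ ht, hL t ξ ht]
  bound_deriv s := by
    obtain ⟨K, hK⟩ := h.bound_deriv s
    obtain ⟨L, hL⟩ := k.bound_deriv s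
    refine ⟨K + L, fun t ξ ht => ?_⟩
    have := mul_le_mul_of_nonneg_left (norm_add_le (g' t ξ) (f' t ξ)) (weight_nonneg s ξ)
    linarith [hK t ξ ht, hL t ξ ht]

lemma symbol_bound {τ k C : ℝ} {p : Plane → ℂ} (hC : ∀ ξ, ‖p ξ‖ ≤ C * weight k ξ)
    (h : ∀ s : ℝ, ∃ K : ℝ, ∀ t ξ, |t| < τ → weight s ξ * ‖g t ξ‖ ≤ K) (s : ℝ) :
    ∃ K : ℝ, ∀ t ξ, |t| < τ → weight s ξ * ‖p ξ * g t ξ‖ ≤ K := by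
  obtain ⟨K, hK⟩ := h (s + k)
  refine ⟨C * K, fun t ξ ht => ?_⟩
  have hC0 : 0 ≤ C := by
    have := (norm_nonneg _).trans (hC ξ)
    exact nonneg_of_mul_nonneg_left this (weight_pos k ξ)
  calc weight s ξ * ‖p ξ * g t ξ‖ = weight s ξ * (‖p ξ‖ * ‖g t ξ‖) := by rw [norm_mul]
    _ ≤ weight s ξ * (C * weight k ξ * ‖g t ξ‖) := by
        have := weight_nonneg s ξ
        gcongr; exact hC ξ
    _ = C * (weight (s + k) ξ * ‖g t ξ‖) := by rw [weight_add]; ring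
    _ ≤ C * K := by gcongr; exact hK t ξ ht

lemma symbol_mul (h : RapidCurve τ g g') {p : Plane → ℂ} (hp : Measurable p) {C k : ℝ}
    (hC : ∀ ξ, ‖p ξ‖ ≤ C * weight k ξ) :
    RapidCurve τ (fun t ξ => p ξ * g t ξ) (fun t ξ => p ξ * g' t ξ) where
  measurable t ht := hp.mul (h.measurable t ht)
  hasDerivAt t ht ξ := (h.hasDerivAt t ht ξ).const_mul _
  bound := symbol_bound hC h.bound
  bound_deriv := symbol_bound hC h.bound_deriv

lemma weight_even (s : ℝ) (ξ : Plane) : weight s (-ξ) = weight s ξ := by simp [weight]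

lemma reflect (h : RapidCurve τ g g') :
    RapidCurve τ (fun t ξ => starRingEnd ℂ (g t (-ξ))) (fun t ξ => starRingEnd ℂ (g' t (-ξ))) where
  measurable t ht := Complex.continuous_conj.measurable.comp
    ((h.measurable t ht).comp measurable_neg)
  hasDerivAt t ht ξ := (h.hasDerivAt t ht (-ξ)).star
  bound s := by
    obtain ⟨K, hK⟩ := h.bound s
    exact ⟨K, fun t ξ ht => by rw [RCLike.norm_conj, ← weight_even]; exact hK t (-ξ) ht⟩
  bound_deriv s := by
    obtain ⟨K, hK⟩ := h.bound_deriv s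
    exact ⟨K, fun t ξ ht => by rw [RCLike.norm_conj, ← weight_even]; exact hK t (-ξ) ht⟩

lemma osc_mul (h : RapidCurve τ g g') {p : Plane → ℝ} (hp : Measurable p) {C k : ℝ}
    (hC : ∀ ξ, |p ξ| ≤ C * weight k ξ) :
    RapidCurve τ (fun t ξ => osc (p ξ * t) * g t ξ)
      (fun t ξ => osc (p ξ * t) * (Complex.I * p ξ * g t ξ + g' t ξ)) where
  measurable t ht := (continuous_osc.measurable.comp (hp.mul_const t)).mul (h.measurable t ht)
  hasDerivAt t ht ξ := ((hasDerivAt_osc_mul (p ξ) t).mul (h.hasDerivAt t ht ξ)).congr_deriv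
    (by ring)
  bound s := by simpa only [norm_mul, norm_osc, one_mul] using h.bound s
  bound_deriv s := by
    have hp' : Measurable fun ξ => Complex.I * (p ξ : ℂ) :=
      (Complex.measurable_ofReal.comp hp).const_mul _
    obtain ⟨K, hK⟩ := (h.symbol_mul hp' (k := k) (C := C) fun ξ => by
      simpa using hC ξ).bound s
    obtain ⟨L, hL⟩ := h.bound_deriv s
    refine ⟨K + L, fun t ξ ht => ?_⟩
    rw [norm_mul, norm_osc, one_mul]
    have := mul_le_mul_of_nonneg_left (norm_add_le (Complex.I * p ξ * g t ξ) (g' t ξ))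
      (weight_nonneg s ξ)
    linarith [hK t ξ ht, hL t ξ ht]

lemma isSpec (h : RapidCurve τ g g') {t : ℝ} (ht : |t| < τ) (hg : Hermitian (g t)) :
    IsSpec (fun x => (𝓕⁻ (g t) x).re) (g t) := ⟨h.rapid ht, hg.ofReal_re_fourierInv⟩

/-- The mean value inequality at each frequency, with a Lipschitz constant `K / weight s ξ`; it
gives continuity in time in every Sobolev norm. -/
lemma norm_sub_le (h : RapidCurve τ g g') (s : ℝ) : ∃ K : ℝ, ∀ t u ξ, |t| < τ → |u| < τ →
    weight s ξ * ‖g u ξ - g t ξ‖ ≤ K * |u - t| := by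
  obtain ⟨K, hK⟩ := h.bound_deriv s
  refine ⟨K, fun t u ξ ht hu => ?_⟩
  have := (convex_Ioo (-τ) τ).norm_image_sub_le_of_norm_hasDerivWithin_le
    (f := fun t => g t ξ) (f' := fun t => g' t ξ) (C := K / weight s ξ)
    (fun t ht => (h.hasDerivAt t (abs_lt.2 ht) ξ).hasDerivWithinAt)
    (fun t ht => by
      rw [le_div_iff₀ (weight_pos s ξ), mul_comm]; exact hK t ξ (abs_lt.2 ht))
    (abs_lt.1 ht) (abs_lt.1 hu)
  rw [Real.norm_eq_abs, div_mul_eq_mul_div, le_div_iff₀ (weight_pos s ξ), mul_comm] at this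
  exact this

/-- The inverse Fourier transform of a curve of rapidly decreasing Hermitian functions. -/
lemma sobCurve (h : RapidCurve τ g g') (hg : ∀ t, |t| < τ → Hermitian (g t)) {T : ℝ}
    (hT : T < τ) : SobCurve T fun t x => (𝓕⁻ (g t) x).re := by
  have hmem : ∀ t ∈ Icc 0 T, |t| < τ := fun t ht => by
    rw [abs_of_nonneg ht.1]; exact ht.2.trans_lt hT
  refine ⟨fun t ht => (h.isSpec (hmem t ht) (hg t (hmem t ht))).hInf, fun s t ht => ?_⟩
  obtain ⟨K, hK⟩ := h.norm_sub_le (s + 2)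
  have hw := memLp_weight_neg_two
  have hle : ∀ u ∈ Icc 0 T, sobolevNorm s (fun x => (𝓕⁻ (g u) x).re - (𝓕⁻ (g t) x).re) ≤
      ENNReal.ofReal (K * |u - t|) * eLpNorm (weight (-2)) 2 (volume : Measure Plane) := by
    intro u hu
    rw [((h.isSpec (hmem u hu) (hg u (hmem u hu))).sub
      (h.isSpec (hmem t ht) (hg t (hmem t ht)))).sobolevNorm_eq]
    refine eLpNorm_le_mul_eLpNorm_of_ae_le_mul (Eventually.of_forall fun ξ => ?_) 2
    rw [norm_weight_mul s (fun ξ => g u ξ - g t ξ), Real.norm_of_nonneg (weight_nonneg _ _), weight_neg, ← div_eq_mul_inv,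
      le_div_iff₀ (weight_pos _ _)]
    refine le_trans (le_of_eq ?_) (hK t u ξ (hmem t ht) (hmem u hu))
    rw [weight_add]; ring
  refine tendsto_of_tendsto_of_tendsto_of_le_of_le' tendsto_const_nhds ?_
    (Eventually.of_forall fun _ => zero_le) (eventually_nhdsWithin_of_forall hle)
  have h1 : Tendsto (fun u => K * |u - t|) (𝓝[Icc 0 T] t) (𝓝 0) := by
    have : Continuous fun u => K * |u - t| := by fun_prop
    simpa using (this.tendsto t).mono_left nhdsWithin_le_nhds
  have h2 := ENNReal.Tendsto.mul_const (ENNReal.tendsto_ofReal h1)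
    (Or.inr hw.2.ne : _ ∨ eLpNorm (weight (-2)) 2 (volume : Measure Plane) ≠ ⊤)
  simpa using h2

/-- Differentiation under the integral sign, dominated by a multiple of `weight (-4)`. -/
lemma hasDerivAt_fourierInv (h : RapidCurve τ g g') {t : ℝ} (ht : |t| < τ) (x : Plane) :
    HasDerivAt (fun t => (𝓕⁻ (g t) x).re) (𝓕⁻ (g' t) x).re t := by
  have hnhds : Ioo (-τ) τ ∈ 𝓝 t := isOpen_Ioo.mem_nhds (abs_lt.1 ht)
  obtain ⟨K, hK⟩ := h.bound_deriv 4
  have hm : ∀ f : Plane → ℂ, AEStronglyMeasurable f →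
      AEStronglyMeasurable fun ξ => osc (2 * Real.pi * inner ℝ ξ x) * f ξ := fun f hf =>
    (continuous_osc.comp (by fun_prop)).aestronglyMeasurable.mul hf
  have key := hasDerivAt_integral_of_dominated_loc_of_deriv_le (μ := (volume : Measure Plane))
    (F := fun t ξ => osc (2 * Real.pi * inner ℝ ξ x) * g t ξ)
    (F' := fun t ξ => osc (2 * Real.pi * inner ℝ ξ x) * g' t ξ)
    (bound := fun ξ => K * weight (-4) ξ) hnhds
    (by filter_upwards [hnhds] with u hu
        exact hm _ (h.measurable u (abs_lt.2 hu)).aestronglyMeasurable)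
    ((h.rapid ht).integrable.mono (hm _ (h.rapid ht).aesm) (Eventually.of_forall fun ξ => by simp))
    (hm _ (h.rapid_deriv ht).aesm)
    (Eventually.of_forall fun ξ u hu => by
      rw [norm_mul, norm_osc, one_mul, weight_neg, ← div_eq_mul_inv, le_div_iff₀ (weight_pos _ _),
        mul_comm]
      exact hK u ξ (abs_lt.2 hu))
    (integrable_weight_neg_four.const_mul K)
    (Eventually.of_forall fun ξ u hu => (h.hasDerivAt u (abs_lt.2 hu) ξ).const_mul _)
  simp only [← fourierInv_eq_integral] at key
  exact Complex.reCLM.hasFDerivAt.comp_hasDerivAt t key.2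

end RapidCurve

end Boussinesq

end
-- Diagonalization of the linear part and the scalar equation
noncomputable section

namespace Boussinesq

/-- The angular frequency. -/
def freq (ξ : Plane) : ℝ := 2 * Real.pi * ‖ξ‖

/-- The coordinates of the direction of a frequency. -/
def dir (j : Fin 2) (ξ : Plane) : ℝ := ξ j / ‖ξ‖

lemma freq_nonneg (ξ : Plane) : 0 ≤ freq ξ := by unfold freq; positivity

@[simp] lemma freq_neg (ξ : Plane) : freq (-ξ) = freq ξ := by simp [freq]

lemma continuous_freq : Continuous freq := by unfold freq; fun_prop

@[simp] lemma dir_neg (j : Fin 2) (ξ : Plane) : dir j (-ξ) = -dir j ξ := by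
  simp [dir, neg_div]

lemma measurable_dir (j : Fin 2) : Measurable (dir j) :=
  (show Measurable fun ξ : Plane => ξ j by fun_prop).div measurable_norm

lemma abs_dir_le (j : Fin 2) (ξ : Plane) : |dir j ξ| ≤ 1 := by
  rw [dir, abs_div, abs_norm]
  exact div_le_one_of_le₀ (norm_coord_le j ξ) (norm_nonneg _)

lemma freq_mul_dir (j : Fin 2) (ξ : Plane) : freq ξ * dir j ξ = 2 * Real.pi * ξ j := by
  rcases eq_or_ne ξ 0 with rfl | h
  · simp [freq]
  · have := norm_ne_zero_iff.2 h
    rw [freq, dir]; field_simp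

lemma sym_eq (j : Fin 2) (ξ : Plane) : sym j ξ = Complex.I * freq ξ * dir j ξ := by
  rw [sym, ← freq_mul_dir]; push_cast; ring

/-- The direction is a unit vector except at the origin, where it is zero by division by zero; the
factor `freq ξ` makes the identity hold there as well. -/
lemma freq_mul_dir_sq (ξ : Plane) : freq ξ * (dir 0 ξ ^ 2 + dir 1 ξ ^ 2) = freq ξ := by
  rcases eq_or_ne ξ 0 with rfl | h
  · simp [freq]
  · have h1 := norm_ne_zero_iff.2 h
    have h2 : ‖ξ‖ ^ 2 = ξ 0 ^ 2 + ξ 1 ^ 2 := by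
      rw [EuclideanSpace.norm_sq_eq]; simp
    rw [dir, dir, div_pow, div_pow, ← add_div, ← h2, div_self (pow_ne_zero 2 h1), mul_one]

/-- The amplitude ratio `μ` and the frequency `lam` of the plane waves of the linearized system
`(1 - bΔ) ∂ₜη + ∇·(aΔ + 1)u = 0`, `(1 - dΔ) ∂ₜu + ∇(cΔ + 1)η = 0`. -/
structure IsDispersion (a b c d : ℝ) (μ lam : Plane → ℝ) (κ : ℝ) : Prop where
  nonneg_b : 0 ≤ b
  nonneg_d : 0 ≤ d
  one_le : 1 ≤ κ
  measurable_ratio : Measurable μ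
  measurable_lam : Measurable lam
  even_ratio : ∀ ξ, μ (-ξ) = μ ξ
  even_lam : ∀ ξ, lam (-ξ) = lam ξ
  le_ratio : ∀ ξ, κ⁻¹ ≤ μ ξ
  ratio_le : ∀ ξ, μ ξ ≤ κ
  eq_eta : ∀ ξ, (1 + b * freq ξ ^ 2) * lam ξ * μ ξ = freq ξ * (1 - a * freq ξ ^ 2)
  eq_vel : ∀ ξ, (1 + d * freq ξ ^ 2) * lam ξ = freq ξ * (1 - c * freq ξ ^ 2) * μ ξ

/-- The transform of the elevation in terms of the scalar unknown. -/
def etaHat (μ : Plane → ℝ) (y : Plane → ℂ) (ξ : Plane) : ℂ :=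
  (μ ξ : ℂ) * (y ξ + starRingEnd ℂ (y (-ξ)))

/-- The transform of the velocity in terms of the scalar unknown. -/
def velHat (j : Fin 2) (y : Plane → ℂ) (ξ : Plane) : ℂ :=
  (dir j ξ : ℂ) * (y ξ - starRingEnd ℂ (y (-ξ)))

lemma hermitian_velHat (j : Fin 2) (y : Plane → ℂ) : Hermitian (velHat j y) := fun ξ => by
  simp only [velHat, dir_neg, neg_neg, map_mul, map_sub, Complex.conj_conj, Complex.conj_ofReal]
  push_cast; ring

/-- The nonlinearity of the equation for the scalar unknown. -/
def nonlin (b d : ℝ) (μ : Plane → ℝ) (y : Plane → ℂ) (ξ : Plane) : ℂ :=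
  -(Complex.I * freq ξ / 2) *
    ((1 / 2 * ∑ j, conv (velHat j y) (velHat j y) ξ) / ((1 + d * freq ξ ^ 2 : ℝ) : ℂ) +
    (∑ j, dir j ξ * conv (etaHat μ y) (velHat j y) ξ) / ((μ ξ * (1 + b * freq ξ ^ 2) : ℝ) : ℂ))

namespace IsDispersion

variable {a b c d κ : ℝ} {μ lam : Plane → ℝ}

lemma ratio_pos (h : IsDispersion a b c d μ lam κ) (ξ : Plane) : 0 < μ ξ :=
  (inv_pos.2 (by linarith [h.one_le])).trans_le (h.le_ratio ξ)

lemma inv_ratio_le (h : IsDispersion a b c d μ lam κ) (ξ : Plane) : (μ ξ)⁻¹ ≤ κ :=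
  inv_le_of_inv_le₀ (by linarith [h.one_le]) (h.le_ratio ξ)

lemma one_le_eta (h : IsDispersion a b c d μ lam κ) (ξ : Plane) : 1 ≤ 1 + b * freq ξ ^ 2 := by
  have := h.nonneg_b; nlinarith [sq_nonneg (freq ξ)]

lemma one_le_vel (h : IsDispersion a b c d μ lam κ) (ξ : Plane) : 1 ≤ 1 + d * freq ξ ^ 2 := by
  have := h.nonneg_d; nlinarith [sq_nonneg (freq ξ)]

lemma hermitian_etaHat (h : IsDispersion a b c d μ lam κ) (y : Plane → ℂ) :
    Hermitian (etaHat μ y) := fun ξ => by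
  simp only [etaHat, h.even_ratio, neg_neg, map_mul, map_add, Complex.conj_conj,
    Complex.conj_ofReal]
  ring

lemma abs_lam_le (h : IsDispersion a b c d μ lam κ) (ξ : Plane) :
    |lam ξ| ≤ κ * (1 + |c|) * weight 3 ξ := by
  have hκ := h.one_le
  have h0 := freq_nonneg ξ
  have hμ := h.ratio_pos ξ
  have h1 := h.one_le_vel ξ
  have h2 : |lam ξ| ≤ freq ξ * (1 + |c| * freq ξ ^ 2) * κ := by
    calc |lam ξ| ≤ (1 + d * freq ξ ^ 2) * |lam ξ| := le_mul_of_one_le_left (abs_nonneg _) h1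
      _ = |freq ξ * (1 - c * freq ξ ^ 2) * μ ξ| := by
          rw [← h.eq_vel, abs_mul, abs_of_nonneg (by linarith : 0 ≤ 1 + d * freq ξ ^ 2)]
      _ = freq ξ * |1 - c * freq ξ ^ 2| * μ ξ := by
          rw [abs_mul, abs_mul, abs_of_nonneg h0, abs_of_pos hμ]
      _ ≤ freq ξ * (1 + |c| * freq ξ ^ 2) * κ := by
          have h3 : |1 - c * freq ξ ^ 2| ≤ 1 + |c| * freq ξ ^ 2 := by
            refine (abs_sub _ _).trans (le_of_eq ?_)
            rw [abs_one, abs_mul, abs_of_nonneg (sq_nonneg (freq ξ))]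
          gcongr
          exact h.ratio_le ξ
  have h4 : weight 3 ξ = weight 1 ξ * (1 + freq ξ ^ 2) := by
    rw [show (3 : ℝ) = 1 + 2 by norm_num, weight_add, weight_two]; rfl
  rw [h4]
  calc |lam ξ| ≤ freq ξ * (1 + |c| * freq ξ ^ 2) * κ := h2
    _ ≤ weight 1 ξ * ((1 + |c|) * (1 + freq ξ ^ 2)) * κ := by
        have h5 : freq ξ ≤ weight 1 ξ := freq_le_weight_one ξ
        have h6 := weight_nonneg 1 ξ
        have h7 : 1 + |c| * freq ξ ^ 2 ≤ (1 + |c|) * (1 + freq ξ ^ 2) := by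
          nlinarith [abs_nonneg c, sq_nonneg (freq ξ)]
        gcongr
    _ = _ := by ring

/-- The two parts of `nonlin` have opposite parity under conjugate reflection. So the sum with the
reflection sees only the mass flux, and the difference only the kinetic energy. -/
lemma conj_nonlin_neg (h : IsDispersion a b c d μ lam κ) (y : Plane → ℂ) (ξ : Plane) :
    starRingEnd ℂ (nonlin b d μ y (-ξ)) = (Complex.I * freq ξ / 2) *
    ((1 / 2 * ∑ j, conv (velHat j y) (velHat j y) ξ) / ((1 + d * freq ξ ^ 2 : ℝ) : ℂ) -
    (∑ j, dir j ξ * conv (etaHat μ y) (velHat j y) ξ) / ((μ ξ * (1 + b * freq ξ ^ 2) : ℝ) : ℂ)) := by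
  have h1 := fun j => conv_conj_neg (hermitian_velHat j y) (hermitian_velHat j y) ξ
  have h2 := fun j => conv_conj_neg (h.hermitian_etaHat y) (hermitian_velHat j y) ξ
  simp only [nonlin, freq_neg, h1, h2, h.even_ratio, dir_neg, map_mul, map_neg, map_add, map_div₀,
    map_sum, Complex.conj_conj, Complex.conj_ofReal, Complex.conj_I, map_ofNat, map_one,
    Complex.ofReal_neg, neg_mul, Finset.sum_neg_distrib]
  ring

/-- The transform of the mass equation. The linear part is the relation `eq_eta` between `lam` and
`μ`, and the divisor `μ (1 + b |ξ|²)` in `nonlin` is chosen so that the quadratic part comes out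
right. -/
lemma eta_identity (h : IsDispersion a b c d μ lam κ) (y : Plane → ℂ) (ξ : Plane) :
    ((1 + b * freq ξ ^ 2 : ℝ) : ℂ) * etaHat μ
      (fun ξ => -Complex.I * lam ξ * y ξ + nonlin b d μ y ξ) ξ =
    -∑ j, sym j ξ * (((1 - a * freq ξ ^ 2 : ℝ) : ℂ) * velHat j y ξ +
      conv (etaHat μ y) (velHat j y) ξ) := by
  have hB : ((1 + b * freq ξ ^ 2 : ℝ) : ℂ) ≠ 0 := by
    exact_mod_cast (by linarith [h.one_le_eta ξ] : 1 + b * freq ξ ^ 2 ≠ 0)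
  have hm : (μ ξ : ℂ) ≠ 0 := by exact_mod_cast (h.ratio_pos ξ).ne'
  have e1 : (((1 + b * freq ξ ^ 2 : ℝ) : ℂ)) * lam ξ * μ ξ =
      freq ξ * ((1 - a * freq ξ ^ 2 : ℝ) : ℂ) := by exact_mod_cast h.eq_eta ξ
  have e2 : (freq ξ : ℂ) * ((dir 0 ξ : ℂ) ^ 2 + (dir 1 ξ : ℂ) ^ 2) = freq ξ := by
    exact_mod_cast freq_mul_dir_sq ξ
  simp only [etaHat, map_add, map_mul, map_neg, Complex.conj_I, Complex.conj_ofReal, h.even_lam,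
    h.conj_nonlin_neg y ξ]
  rw [nonlin]
  set S := (1 / 2 * ∑ j, conv (velHat j y) (velHat j y) ξ) / ((1 + d * freq ξ ^ 2 : ℝ) : ℂ)
  set K := (∑ j, dir j ξ * conv (etaHat μ y) (velHat j y) ξ) /
    ((μ ξ * (1 + b * freq ξ ^ 2) : ℝ) : ℂ) with hK
  have e3 : (μ ξ : ℂ) * ((1 + b * freq ξ ^ 2 : ℝ) : ℂ) * K =
      ∑ j, dir j ξ * conv (etaHat μ y) (velHat j y) ξ := by
    rw [hK, Complex.ofReal_mul]; field_simp
  rw [Fin.sum_univ_two] at e3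
  simp only [Fin.sum_univ_two, sym_eq]
  change _ = -(Complex.I * freq ξ * dir 0 ξ * (_ * ((dir 0 ξ : ℂ) *
    (y ξ - starRingEnd ℂ (y (-ξ)))) + conv (etaHat μ y) (velHat 0 y) ξ) + Complex.I * freq ξ *
    dir 1 ξ * (_ * ((dir 1 ξ : ℂ) * (y ξ - starRingEnd ℂ (y (-ξ)))) +
    conv (etaHat μ y) (velHat 1 y) ξ))
  linear_combination (-Complex.I * (y ξ - starRingEnd ℂ (y (-ξ)))) * e1 -
    Complex.I * freq ξ * e3 + Complex.I * ((1 - a * freq ξ ^ 2 : ℝ) : ℂ) *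
    (y ξ - starRingEnd ℂ (y (-ξ))) * e2

/-- The transform of the momentum equation, by `eq_vel`; both sides are parallel to `ξ`, so the
scalar unknown suffices. -/
lemma vel_identity (h : IsDispersion a b c d μ lam κ) (y : Plane → ℂ) (j : Fin 2) (ξ : Plane) :
    ((1 + d * freq ξ ^ 2 : ℝ) : ℂ) * velHat j
      (fun ξ => -Complex.I * lam ξ * y ξ + nonlin b d μ y ξ) ξ =
    -(sym j ξ * (((1 - c * freq ξ ^ 2 : ℝ) : ℂ) * etaHat μ y ξ +
      1 / 2 * ∑ k, conv (velHat k y) (velHat k y) ξ)) := by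
  have hD : ((1 + d * freq ξ ^ 2 : ℝ) : ℂ) ≠ 0 := by
    exact_mod_cast (by linarith [h.one_le_vel ξ] : 1 + d * freq ξ ^ 2 ≠ 0)
  have e1 : (((1 + d * freq ξ ^ 2 : ℝ) : ℂ)) * lam ξ =
      freq ξ * ((1 - c * freq ξ ^ 2 : ℝ) : ℂ) * μ ξ := by exact_mod_cast h.eq_vel ξ
  rw [velHat, etaHat]
  simp only [map_add, map_mul, map_neg, Complex.conj_I, Complex.conj_ofReal, h.even_lam,
    h.conj_nonlin_neg y ξ]
  rw [nonlin]
  set S := (1 / 2 * ∑ j, conv (velHat j y) (velHat j y) ξ) / ((1 + d * freq ξ ^ 2 : ℝ) : ℂ)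
    with hS
  set K := (∑ j, dir j ξ * conv (etaHat μ y) (velHat j y) ξ) /
    ((μ ξ * (1 + b * freq ξ ^ 2) : ℝ) : ℂ)
  have e3 : ((1 + d * freq ξ ^ 2 : ℝ) : ℂ) * S =
      1 / 2 * ∑ j, conv (velHat j y) (velHat j y) ξ := by
    rw [hS]; field_simp
  rw [← e3, sym_eq]
  linear_combination (-Complex.I * dir j ξ * (y ξ + starRingEnd ℂ (y (-ξ)))) * e1

end IsDispersion

/-- The coefficients of the elevation (first component `true`) and of the velocity. -/
def waveCoeff (μ : Plane → ℝ) (l : Bool × Fin 2) (ξ : Plane) : ℝ := bif l.1 then μ ξ else dir l.2 ξ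

/-- The parity of the elevation and of the velocity. -/
def waveSign (l : Bool × Fin 2) : ℝ := bif l.1 then 1 else -1

/-- The multipliers of the quadratic interactions. -/
def waveMult (b d : ℝ) (μ : Plane → ℝ) (l : Bool × Fin 2) (ξ : Plane) : ℝ :=
  bif l.1 then freq ξ / 2 * dir l.2 ξ / (μ ξ * (1 + b * freq ξ ^ 2))
  else freq ξ / 4 / (1 + d * freq ξ ^ 2)

/-- The quadratic interactions in the equation for the scalar unknown, after removal of the linear
part. -/
def waveInteraction (b d : ℝ) (μ lam : Plane → ℝ) : Interaction (Bool × Fin 2) where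
  cl l t ξ := waveCoeff μ l ξ * osc (-lam ξ * t)
  dl l t ξ := ((waveSign l * waveCoeff μ l ξ : ℝ) : ℂ) * osc (lam ξ * t)
  cr l t ξ := waveCoeff μ (false, l.2) ξ * osc (-lam ξ * t)
  dr l t ξ := ((waveSign (false, l.2) * waveCoeff μ (false, l.2) ξ : ℝ) : ℂ) * osc (lam ξ * t)
  M l t ξ := osc (lam ξ * t) * (-Complex.I * waveMult b d μ l ξ)

/-- The bound for the multipliers. -/
def waveBound (b d κ : ℝ) (ξ : Plane) : ℝ :=
  κ * (freq ξ / (1 + b * freq ξ ^ 2) + freq ξ / (1 + d * freq ξ ^ 2))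

/-- The scalar unknown, from its profile. -/
def twist (lam : Plane → ℝ) (z : ℝ → Plane → ℂ) (t : ℝ) (ξ : Plane) : ℂ :=
  osc (-lam ξ * t) * z t ξ

namespace IsDispersion

variable {a b c d κ : ℝ} {μ lam : Plane → ℝ}

lemma abs_waveCoeff_le (h : IsDispersion a b c d μ lam κ) (l : Bool × Fin 2) (ξ : Plane) :
    |waveCoeff μ l ξ| ≤ κ := by
  obtain ⟨_ | _, j⟩ := l
  · exact (abs_dir_le j ξ).trans h.one_le
  · simpa [waveCoeff, abs_of_pos (h.ratio_pos ξ)] using h.ratio_le ξ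

lemma measurable_waveCoeff (h : IsDispersion a b c d μ lam κ) (l : Bool × Fin 2) :
    Measurable (waveCoeff μ l) := by
  obtain ⟨_ | _, j⟩ := l
  · exact measurable_dir j
  · exact h.measurable_ratio

lemma measurable_waveMult (h : IsDispersion a b c d μ lam κ) (l : Bool × Fin 2) :
    Measurable (waveMult b d μ l) := by
  have := continuous_freq.measurable
  have := h.measurable_ratio
  have := measurable_dir l.2
  obtain ⟨_ | _, j⟩ := l
  · change Measurable fun ξ => freq ξ / 4 / (1 + d * freq ξ ^ 2)
    fun_prop
  · change Measurable fun ξ => freq ξ / 2 * dir j ξ / (μ ξ * (1 + b * freq ξ ^ 2))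
    fun_prop

lemma abs_waveMult_le (h : IsDispersion a b c d μ lam κ) (l : Bool × Fin 2) (ξ : Plane) :
    |waveMult b d μ l ξ| ≤ waveBound b d κ ξ := by
  have h0 := freq_nonneg ξ
  have hb := h.one_le_eta ξ
  have hd := h.one_le_vel ξ
  have hκ := h.one_le
  have hμ := h.ratio_pos ξ
  have p1 : 0 ≤ freq ξ / (1 + b * freq ξ ^ 2) := by positivity
  have p2 : 0 ≤ freq ξ / (1 + d * freq ξ ^ 2) := by positivity
  obtain ⟨_ | _, j⟩ := l
  · simp only [waveMult, cond_false, waveBound]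
    rw [abs_of_nonneg (by positivity), div_right_comm]
    nlinarith
  · simp only [waveMult, cond_true, waveBound]
    have e : freq ξ / 2 * dir j ξ / (μ ξ * (1 + b * freq ξ ^ 2)) =
      (freq ξ / (1 + b * freq ξ ^ 2)) * ((μ ξ)⁻¹ * (dir j ξ / 2)) := by field_simp
    rw [e, abs_mul, abs_of_nonneg p1, abs_mul, abs_of_pos (inv_pos.2 hμ), abs_div, abs_two]
    have q1 := abs_dir_le j ξ
    have q2 := h.inv_ratio_le ξ
    have q3 : (μ ξ)⁻¹ * (|dir j ξ| / 2) ≤ κ * 1 :=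
      mul_le_mul q2 (by linarith) (by positivity) (by linarith)
    nlinarith [mul_le_mul_of_nonneg_left q3 p1, mul_nonneg (by linarith : 0 ≤ κ) p2]

lemma waveInteraction_isBounded (h : IsDispersion a b c d μ lam κ) :
    (waveInteraction b d μ lam).IsBounded κ (waveBound b d κ) := by
  have hl := h.measurable_lam
  have hosc : ∀ t, Measurable fun ξ => osc (lam ξ * t) := fun t =>
    continuous_osc.measurable.comp (hl.mul_const t)
  have hosc' : ∀ t, Measurable fun ξ => osc (-lam ξ * t) := fun t =>
    continuous_osc.measurable.comp (hl.neg.mul_const t)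
  have hcont : ∀ p : ℝ, Continuous fun t => osc (p * t) := fun p =>
    continuous_osc.comp (by fun_prop)
  have hco := fun l => Complex.measurable_ofReal.comp (h.measurable_waveCoeff l)
  have hco' := fun l => Complex.measurable_ofReal.comp
    ((h.measurable_waveCoeff l).const_mul (waveSign l))
  have hnorm : ∀ (p q : ℝ), ‖(p : ℂ) * osc q‖ = |p| := fun p q => by
    rw [norm_mul, norm_osc, mul_one, Complex.norm_real, Real.norm_eq_abs]
  have hsign : ∀ l ξ, |waveSign l * waveCoeff μ l ξ| ≤ κ := fun l ξ => by
    rw [abs_mul]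
    have : |waveSign l| = 1 := by
      obtain ⟨_ | _, j⟩ := l <;> simp [waveSign]
    rw [this, one_mul]; exact h.abs_waveCoeff_le l ξ
  refine ⟨fun l t => ⟨(hco l).mul (hosc' t), (hco' l).mul (hosc t), (hco _).mul (hosc' t),
    (hco' _).mul (hosc t), (hosc t).mul
      ((Complex.measurable_ofReal.comp (h.measurable_waveMult l)).const_mul _)⟩,
    fun l ξ => ⟨continuous_const.mul (hcont _), continuous_const.mul (hcont _),
      continuous_const.mul (hcont _), continuous_const.mul (hcont _),
      (hcont _).mul continuous_const⟩, fun l t ξ => ?_, fun l t ξ => ?_, fun l t ξ => ?_,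
    fun l t ξ => ?_, fun l t ξ => ?_, by linarith [h.one_le]⟩
  · exact (hnorm _ _).trans_le (h.abs_waveCoeff_le l ξ)
  · exact (hnorm _ _).trans_le (hsign l ξ)
  · exact (hnorm _ _).trans_le (h.abs_waveCoeff_le _ ξ)
  · exact (hnorm _ _).trans_le (hsign _ ξ)
  · simp only [waveInteraction, norm_mul, norm_osc, norm_neg, Complex.norm_I, one_mul,
      Complex.norm_real, Real.norm_eq_abs]
    exact h.abs_waveMult_le l ξ

lemma left_vel (h : IsDispersion a b c d μ lam κ) (j : Fin 2) (z : ℝ → Plane → ℂ) (t : ℝ) :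
    (waveInteraction b d μ lam).left (false, j) z t = velHat j (twist lam z t) := by
  funext ξ
  simp only [Interaction.left, MajorizedBy.comb, waveInteraction, waveCoeff, waveSign, cond_false,
    velHat, twist, h.even_lam, map_mul, conj_osc, neg_mul, neg_neg]
  push_cast; ring

lemma left_eta (h : IsDispersion a b c d μ lam κ) (j : Fin 2) (z : ℝ → Plane → ℂ) (t : ℝ) :
    (waveInteraction b d μ lam).left (true, j) z t = etaHat μ (twist lam z t) := by
  funext ξ
  simp only [Interaction.left, MajorizedBy.comb, waveInteraction, waveCoeff, waveSign, cond_true,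
    etaHat, twist, h.even_lam, map_mul, conj_osc, neg_mul, neg_neg]
  push_cast; ring

lemma right_vel (h : IsDispersion a b c d μ lam κ) (l : Bool × Fin 2) (z : ℝ → Plane → ℂ) (t : ℝ) :
    (waveInteraction b d μ lam).right l z t = velHat l.2 (twist lam z t) :=
  h.left_vel l.2 z t

/-- The oscillating coefficients of the interaction convert the profile into the scalar unknown, and
the phase of the multiplier converts the result back. -/
lemma form_eq (h : IsDispersion a b c d μ lam κ) (z : ℝ → Plane → ℂ) (t : ℝ) (ξ : Plane) :
    (waveInteraction b d μ lam).form z z t ξ =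
      osc (lam ξ * t) * nonlin b d μ (twist lam z t) ξ := by
  simp only [Interaction.form, h.right_vel, Fintype.sum_prod_type, Fintype.sum_bool, h.left_vel,
    h.left_eta, Fin.sum_univ_two, nonlin]
  simp only [waveInteraction, waveMult, cond_true, cond_false]
  push_cast; ring

end IsDispersion

end Boussinesq

end
-- Solutions of the system from the scalar equation
noncomputable section

namespace Boussinesq

variable {a b c d κ : ℝ} {μ lam : Plane → ℝ}

namespace RapidCurve

variable {τ : ℝ} {y y' : ℝ → Plane → ℂ}

lemma etaHat (hy : RapidCurve τ y y') (h : IsDispersion a b c d μ lam κ) :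
    RapidCurve τ (fun t => etaHat μ (y t)) (fun t => etaHat μ (y' t)) :=
  (hy.add hy.reflect).symbol_mul (Complex.measurable_ofReal.comp h.measurable_ratio) (C := κ)
    (k := 0) fun ξ => by
      simpa [abs_of_pos (h.ratio_pos ξ)] using h.ratio_le ξ

lemma velHat (hy : RapidCurve τ y y') (j : Fin 2) :
    RapidCurve τ (fun t => velHat j (y t)) (fun t => velHat j (y' t)) := by
  have h1 := (hy.add (hy.reflect.symbol_mul (p := fun _ => -1) measurable_const (C := 1) (k := 0)
    fun ξ => by simp)).symbol_mul (Complex.measurable_ofReal.comp (measurable_dir j)) (C := 1)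
    (k := 0) fun ξ => by simpa using abs_dir_le j ξ
  simp only [neg_one_mul, ← sub_eq_add_neg] at h1
  exact h1

end RapidCurve

/-- The real function with the given Fourier transform. -/
def invRe (g : Plane → ℂ) (x : Plane) : ℝ := (𝓕⁻ g x).re

/-- The state of the system with a given scalar unknown on the Fourier side. -/
def waveState (μ : Plane → ℝ) (y : Plane → ℂ) : State :=
  (invRe (etaHat μ y), fun x => WithLp.toLp 2 fun j => invRe (velHat j y) x)

lemma IsSpec.re_fourierInv {f : Plane → ℝ} {g g' : Plane → ℂ} (h : IsSpec f g)
    (hg : ∀ ξ, g' ξ = g ξ) (x : Plane) : (𝓕⁻ g' x).re = f x := by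
  rw [funext hg, ← h.eq, Complex.ofReal_re]

/-- Carries an evolution equation between transforms over to the pointwise equation between
functions. -/
lemma RapidCurve.hasDerivWithinAt_of_isSpec {τ T : ℝ} {g g' : ℝ → Plane → ℂ}
    {F : ℝ → Plane → ℝ} {F' : Plane → ℝ} {G : ℝ → Plane → ℂ} {G' : Plane → ℂ}
    (h : RapidCurve τ g g') (hT : T < τ) {t : ℝ} (ht : t ∈ Icc 0 T)
    (hF : ∀ t ∈ Icc 0 T, IsSpec (F t) (G t)) (hG : ∀ t ∈ Icc 0 T, ∀ ξ, g t ξ = G t ξ)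
    (hF' : IsSpec F' G') (hG' : ∀ ξ, g' t ξ = G' ξ) (x : Plane) :
    HasDerivWithinAt (fun t => F t x) (F' x) (Icc 0 T) t := by
  have htτ : |t| < τ := by rw [abs_of_nonneg ht.1]; exact ht.2.trans_lt hT
  have h1 := (h.hasDerivAt_fourierInv htτ x).hasDerivWithinAt (s := Icc 0 T)
  rw [hF'.re_fourierInv hG'] at h1
  exact h1.congr (fun u hu => ((hF u hu).re_fourierInv (hG u hu) x).symm)
    ((hF t ht).re_fourierInv (hG t ht) x).symm

lemma norm_one_add_freq_le (p : ℝ) (ξ : Plane) :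
    ‖((1 + p * freq ξ ^ 2 : ℝ) : ℂ)‖ ≤ (1 + |p|) * weight 2 ξ := by
  have h2 : |1 + p * freq ξ ^ 2| ≤ 1 + |p| * freq ξ ^ 2 := by
    refine (abs_add_le _ _).trans (le_of_eq ?_)
    rw [abs_one, abs_mul, abs_of_nonneg (sq_nonneg (freq ξ))]
  rw [Complex.norm_real, Real.norm_eq_abs, weight_two]
  refine h2.trans ?_
  change _ ≤ (1 + |p|) * (1 + freq ξ ^ 2)
  nlinarith [abs_nonneg p, sq_nonneg (freq ξ)]

lemma RapidCurve.one_add_freq_mul {τ : ℝ} {g g' : ℝ → Plane → ℂ} (h : RapidCurve τ g g') (p : ℝ) :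
    RapidCurve τ (fun t ξ => ((1 + p * freq ξ ^ 2 : ℝ) : ℂ) * g t ξ)
      (fun t ξ => ((1 + p * freq ξ ^ 2 : ℝ) : ℂ) * g' t ξ) :=
  h.symbol_mul (Continuous.measurable
    (Complex.continuous_ofReal.comp (by have := continuous_freq; fun_prop)))
    (norm_one_add_freq_le p)

namespace IsDispersion

variable {τ T : ℝ} {y : ℝ → Plane → ℂ}

/-- A solution of the scalar equation on the Fourier side gives a solution of the system. -/
lemma isSolution (h : IsDispersion a b c d μ lam κ)
    (hy : RapidCurve τ y fun t ξ => -Complex.I * lam ξ * y t ξ + nonlin b d μ (y t) ξ)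
    (hT : T < τ) : IsSolution a b c d T fun t => waveState μ (y t) := by
  have hmem : ∀ t ∈ Icc 0 T, |t| < τ := fun t ht => by
    rw [abs_of_nonneg ht.1]; exact ht.2.trans_lt hT
  have rη := hy.etaHat h
  have ru := fun j => hy.velHat j
  have sη : ∀ t ∈ Icc 0 T, IsSpec (invRe (etaHat μ (y t))) (etaHat μ (y t)) := fun t ht =>
    rη.isSpec (hmem t ht) (h.hermitian_etaHat _)
  have su : ∀ j, ∀ t ∈ Icc 0 T, IsSpec (invRe (velHat j (y t))) (velHat j (y t)) :=
    fun j t ht => (ru j).isSpec (hmem t ht) (hermitian_velHat j _)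
  refine isSolution_iff.2 ⟨fun t ht => ?_, ⟨?_, fun j => ?_, fun t ht x => ?_,
    fun j t ht x => ?_⟩, fun t ht x => ?_⟩
  · rw [contDiff_euclidean]
    exact fun j => (su j t ht).contDiff
  · exact rη.sobCurve (fun t _ => h.hermitian_etaHat _) hT
  · exact (ru j).sobCurve (fun t _ => hermitian_velHat j _) hT
  · have flux := fun j => (((((su j t ht).lap.const_mul a).add (su j t ht)).add
      ((sη t ht).mul (su j t ht))).pd j)
    have := (rη.one_add_freq_mul b).hasDerivWithinAt_of_isSpec hT ht
      (fun t ht => (sη t ht).sub ((sη t ht).lap.const_mul b)) (fun t ht ξ => ?_)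
      ((flux 0).add (flux 1)).neg (fun ξ => ?_) x
    · simp only [Fin.sum_univ_two]
      exact this
    · simp only [freq]; push_cast; ring
    · refine (h.eta_identity (y t) ξ).trans ?_
      simp only [Fin.sum_univ_two, freq]; push_cast; ring
  · have flux := ((((sη t ht).lap.const_mul c).add (sη t ht)).add
      ((((su 0 t ht).mul (su 0 t ht)).add ((su 1 t ht).mul (su 1 t ht))).const_mul (1 / 2))).pd j
    have := ((ru j).one_add_freq_mul d).hasDerivWithinAt_of_isSpec hT ht
      (fun t ht => (su j t ht).sub ((su j t ht).lap.const_mul d)) (fun t ht ξ => ?_)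
      flux.neg (fun ξ => ?_) x
    · simp only [sq]
      exact this
    · simp only [freq]; push_cast; ring
    · refine (h.vel_identity (y t) j ξ).trans ?_
      simp only [Fin.sum_univ_two, freq]; push_cast; ring
  -- The velocity transform is parallel to `ξ`, hence its curl vanishes identically.
  · have h1 := ((su 1 t ht).pd 0).sub ((su 0 t ht).pd 1)
    have h2 : ∀ ξ, (fun _ => (0 : ℂ)) ξ =
        sym 0 ξ * velHat 1 (y t) ξ - sym 1 ξ * velHat 0 (y t) ξ := fun ξ => by
      simp only [sym_eq, velHat]; ring
    refine (h1.re_fourierInv h2 x).symm.trans ?_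
    simp [fourierInv_eq_integral]

/-- The scalar unknown built from the expansion of the interaction equation. -/
lemma rapidCurve_twist (h : IsDispersion a b c d μ lam κ) {m g : Plane → ℝ} {A P R Λ κ' : ℝ}
    {z₀ : Plane → ℂ}
    (hc : Interaction.IsBounded.Controls (waveInteraction b d μ lam) κ' m g A P R Λ z₀)
    (hτ : 4 * Interaction.IsBounded.rate (Bool × Fin 2) κ' Λ * τ * P ≤ 1 / 2) :
    RapidCurve τ (twist lam ((waveInteraction b d μ lam).sol z₀)) fun t ξ =>
      -Complex.I * lam ξ * twist lam ((waveInteraction b d μ lam).sol z₀) t ξ +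
        nonlin b d μ (twist lam ((waveInteraction b d μ lam).sol z₀) t) ξ := by
  have h1 : RapidCurve τ ((waveInteraction b d μ lam).sol z₀)
      ((waveInteraction b d μ lam).form ((waveInteraction b d μ lam).sol z₀)
        ((waveInteraction b d μ lam).sol z₀)) := by
    refine ⟨fun t ht => hc.measurable_sol hτ ht.le, fun t ht ξ => hc.hasDerivAt_sol hτ ht ξ,
      fun s => ?_, fun s => ?_⟩
    · obtain ⟨K, hK⟩ := hc.exists_weight_mul_sol_le hτ s
      exact ⟨K, fun t ξ ht => hK t ξ ht.le⟩
    · obtain ⟨K, hK⟩ := hc.exists_weight_mul_form_le hτ s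
      exact ⟨K, fun t ξ ht => hK t ξ ht.le⟩
  -- By the product rule, the derivative of the phase produces the linear term, and that of the
  -- profile produces `nonlin`.
  have h2 := h1.osc_mul (p := fun ξ => -lam ξ) h.measurable_lam.neg
    (fun ξ => by rw [abs_neg]; exact h.abs_lam_le ξ)
  convert h2 using 3 with t ξ t ξ
  · rfl
  rw [h.form_eq, mul_add, ← mul_assoc (osc (-lam ξ * t)) (osc (lam ξ * t)), neg_mul (lam ξ) t,
    osc_neg_mul, one_mul, twist]
  push_cast; ring_nf

end IsDispersion

end Boussinesq

end
-- The wave packet and its resonance with its mirror image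
noncomputable section

namespace Boussinesq

/-- The frequency of the initial data. -/
def carrier (N : ℝ) : Plane := EuclideanSpace.single 0 N

@[simp] lemma norm_carrier (N : ℝ) : ‖carrier N‖ = |N| := by simp [carrier]

/-- The Fourier transform of the initial data: a bump at the frequency `N`. -/
def packet (A N : ℝ) : Plane → ℂ :=
  (Metric.ball (carrier N) 1).indicator fun _ => Complex.I * A

/-- A symmetric bound for the initial data. -/
def packetBound (A N : ℝ) : Plane → ℝ :=
  (Metric.ball (carrier N) 1 ∪ Metric.ball (-carrier N) 1).indicator fun _ => A

lemma abs_norm_sub_le_of_mem_ball {N : ℝ} (hN : 0 ≤ N) {ξ : Plane}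
    (h : ξ ∈ Metric.ball (carrier N) 1) : |‖ξ‖ - N| ≤ 1 := by
  have h1 := abs_norm_sub_norm_le ξ (carrier N)
  rw [norm_carrier, abs_of_nonneg hN] at h1
  rw [mem_ball_iff_norm] at h
  linarith

lemma neg_mem_ball_carrier {N : ℝ} {ξ : Plane} :
    -ξ ∈ Metric.ball (carrier N) 1 ↔ ξ ∈ Metric.ball (-carrier N) 1 := by
  rw [mem_ball_iff_norm, mem_ball_iff_norm, ← norm_neg]
  congr! 2; abel

lemma packetBound_support {A N : ℝ} (hN : 0 ≤ N) {ξ : Plane} (h : packetBound A N ξ ≠ 0) :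
    |‖ξ‖ - N| ≤ 1 := by
  rcases mem_of_indicator_ne_zero h with h | h
  · exact abs_norm_sub_le_of_mem_ball hN h
  · rw [← norm_neg]; exact abs_norm_sub_le_of_mem_ball hN (neg_mem_ball_carrier.2 h)

lemma packetBound_even (A N : ℝ) (ξ : Plane) : packetBound A N (-ξ) = packetBound A N ξ := by
  have : -ξ ∈ Metric.ball (carrier N) 1 ∪ Metric.ball (-carrier N) 1 ↔
      ξ ∈ Metric.ball (carrier N) 1 ∪ Metric.ball (-carrier N) 1 := by
    rw [mem_union, mem_union, neg_mem_ball_carrier, ← neg_mem_ball_carrier (ξ := -ξ), neg_neg,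
      or_comm]
  by_cases h : ξ ∈ Metric.ball (carrier N) 1 ∪ Metric.ball (-carrier N) 1
  · rw [packetBound, indicator_of_mem h, indicator_of_mem (this.2 h)]
  · rw [packetBound, indicator_of_notMem h, indicator_of_notMem (this.not.2 h)]

lemma norm_packet_le {A : ℝ} (hA : 0 ≤ A) (N : ℝ) (ξ : Plane) :
    ‖packet A N ξ‖ ≤ packetBound A N ξ := by
  rw [packet, packetBound, norm_indicator_eq_indicator_norm]
  have : ‖Complex.I * (A : ℂ)‖ = A := by simp [abs_of_nonneg hA]
  rw [this]
  exact indicator_le_indicator_of_subset subset_union_left (fun _ => hA) ξ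

lemma packet_eq_zero {A N : ℝ} (hN : 2 ≤ N) {ξ : Plane} (hξ : ‖ξ‖ ≤ 1 / 2) :
    packet A N ξ = 0 := by
  by_contra h
  have := abs_le.1 (abs_norm_sub_le_of_mem_ball (by linarith) (mem_of_indicator_ne_zero h))
  linarith [this.1]

lemma measurable_packet (A N : ℝ) : Measurable (packet A N) :=
  measurable_const.indicator measurableSet_ball

/-- The area of the unit disc. -/
def discArea : ℝ := volume.real (Metric.ball (0 : Plane) 1)

/-- The area of the disc of radius `1 / 2`. -/
def halfDiscArea : ℝ := volume.real (Metric.ball (0 : Plane) (1 / 2))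

lemma halfDiscArea_pos : 0 < halfDiscArea :=
  ENNReal.toReal_pos (Metric.measure_ball_pos _ _ (by norm_num)).ne' measure_ball_lt_top.ne

lemma discArea_pos : 0 < discArea :=
  ENNReal.toReal_pos (Metric.measure_ball_pos _ _ (by norm_num)).ne' measure_ball_lt_top.ne

lemma isDatum_packetBound {A N : ℝ} (hA : 0 ≤ A) (hN : 0 ≤ N) :
    IsDatum (packetBound A N) A (2 * A * discArea) (N + 1) := by
  have hm : MeasurableSet (Metric.ball (carrier N) 1 ∪ Metric.ball (-carrier N) 1) :=
    measurableSet_ball.union measurableSet_ball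
  have hv : ∀ x : Plane, volume.real (Metric.ball x 1) = discArea := fun x => by
    rw [discArea, Measure.real, Measure.real, Measure.addHaar_ball_center]
  have hle : volume.real (Metric.ball (carrier N) 1 ∪ Metric.ball (-carrier N) 1) ≤
      2 * discArea := by
    refine (measureReal_union_le _ _).trans (le_of_eq ?_)
    rw [hv, hv]; ring
  refine ⟨⟨measurable_const.indicator hm, fun ξ => indicator_nonneg (fun _ _ => hA) ξ,
    packetBound_even A N, ?_, ⟨A, fun ξ => indicator_le_self' (fun _ _ => hA) ξ⟩⟩,
    fun ξ => indicator_le_self' (fun _ _ => hA) ξ, ?_, fun ξ hξ => ?_⟩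
  · refine (integrable_indicator_iff hm).2 (integrableOn_const (hs := ?_))
    exact ((measure_union_le _ _).trans_lt
      (ENNReal.add_lt_top.2 ⟨measure_ball_lt_top, measure_ball_lt_top⟩)).ne
  · rw [packetBound, integral_indicator hm, setIntegral_const, smul_eq_mul]
    nlinarith
  · by_contra h
    have := abs_le.1 (packetBound_support hN h)
    linarith [this.2]

variable {a b c d κ : ℝ} {μ lam : Plane → ℝ}

/-- The packet carried by the linear flow with phase `lam`. -/
def carried (lam : Plane → ℝ) (A N s : ℝ) : Plane → ℂ := twist lam (fun _ => packet A N) s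

/-- The factor `i` in `packet` makes the bumps at `N` and `-N` enter the velocity with the same
sign, up to the direction and opposite phases. -/
lemma velHat_carried (he : ∀ ξ, lam (-ξ) = lam ξ) (A N s : ℝ) (j : Fin 2) (ξ : Plane) :
    velHat j (carried lam A N s) ξ = Complex.I * A * dir j ξ *
      ((Metric.ball (carrier N) 1).indicator (fun _ => osc (-(lam ξ * s))) ξ +
        (Metric.ball (-carrier N) 1).indicator (fun _ => osc (lam ξ * s)) ξ) := by
  have hp : packet A N (-ξ) =
      (Metric.ball (-carrier N) 1).indicator (fun _ => Complex.I * (A : ℂ)) ξ := by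
    by_cases h : ξ ∈ Metric.ball (-carrier N) 1
    · rw [packet, indicator_of_mem h, indicator_of_mem (neg_mem_ball_carrier.2 h)]
    · rw [packet, indicator_of_notMem h, indicator_of_notMem (neg_mem_ball_carrier.not.2 h)]
  simp only [velHat, carried, twist, hp, he, neg_mul]
  rw [packet]
  by_cases h1 : ξ ∈ Metric.ball (carrier N) 1 <;> by_cases h2 : ξ ∈ Metric.ball (-carrier N) 1 <;>
    simp only [h1, h2, indicator_of_mem, indicator_of_notMem, not_false_eq_true, mul_zero,
      map_zero, add_zero, zero_add, map_mul, conj_osc, Complex.conj_I, Complex.conj_ofReal,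
      neg_neg, sub_zero] <;> ring

/-- Two long vectors with a short sum point in nearly opposite directions. -/
lemma dir_mul_dir_le {p q : Plane} (hq : 3 / 2 ≤ ‖q‖) (hp : p ≠ 0) (h : ‖p + q‖ ≤ 1 / 2) :
    1 / 2 ≤ -(dir 0 p * dir 0 q + dir 1 p * dir 1 q) := by
  have hp0 := norm_pos_iff.2 hp
  have e : -(dir 0 p * dir 0 q + dir 1 p * dir 1 q) =
      -(p 0 * q 0 + p 1 * q 1) / (‖p‖ * ‖q‖) := by
    have : ‖q‖ ≠ 0 := by linarith
    rw [dir, dir, dir, dir]; field_simp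
  have e2 : p 0 * q 0 + p 1 * q 1 = inner ℝ (p + q) q - ‖q‖ ^ 2 := by
    rw [inner_add_left, real_inner_self_eq_norm_sq, add_sub_cancel_right]
    simp [PiLp.inner_apply, mul_comm]
  have h1 : inner ℝ (p + q) q ≤ 1 / 2 * ‖q‖ :=
    (real_inner_le_norm _ _).trans (mul_le_mul_of_nonneg_right h (norm_nonneg _))
  have h2 : ‖p‖ ≤ ‖q‖ + 1 / 2 := by
    calc ‖p‖ = ‖(p + q) - q‖ := by rw [add_sub_cancel_right]
      _ ≤ ‖p + q‖ + ‖q‖ := norm_sub_le _ _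
      _ ≤ _ := by linarith
  rw [e, e2, le_div_iff₀ (by positivity)]
  nlinarith

lemma half_le_re_osc {θ : ℝ} (h : |θ| ≤ 1) : 1 / 2 ≤ (osc θ).re := by
  rw [osc, Complex.exp_ofReal_mul_I_re]
  have := Real.one_sub_sq_div_two_le_cos (x := θ)
  have h2 : θ ^ 2 ≤ 1 := (sq_le_one_iff_abs_le_one θ).2 h
  linarith

/-- The positivity behind the instability. As `p + q` is short, `p` and `q` cannot lie in the same
bump. In opposite bumps `(iA)²` times the negative product of directions is at least `A² / 2`, and a
phase difference of at most one leaves half of it. Every other contribution vanishes, and `q` in the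
smaller ball forces `p` into the opposite bump. -/
lemma re_sum_velHat_ge (he : ∀ ξ, lam (-ξ) = lam ξ) {A N s : ℝ} (hN : 3 ≤ N)
    (hph : ∀ ξ ζ : Plane, |‖ξ‖ - N| ≤ 1 → |‖ζ‖ - N| ≤ 1 → |(lam ξ - lam ζ) * s| ≤ 1) {p q : Plane}
    (hpq : ‖p + q‖ ≤ 1 / 2) :
    (Metric.ball (-carrier N) (1 / 2)).indicator (fun _ => A ^ 2 / 4) q ≤
    (∑ j, velHat j (carried lam A N s) p * velHat j (carried lam A N s) q).re := by
  have hB : ∀ ξ ∈ Metric.ball (carrier N) 1, |‖ξ‖ - N| ≤ 1 := fun ξ h =>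
    abs_norm_sub_le_of_mem_ball (by linarith) h
  have hB' : ∀ ξ ∈ Metric.ball (-carrier N) 1, |‖ξ‖ - N| ≤ 1 := fun ξ h => by
    rw [← norm_neg]; exact hB _ (neg_mem_ball_carrier.2 h)
  have hdisj : ∀ ξ ∈ Metric.ball (carrier N) 1, ξ ∉ Metric.ball (-carrier N) 1 := by
    intro ξ h1 h2
    rw [mem_ball_iff_norm] at h1 h2
    have h3 : ‖(2 : ℝ) • carrier N‖ ≤ ‖ξ - carrier N‖ + ‖ξ - -carrier N‖ := by
      rw [add_comm]
      refine le_trans (le_of_eq ?_) (norm_sub_le _ _)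
      congr 1; rw [two_smul]; abel
    rw [norm_smul, norm_carrier, abs_of_nonneg (by linarith), Real.norm_ofNat] at h3
    linarith
  have hsame : ∀ x : Plane, ‖x‖ = N → p ∈ Metric.ball x 1 → q ∈ Metric.ball x 1 → False := by
    intro x hx h1 h2
    rw [mem_ball_iff_norm] at h1 h2
    have h3 : ‖(2 : ℝ) • x‖ ≤ ‖p + q‖ + (‖p - x‖ + ‖q - x‖) := by
      refine le_trans (le_of_eq ?_) ((norm_sub_le _ _).trans
        (add_le_add le_rfl (norm_add_le (p - x) (q - x))))
      congr 1; rw [two_smul]; abel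
    rw [norm_smul, hx, Real.norm_ofNat] at h3
    linarith
  have hc : ‖carrier N‖ = N := by rw [norm_carrier, abs_of_nonneg (by linarith)]
  have hc' : ‖-carrier N‖ = N := by rw [norm_neg, hc]
  have hmain : ∀ θ : ℝ, |θ| ≤ 1 → |‖p‖ - N| ≤ 1 → |‖q‖ - N| ≤ 1 →
      A ^ 2 / 4 ≤ ((-(A ^ 2 * (dir 0 p * dir 0 q + dir 1 p * dir 1 q)) : ℝ) * osc θ).re := by
    intro θ hθ h1 h2
    have h3 := half_le_re_osc hθ
    have h4 := dir_mul_dir_le (p := p) (q := q) (by linarith [(abs_le.1 h2).1])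
      (norm_pos_iff.1 (by linarith [(abs_le.1 h1).1])) hpq
    rw [Complex.re_ofReal_mul]
    have h5 := mul_le_mul h4 h3 (by norm_num) (by linarith)
    nlinarith [sq_nonneg A, mul_le_mul_of_nonneg_left h5 (sq_nonneg A)]
  have hsum : ∀ α β : ℂ, ∑ j, (Complex.I * A * dir j p * α) * (Complex.I * A * dir j q * β) =
      ((-(A ^ 2 * (dir 0 p * dir 0 q + dir 1 p * dir 1 q)) : ℝ) : ℂ) * (α * β) := by
    intro α β
    rw [Fin.sum_univ_two]
    push_cast
    linear_combination (α * β * A ^ 2 * (dir 0 p * dir 0 q + dir 1 p * dir 1 q)) * Complex.I_sq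
  have hball : ∀ x, x ∈ Metric.ball (-carrier N) (1 / 2) → x ∈ Metric.ball (-carrier N) 1 :=
    fun x hx => Metric.ball_subset_ball (by norm_num) hx
  have hpos : q ∈ Metric.ball (-carrier N) (1 / 2) → p ∈ Metric.ball (carrier N) 1 := by
    intro hq
    rw [mem_ball_iff_norm] at hq ⊢
    have : p - carrier N = (p + q) - (q - -carrier N) := by abel
    rw [this]
    exact (norm_sub_le _ _).trans_lt (by linarith)
  have hA : 0 ≤ A ^ 2 / 4 := by positivity
  have hind : (Metric.ball (-carrier N) (1 / 2)).indicator (fun _ => A ^ 2 / 4) q ≤ A ^ 2 / 4 :=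
    indicator_le_self' (fun _ _ => hA) q
  simp only [velHat_carried he, hsum]
  by_cases hp1 : p ∈ Metric.ball (carrier N) 1
  · have hp2 := hdisj p hp1
    rw [indicator_of_mem hp1, indicator_of_notMem hp2, add_zero]
    have hq1 : q ∉ Metric.ball (carrier N) 1 := fun h => hsame _ hc hp1 h
    rw [indicator_of_notMem hq1, zero_add]
    by_cases hq2 : q ∈ Metric.ball (-carrier N) 1
    · rw [indicator_of_mem hq2, ← osc_add]
      refine hind.trans (hmain _ ?_ (hB _ hp1) (hB' _ hq2))
      rw [show -(lam p * s) + lam q * s = (lam q - lam p) * s by ring]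
      exact hph _ _ (hB' _ hq2) (hB _ hp1)
    · rw [indicator_of_notMem hq2, mul_zero, mul_zero, Complex.zero_re,
        indicator_of_notMem fun h => hq2 (hball _ h)]
  · rw [indicator_of_notMem (fun h => hp1 (hpos h)), indicator_of_notMem hp1, zero_add]
    by_cases hp2 : p ∈ Metric.ball (-carrier N) 1
    · rw [indicator_of_mem hp2]
      have hq2 : q ∉ Metric.ball (-carrier N) 1 := fun h => hsame _ hc' hp2 h
      rw [indicator_of_notMem hq2, add_zero]
      by_cases hq1 : q ∈ Metric.ball (carrier N) 1
      · rw [indicator_of_mem hq1, ← osc_add]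
        refine hA.trans (hmain _ ?_ (hB' _ hp2) (hB _ hq1))
        rw [show lam p * s + -(lam q * s) = (lam p - lam q) * s by ring]
        exact hph _ _ (hB' _ hp2) (hB _ hq1)
      · rw [indicator_of_notMem hq1, mul_zero, mul_zero, Complex.zero_re]
    · rw [indicator_of_notMem hp2, zero_mul, mul_zero, Complex.zero_re]

end Boussinesq

end
-- Growth of the low frequencies
noncomputable section

namespace Boussinesq

variable {a b c d κ : ℝ} {μ lam : Plane → ℝ} {A N Λ t : ℝ}

open Interaction IsBounded

lemma packet_majorizedBy (hA : 0 ≤ A) :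
    MajorizedBy 0 (packetBound A N) fun _ => packet A N :=
  ⟨fun _ => measurable_packet A N, fun _ => continuous_const, fun _ ξ => by
    simpa using norm_packet_le hA N ξ⟩

lemma norm_osc_sub_one_le (θ : ℝ) : ‖osc θ - 1‖ ≤ |θ| := by
  rw [osc, mul_comm]
  exact Real.norm_exp_I_mul_ofReal_sub_one_le

namespace IsDispersion

lemma controls (h : IsDispersion a b c d μ lam κ) (hA : 0 ≤ A) (hN : 0 ≤ N) (hΛ : 0 ≤ Λ)
    (hm : ∀ (n : ℕ) ξ, ‖ξ‖ ≤ (n + 2) * (N + 1) → waveBound b d κ ξ ≤ Λ * (n + 2)) :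
    Controls (waveInteraction b d μ lam) κ (waveBound b d κ) (packetBound A N) A
      (2 * A * discArea) (N + 1) Λ (packet A N) :=
  ⟨h.waveInteraction_isBounded, isDatum_packetBound hA hN,
    fun ξ => (abs_nonneg _).trans (h.abs_waveMult_le (true, 0) ξ), hm, hΛ, measurable_packet A N,
    norm_packet_le hA N⟩

lemma waveBound_neg (b d κ : ℝ) (ξ : Plane) : waveBound b d κ (-ξ) = waveBound b d κ ξ := by
  simp [waveBound]

lemma form_packet (h : IsDispersion a b c d μ lam κ) (s : ℝ) (ξ : Plane) :
    (waveInteraction b d μ lam).form (fun _ => packet A N) (fun _ => packet A N) s ξ =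
      osc (lam ξ * s) * nonlin b d μ (carried lam A N s) ξ :=
  h.form_eq (fun _ => packet A N) s ξ

lemma nonlin_packet (h : IsDispersion a b c d μ lam κ) (s : ℝ) (ξ : Plane) :
    nonlin b d μ (carried lam A N s) ξ = osc (-lam ξ * s) *
      (waveInteraction b d μ lam).form (fun _ => packet A N) (fun _ => packet A N) s ξ := by
  rw [h.form_packet, ← mul_assoc, neg_mul, osc_neg_mul, one_mul]

lemma form_packet_majorizedBy (h : IsDispersion a b c d μ lam κ) (hA : 0 ≤ A) (hN : 0 ≤ N) :
    MajorizedBy 0 (fun ξ => waveBound b d κ ξ * (16 * κ ^ 2) * (A * (2 * A * discArea)))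
      ((waveInteraction b d μ lam).form (fun _ => packet A N) fun _ => packet A N) := by
  have hd := isDatum_packetBound hA hN
  have h1 := h.waveInteraction_isBounded.form_majorizedBy (packet_majorizedBy (N := N) hA)
    hd.toIsMajorant (packet_majorizedBy hA) hd.toIsMajorant
  refine h1.mono fun ξ => ?_
  have hm : 0 ≤ waveBound b d κ ξ := (abs_nonneg _).trans (h.abs_waveMult_le (true, 0) ξ)
  have e : (Fintype.card (Bool × Fin 2) : ℝ) * (4 * κ ^ 2) = 16 * κ ^ 2 := by
    simp; ring
  rw [e]
  gcongr
  exact (hd.toIsMajorant.rconv_le hd.toIsMajorant hd.le_sup ξ).trans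
    (mul_le_mul_of_nonneg_left hd.integral_le hA)

lemma continuous_nonlin_packet (h : IsDispersion a b c d μ lam κ) (hA : 0 ≤ A) (hN : 0 ≤ N)
    (ξ : Plane) : Continuous fun s => nonlin b d μ (carried lam A N s) ξ := by
  simp only [h.nonlin_packet]
  exact (continuous_osc.comp (by fun_prop)).mul ((h.form_packet_majorizedBy hA hN).continuous ξ)

lemma norm_nonlin_packet_le (h : IsDispersion a b c d μ lam κ) (hA : 0 ≤ A) (hN : 0 ≤ N) (s : ℝ)
    (ξ : Plane) : ‖nonlin b d μ (carried lam A N s) ξ‖ ≤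
      waveBound b d κ ξ * (16 * κ ^ 2) * (A * (2 * A * discArea)) := by
  rw [h.nonlin_packet, norm_mul, norm_osc, one_mul]
  simpa using (h.form_packet_majorizedBy hA hN).bound s ξ

lemma integrable_velHat_packet (h : IsDispersion a b c d μ lam κ) (hA : 0 ≤ A) (hN : 0 ≤ N)
    (s : ℝ) (j : Fin 2) (ξ : Plane) : Integrable fun ζ =>
      velHat j (carried lam A N s) (ξ - ζ) * velHat j (carried lam A N s) ζ := by
  have hd := (isDatum_packetBound hA hN).toIsMajorant
  have hp := h.waveInteraction_isBounded.left_majorizedBy (false, j)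
    (packet_majorizedBy (N := N) hA) hd
  have hκ : 0 ≤ 2 * κ := by linarith [h.one_le]
  have := hp.integrable_integrand hp (hd.const_mul hκ) (hd.const_mul hκ) s ξ
  rw [h.left_vel] at this
  exact this

/-- The resonant interaction of the packet with its mirror image. -/
lemma re_sum_conv_ge (h : IsDispersion a b c d μ lam κ) (hA : 0 ≤ A) (hN : 3 ≤ N) {s : ℝ}
    (hph : ∀ ξ ζ : Plane, |‖ξ‖ - N| ≤ 1 → |‖ζ‖ - N| ≤ 1 → |(lam ξ - lam ζ) * s| ≤ 1) {ξ : Plane}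
    (hξ : ‖ξ‖ ≤ 1 / 2) : A ^ 2 / 4 * halfDiscArea ≤
      (∑ j, conv (velHat j (carried lam A N s)) (velHat j (carried lam A N s)) ξ).re := by
  have hint := fun j => h.integrable_velHat_packet hA (by linarith : 0 ≤ N) s j ξ
  have hs := integrable_finsetSum Finset.univ fun j (_ : j ∈ Finset.univ) => hint j
  have e1 : (∑ j, conv (velHat j (carried lam A N s)) (velHat j (carried lam A N s)) ξ).re =
      ∫ ζ, (∑ j, velHat j (carried lam A N s) (ξ - ζ) * velHat j (carried lam A N s) ζ).re := by
    have := integral_re hs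
    simp only [RCLike.re_to_complex] at this
    rw [this, integral_finsetSum _ fun j _ => hint j]
    rfl
  have e2 : A ^ 2 / 4 * halfDiscArea =
      ∫ ζ, (Metric.ball (-carrier N) (1 / 2)).indicator (fun _ => A ^ 2 / 4) ζ := by
    rw [integral_indicator measurableSet_ball, setIntegral_const, smul_eq_mul, halfDiscArea,
      Measure.real, Measure.real,
      Measure.addHaar_ball_center volume (-carrier N), mul_comm]
  rw [e1, e2]
  refine integral_mono ((integrable_indicator_iff measurableSet_ball).2
    (integrableOn_const (hs := measure_ball_lt_top.ne))) hs.re fun ζ => ?_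
  exact re_sum_velHat_ge h.even_lam hN hph (by simpa using hξ)

/-- By parity the difference contains only the kinetic energy, whose low frequency part has a
positive real part; the mass flux, of no definite sign, drops out. -/
lemma re_nonlin_sub_ge (h : IsDispersion a b c d μ lam κ) (hA : 0 ≤ A) (hN : 3 ≤ N) {s : ℝ}
    (hph : ∀ ξ ζ : Plane, |‖ξ‖ - N| ≤ 1 → |‖ζ‖ - N| ≤ 1 → |(lam ξ - lam ζ) * s| ≤ 1) {ξ : Plane}
    (hξ : ‖ξ‖ ≤ 1 / 2) :
    freq ξ / (2 * (1 + d * freq ξ ^ 2)) * (A ^ 2 / 4 * halfDiscArea) ≤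
    (Complex.I * (nonlin b d μ (carried lam A N s) ξ -
      starRingEnd ℂ (nonlin b d μ (carried lam A N s) (-ξ)))).re := by
  have hD : ((1 + d * freq ξ ^ 2 : ℝ) : ℂ) ≠ 0 := by
    exact_mod_cast (by linarith [h.one_le_vel ξ] : 1 + d * freq ξ ^ 2 ≠ 0)
  have e : Complex.I * (nonlin b d μ (carried lam A N s) ξ -
      starRingEnd ℂ (nonlin b d μ (carried lam A N s) (-ξ))) =
      ((freq ξ / (2 * (1 + d * freq ξ ^ 2)) : ℝ) : ℂ) *
      ∑ j, conv (velHat j (carried lam A N s)) (velHat j (carried lam A N s)) ξ := by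
    rw [h.conj_nonlin_neg, nonlin, Complex.ofReal_div, Complex.ofReal_mul 2, Complex.ofReal_ofNat]
    generalize ((1 + d * freq ξ ^ 2 : ℝ) : ℂ) = D at hD
    field_simp
    linear_combination (-2 * freq ξ * ∑ j, conv (velHat j (carried lam A N s))
      (velHat j (carried lam A N s)) ξ) * Complex.I_sq
  rw [e, Complex.re_ofReal_mul]
  have := freq_nonneg ξ
  have := h.one_le_vel ξ
  exact mul_le_mul_of_nonneg_left (h.re_sum_conv_ge hA hN hph hξ) (by positivity)

/-- The packet itself vanishes at low frequency. Two errors remain: the terms of third and higher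
order, relatively of the size of the series ratio, and the linear rotation between the times `s` and
`t`, at most `|lam ξ| * t`. -/
lemma norm_twist_sub_le (h : IsDispersion a b c d μ lam κ) (hA : 0 ≤ A) (hN : 3 ≤ N)
    (hc : Controls (waveInteraction b d μ lam) κ (waveBound b d κ) (packetBound A N) A
      (2 * A * discArea) (N + 1) Λ (packet A N)) (ht : 0 ≤ t)
    (hτ : 4 * rate (Bool × Fin 2) κ Λ * t * (2 * A * discArea) ≤ 1 / 2) {ξ : Plane}
    (hξ : ‖ξ‖ ≤ 1 / 2) :
    ‖twist lam ((waveInteraction b d μ lam).sol (packet A N)) t ξ -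
      ∫ s in (0 : ℝ)..t, nonlin b d μ (carried lam A N s) ξ‖ ≤
    waveBound b d κ ξ * (16 * κ ^ 2) * (A * (2 * A * discArea)) * t *
      (8 * (4 * rate (Bool × Fin 2) κ Λ * t * (2 * A * discArea)) + |lam ξ| * t) := by
  have hN0 : 0 ≤ N := by linarith
  have h1 := hc.norm_sol_sub_le ht hτ ξ
  rw [packet_eq_zero (by linarith) hξ, sub_zero] at h1
  have e : (Fintype.card (Bool × Fin 2) : ℝ) * (32 * κ ^ 2) = 16 * κ ^ 2 * 8 := by
    simp; ring
  rw [e] at h1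
  simp only [h.form_packet] at h1
  set F : ℝ → ℂ := fun s => nonlin b d μ (carried lam A N s) ξ with hF
  set B := waveBound b d κ ξ * (16 * κ ^ 2) * (A * (2 * A * discArea)) with hB
  have hFc : Continuous F := h.continuous_nonlin_packet hA hN0 ξ
  have hFB : ∀ s, ‖F s‖ ≤ B := fun s => h.norm_nonlin_packet_le hA hN0 s ξ
  have hosc : Continuous fun s => osc (lam ξ * s) := continuous_osc.comp (by fun_prop)
  have i1 : IntervalIntegrable (fun s => osc (-lam ξ * t) * (osc (lam ξ * s) * F s)) volume 0 t :=
    (continuous_const.mul (hosc.mul hFc)).intervalIntegrable _ _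
  have h2 : ‖∫ s in (0 : ℝ)..t, (osc (-lam ξ * t) * (osc (lam ξ * s) * F s) - F s)‖ ≤
      |lam ξ| * t * B * |t - 0| := by
    refine intervalIntegral.norm_integral_le_of_norm_le_const fun s hs => ?_
    rw [uIoc_of_le ht] at hs
    have e2 : osc (-lam ξ * t) * (osc (lam ξ * s) * F s) - F s =
        (osc (lam ξ * (s - t)) - 1) * F s := by
      rw [← mul_assoc, ← osc_add, show -lam ξ * t + lam ξ * s = lam ξ * (s - t) by ring]; ring
    rw [e2, norm_mul]
    refine mul_le_mul ((norm_osc_sub_one_le _).trans ?_) (hFB s) (norm_nonneg _) (by positivity)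
    rw [abs_mul]
    have : |s - t| ≤ t := by rw [abs_le]; constructor <;> linarith [hs.1, hs.2]
    gcongr
  rw [sub_zero, abs_of_nonneg ht] at h2
  rw [intervalIntegral.integral_sub i1 (hFc.intervalIntegrable _ _),
    intervalIntegral.integral_const_mul] at h2
  have e3 : twist lam ((waveInteraction b d μ lam).sol (packet A N)) t ξ -
      ∫ s in (0 : ℝ)..t, F s =
      osc (-lam ξ * t) * ((waveInteraction b d μ lam).sol (packet A N) t ξ -
        ∫ s in (0 : ℝ)..t, osc (lam ξ * s) * F s) +
      (osc (-lam ξ * t) * (∫ s in (0 : ℝ)..t, osc (lam ξ * s) * F s) - ∫ s in (0 : ℝ)..t, F s) := by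
    rw [twist]; ring
  rw [e3]
  refine (norm_add_le _ _).trans ?_
  rw [norm_mul, norm_osc, one_mul]
  refine (add_le_add h1 h2).trans (le_of_eq ?_)
  rw [hB]; ring

/-- The lower bound at low frequency. -/
lemma norm_velHat_ge (h : IsDispersion a b c d μ lam κ) (hA : 0 ≤ A) (hN : 3 ≤ N)
    (hc : Controls (waveInteraction b d μ lam) κ (waveBound b d κ) (packetBound A N) A
      (2 * A * discArea) (N + 1) Λ (packet A N)) (ht : 0 ≤ t)
    (hτ : 4 * rate (Bool × Fin 2) κ Λ * t * (2 * A * discArea) ≤ 1 / 2)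
    (hph : ∀ ξ ζ : Plane, |‖ξ‖ - N| ≤ 1 → |‖ζ‖ - N| ≤ 1 → |lam ξ - lam ζ| * t ≤ 1) {ξ : Plane}
    (hξ : ‖ξ‖ ≤ 1 / 2) (hξ0 : 1 / 4 ≤ ξ 0) :
    t * (freq ξ / (2 * (1 + d * freq ξ ^ 2)) * (A ^ 2 / 4 * halfDiscArea)) / 2 -
      waveBound b d κ ξ * (16 * κ ^ 2) * (A * (2 * A * discArea)) * t *
      (8 * (4 * rate (Bool × Fin 2) κ Λ * t * (2 * A * discArea)) + |lam ξ| * t) ≤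
    ‖velHat 0 (twist lam ((waveInteraction b d μ lam).sol (packet A N)) t) ξ‖ := by
  have hN0 : 0 ≤ N := by linarith
  set y := twist lam ((waveInteraction b d μ lam).sol (packet A N)) t with hy
  set F : Plane → ℝ → ℂ := fun ξ s => nonlin b d μ (carried lam A N s) ξ with hF
  have hFc : ∀ ξ, Continuous (F ξ) := h.continuous_nonlin_packet hA hN0
  set E := waveBound b d κ ξ * (16 * κ ^ 2) * (A * (2 * A * discArea)) * t *
      (8 * (4 * rate (Bool × Fin 2) κ Λ * t * (2 * A * discArea)) + |lam ξ| * t) with hE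
  set L := freq ξ / (2 * (1 + d * freq ξ ^ 2)) * (A ^ 2 / 4 * halfDiscArea) with hL
  have e1 : ‖y ξ - ∫ s in (0 : ℝ)..t, F ξ s‖ ≤ E := h.norm_twist_sub_le hA hN hc ht hτ hξ
  have e2 : ‖y (-ξ) - ∫ s in (0 : ℝ)..t, F (-ξ) s‖ ≤ E := by
    have := h.norm_twist_sub_le hA hN hc ht hτ (ξ := -ξ) (by simpa using hξ)
    rwa [waveBound_neg, h.even_lam] at this
  have hcc : Continuous fun s => starRingEnd ℂ (F (-ξ) s) :=
    Complex.continuous_conj.comp (hFc (-ξ))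
  have hG : Continuous fun s => Complex.I * (F ξ s - starRingEnd ℂ (F (-ξ) s)) :=
    continuous_const.mul ((hFc ξ).sub hcc)
  have e3 : t * L ≤ ‖(∫ s in (0 : ℝ)..t, F ξ s) -
      starRingEnd ℂ (∫ s in (0 : ℝ)..t, F (-ξ) s)‖ := by
    have i1 : (∫ s in (0 : ℝ)..t, F ξ s) - starRingEnd ℂ (∫ s in (0 : ℝ)..t, F (-ξ) s) =
        ∫ s in (0 : ℝ)..t, (F ξ s - starRingEnd ℂ (F (-ξ) s)) := by
      rw [← intervalIntegral.intervalIntegral_conj, intervalIntegral.integral_sub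
        ((hFc ξ).intervalIntegrable _ _) (hcc.intervalIntegrable _ _)]
    have i2 : (Complex.I * ∫ s in (0 : ℝ)..t, (F ξ s - starRingEnd ℂ (F (-ξ) s))).re =
        ∫ s in (0 : ℝ)..t, (Complex.I * (F ξ s - starRingEnd ℂ (F (-ξ) s))).re := by
      rw [← intervalIntegral.integral_const_mul]
      exact (Complex.reCLM.intervalIntegral_comp_comm (hG.intervalIntegrable _ _)).symm
    have i3 : ∫ s in (0 : ℝ)..t, L ≤
        ∫ s in (0 : ℝ)..t, (Complex.I * (F ξ s - starRingEnd ℂ (F (-ξ) s))).re := by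
      refine intervalIntegral.integral_mono_on ht (by simp)
        ((Complex.continuous_re.comp hG).intervalIntegrable _ _) fun s hs => ?_
      refine h.re_nonlin_sub_ge hA hN (fun p q hp hq => ?_) hξ
      rw [abs_mul, abs_of_nonneg hs.1]
      exact (mul_le_mul_of_nonneg_left hs.2 (abs_nonneg _)).trans (hph p q hp hq)
    rw [intervalIntegral.integral_const, sub_zero, smul_eq_mul] at i3
    rw [i1]
    refine i3.trans (i2.symm.le.trans ((Complex.re_le_norm _).trans (le_of_eq ?_)))
    rw [norm_mul, Complex.norm_I, one_mul]
  have e4 : t * L - 2 * E ≤ ‖y ξ - starRingEnd ℂ (y (-ξ))‖ := by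
    have i1 : (∫ s in (0 : ℝ)..t, F ξ s) - starRingEnd ℂ (∫ s in (0 : ℝ)..t, F (-ξ) s) =
        (y ξ - starRingEnd ℂ (y (-ξ))) - (y ξ - ∫ s in (0 : ℝ)..t, F ξ s) +
        starRingEnd ℂ (y (-ξ) - ∫ s in (0 : ℝ)..t, F (-ξ) s) := by
      rw [map_sub]; ring
    have i2 := norm_add_le ((y ξ - starRingEnd ℂ (y (-ξ))) - (y ξ - ∫ s in (0 : ℝ)..t, F ξ s))
      (starRingEnd ℂ (y (-ξ) - ∫ s in (0 : ℝ)..t, F (-ξ) s))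
    have i3 := norm_sub_le (y ξ - starRingEnd ℂ (y (-ξ))) (y ξ - ∫ s in (0 : ℝ)..t, F ξ s)
    rw [← i1, RCLike.norm_conj] at i2
    linarith
  -- `ξ 0 ≥ 1 / 4` and `‖ξ‖ ≤ 1 / 2`: one velocity component carries a fixed share of the growth.
  have hdir : 1 / 2 ≤ |dir 0 ξ| := by
    have h1 : 0 < ‖ξ‖ := lt_of_lt_of_le (by linarith) ((le_abs_self _).trans (norm_coord_le 0 ξ))
    refine le_trans ?_ (le_abs_self _)
    rw [dir, le_div_iff₀ h1]
    linarith
  rw [velHat, norm_mul, Complex.norm_real, Real.norm_eq_abs]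
  calc t * L / 2 - E = 1 / 2 * (t * L - 2 * E) := by ring
    _ ≤ 1 / 2 * ‖y ξ - starRingEnd ℂ (y (-ξ))‖ := by linarith
    _ ≤ _ := mul_le_mul_of_nonneg_right hdir (norm_nonneg _)

end IsDispersion

end Boussinesq

end
-- Size of the datum and of the solution
noncomputable section

namespace Boussinesq

variable {a b c d κ : ℝ} {μ lam : Plane → ℝ} {A N Λ t T s : ℝ}

open Interaction IsBounded

/-- The square root of the area of two discs. -/
def packetConst : ℝ≥0∞ := (2 * volume (Metric.ball (0 : Plane) 1)) ^ (1 / 2 : ℝ)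

lemma packetConst_ne_top : packetConst ≠ ⊤ :=
  ENNReal.rpow_ne_top_of_nonneg (by norm_num) (ENNReal.mul_ne_top (by norm_num)
    measure_ball_lt_top.ne)

lemma weight_le_rpow (hs : s ≤ 0) (hN : 1 < N) {ξ : Plane} (h : |‖ξ‖ - N| ≤ 1) :
    weight s ξ ≤ (N - 1) ^ s := by
  have h1 : N - 1 ≤ ‖ξ‖ := by linarith [(abs_le.1 h).1]
  have h2 : (N - 1) ^ s = ((N - 1) ^ 2) ^ (s / 2) := by
    rw [← Real.rpow_natCast, ← Real.rpow_mul (by linarith)]; congr 1; push_cast; ring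
  rw [h2, weight]
  refine Real.rpow_le_rpow_of_nonpos (by nlinarith) ?_ (by linarith)
  have h3 : N - 1 ≤ 2 * Real.pi * ‖ξ‖ := by nlinarith [Real.pi_gt_three]
  nlinarith

lemma IsSpec.sobolevNorm_le_of_packetBound {f : Plane → ℝ} {g : Plane → ℂ} (h : IsSpec f g)
    (hA : 0 ≤ A) (hN : 1 < N) (hs : s ≤ 0) (hκ : 0 ≤ κ)
    (hg : ∀ ξ, ‖g ξ‖ ≤ 2 * κ * packetBound A N ξ) :
    sobolevNorm s f ≤ ENNReal.ofReal (2 * κ * A * (N - 1) ^ s) * packetConst := by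
  set U := Metric.ball (carrier N) 1 ∪ Metric.ball (-carrier N) 1 with hU
  have hM : 0 ≤ 2 * κ * A * (N - 1) ^ s := by
    have := Real.rpow_nonneg (by linarith : 0 ≤ N - 1) s; positivity
  rw [h.sobolevNorm_eq]
  have h1 : eLpNorm (fun ξ => (weight s ξ : ℂ) * g ξ) 2 volume ≤
      eLpNorm (U.indicator fun _ => 2 * κ * A * (N - 1) ^ s) 2 (volume : Measure Plane) := by
    refine eLpNorm_mono_real fun ξ => ?_
    rw [norm_weight_mul]
    by_cases hξ : ξ ∈ U
    · have h2 := hg ξ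
      have h3 : |‖ξ‖ - N| ≤ 1 := by
        rcases hξ with hξ | hξ
        · exact abs_norm_sub_le_of_mem_ball (by linarith) hξ
        · rw [← norm_neg]
          exact abs_norm_sub_le_of_mem_ball (by linarith) (neg_mem_ball_carrier.2 hξ)
      rw [packetBound, ← hU, indicator_of_mem hξ] at h2
      rw [indicator_of_mem hξ]
      calc weight s ξ * ‖g ξ‖ ≤ (N - 1) ^ s * (2 * κ * A) :=
            mul_le_mul (weight_le_rpow hs hN h3) h2 (norm_nonneg _)
              (Real.rpow_nonneg (by linarith) _)
        _ = _ := by ring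
    · have h2 := hg ξ
      rw [packetBound, ← hU, indicator_of_notMem hξ, mul_zero] at h2
      rw [indicator_of_notMem hξ]
      exact mul_nonpos_of_nonneg_of_nonpos (weight_nonneg _ _) h2
  refine h1.trans ?_
  rw [eLpNorm_indicator_const (measurableSet_ball.union measurableSet_ball) (by norm_num)
    (by norm_num), Real.enorm_of_nonneg hM, packetConst, ENNReal.toReal_ofNat]
  gcongr
  refine (measure_union_le _ _).trans (le_of_eq ?_)
  rw [Measure.addHaar_ball_center, Measure.addHaar_ball_center volume (-carrier N), two_mul]

/-- The low frequencies at which the solution becomes large. -/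
def lowBall : Set Plane := Metric.ball (carrier (3 / 8)) (1 / 8)

lemma norm_le_of_mem_lowBall {ξ : Plane} (h : ξ ∈ lowBall) : ‖ξ‖ ≤ 1 / 2 := by
  rw [lowBall, mem_ball_iff_norm] at h
  have := norm_sub_norm_le ξ (carrier (3 / 8))
  rw [norm_carrier, abs_of_pos (by norm_num)] at this
  linarith

lemma le_coord_of_mem_lowBall {ξ : Plane} (h : ξ ∈ lowBall) : 1 / 4 ≤ ξ 0 := by
  rw [lowBall, mem_ball_iff_norm] at h
  have h1 := norm_coord_le 0 (ξ - carrier (3 / 8))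
  have h2 : (ξ - carrier (3 / 8)) 0 = ξ 0 - 3 / 8 := by simp [carrier]
  rw [h2, Real.norm_eq_abs] at h1
  linarith [(abs_le.1 h1).1]

/-- The square root of the area of the set of low frequencies, with the Sobolev weight. -/
def lowConst (s : ℝ) : ℝ≥0∞ :=
  ENNReal.ofReal ((1 + Real.pi ^ 2) ^ (s / 2)) * volume lowBall ^ (1 / 2 : ℝ)

lemma lowConst_pos (s : ℝ) : 0 < lowConst s := by
  refine ENNReal.mul_pos (ENNReal.ofReal_pos.2 (by positivity)).ne' ?_
  exact (ENNReal.rpow_pos (Metric.measure_ball_pos _ _ (by norm_num)) measure_ball_lt_top.ne).ne'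

lemma IsSpec.le_sobolevNorm {f : Plane → ℝ} {g : Plane → ℂ} (h : IsSpec f g) (hs : s ≤ 0) {M : ℝ}
    (hM : 0 ≤ M) (hg : ∀ ξ ∈ lowBall, M ≤ ‖g ξ‖) :
    ENNReal.ofReal M * lowConst s ≤ sobolevNorm s f := by
  have hw : 0 ≤ (1 + Real.pi ^ 2) ^ (s / 2) := by positivity
  rw [h.sobolevNorm_eq]
  have h1 : eLpNorm (lowBall.indicator fun _ => M * (1 + Real.pi ^ 2) ^ (s / 2)) 2
      (volume : Measure Plane) ≤ eLpNorm (fun ξ => (weight s ξ : ℂ) * g ξ) 2 volume := by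
    refine eLpNorm_mono fun ξ => ?_
    rw [norm_weight_mul]
    by_cases hξ : ξ ∈ lowBall
    · rw [indicator_of_mem hξ, Real.norm_of_nonneg (by positivity), mul_comm]
      refine mul_le_mul ?_ (hg ξ hξ) hM (weight_nonneg _ _)
      refine Real.rpow_le_rpow_of_nonpos (by positivity) ?_ (by linarith)
      have : 2 * Real.pi * ‖ξ‖ ≤ Real.pi := by
        nlinarith [norm_le_of_mem_lowBall hξ, Real.pi_pos]
      gcongr
    · rw [indicator_of_notMem hξ, norm_zero]
      exact mul_nonneg (weight_nonneg _ _) (norm_nonneg _)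
  refine le_trans (le_of_eq ?_) h1
  rw [eLpNorm_indicator_const (s := lowBall) measurableSet_ball (by norm_num) (by norm_num),
    Real.enorm_of_nonneg (by positivity), ENNReal.ofReal_mul hM, lowConst, ENNReal.toReal_ofNat,
    mul_assoc]

namespace IsDispersion

lemma norm_etaHat_packet_le (h : IsDispersion a b c d μ lam κ) (hA : 0 ≤ A) (ξ : Plane) :
    ‖etaHat μ (packet A N) ξ‖ ≤ 2 * κ * packetBound A N ξ := by
  have h1 := norm_packet_le hA N ξ
  have h2 := norm_packet_le hA N (-ξ)
  rw [packetBound_even] at h2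
  have hκ := h.one_le
  rw [etaHat, norm_mul, Complex.norm_real, Real.norm_of_nonneg (h.ratio_pos ξ).le]
  calc μ ξ * ‖packet A N ξ + starRingEnd ℂ (packet A N (-ξ))‖
      ≤ κ * (packetBound A N ξ + packetBound A N ξ) := by
        refine mul_le_mul (h.ratio_le ξ) ((norm_add_le _ _).trans ?_) (norm_nonneg _) (by linarith)
        rw [RCLike.norm_conj]; exact add_le_add h1 h2
    _ = _ := by ring

lemma norm_velHat_packet_le (h : IsDispersion a b c d μ lam κ) (hA : 0 ≤ A) (j : Fin 2)
    (ξ : Plane) : ‖velHat j (packet A N) ξ‖ ≤ 2 * κ * packetBound A N ξ := by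
  have h1 := norm_packet_le hA N ξ
  have h2 := norm_packet_le hA N (-ξ)
  rw [packetBound_even] at h2
  have hκ := h.one_le
  rw [velHat, norm_mul, Complex.norm_real, Real.norm_eq_abs]
  calc |dir j ξ| * ‖packet A N ξ - starRingEnd ℂ (packet A N (-ξ))‖
      ≤ κ * (packetBound A N ξ + packetBound A N ξ) := by
        refine mul_le_mul ((abs_dir_le j ξ).trans hκ) ((norm_sub_le _ _).trans ?_) (norm_nonneg _)
          (by linarith)
        rw [RCLike.norm_conj]; exact add_le_add h1 h2
    _ = _ := by ring

lemma abs_lam_le_of_norm_le (h : IsDispersion a b c d μ lam κ) {ρ : ℝ} {ξ : Plane}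
    (hξ : ‖ξ‖ ≤ ρ) : |lam ξ| ≤ κ * (1 + |c|) * (1 + 2 * Real.pi * ρ) ^ 3 := by
  have hκ := h.one_le
  refine (h.abs_lam_le ξ).trans ?_
  have h1 := weight_natCast 3 ξ
  rw [Nat.cast_ofNat] at h1
  rw [h1]
  have h2 : weight 1 ξ ≤ 1 + 2 * Real.pi * ρ := (weight_one_le ξ).trans (by gcongr)
  exact mul_le_mul_of_nonneg_left (pow_le_pow_left₀ (weight_nonneg _ _) h2 3) (by positivity)

lemma waveBound_le (h : IsDispersion a b c d μ lam κ) (ξ : Plane) :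
    waveBound b d κ ξ ≤ 2 * κ * freq ξ := by
  have hκ := h.one_le
  have h0 := freq_nonneg ξ
  have h1 := div_le_self h0 (h.one_le_eta ξ)
  have h2 := div_le_self h0 (h.one_le_vel ξ)
  rw [waveBound]
  nlinarith

/-- The low frequencies grow at a rate quadratic in the amplitude of the packet. -/
lemma exists_norm_velHat_ge (h : IsDispersion a b c d μ lam κ) :
    ∃ c₁ > 0, ∃ θ₀ > 0, θ₀ ≤ 1 / 2 ∧ ∃ t₀ > 0, ∀ A N Λ t : ℝ, 0 ≤ A → 3 ≤ N → 0 ≤ t → t ≤ t₀ →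
      Controls (waveInteraction b d μ lam) κ (waveBound b d κ) (packetBound A N) A
        (2 * A * discArea) (N + 1) Λ (packet A N) →
      4 * rate (Bool × Fin 2) κ Λ * t * (2 * A * discArea) ≤ θ₀ →
      (∀ ξ ζ : Plane, |‖ξ‖ - N| ≤ 1 → |‖ζ‖ - N| ≤ 1 → |lam ξ - lam ζ| * t ≤ 1) →
      ∀ ξ ∈ lowBall, c₁ * (A ^ 2 * t) ≤
        ‖velHat 0 (twist lam ((waveInteraction b d μ lam).sol (packet A N)) t) ξ‖ := by
  have hκ := h.one_le
  have hd := h.nonneg_d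
  have hV := discArea_pos
  have hV' := halfDiscArea_pos
  -- `L` bounds the phase on `‖ξ‖ ≤ 1 / 2`, `q` is the rate of the quadratic term, and `W` the size
  -- of the error terms, each up to a factor `freq ξ * A ^ 2`. The bounds `θ₀` and `t₀` make each of
  -- the two errors at most `q / 4`, so that half of the main term survives.
  set L : ℝ := κ * (1 + |c|) * (1 + 2 * Real.pi * (1 / 2)) ^ 3 with hL
  have hLpos : 0 < L := by positivity
  set q : ℝ := halfDiscArea / (16 * (1 + 16 * d)) with hq
  have hqpos : 0 < q := by positivity
  set W : ℝ := 64 * κ ^ 3 * discArea with hW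
  have hWpos : 0 < W := by positivity
  refine ⟨q / 2, by positivity, min (1 / 2) (q / (W * 32)), by positivity, min_le_left _ _,
    q / (W * L * 4), by positivity, ?_⟩
  intro A N Λ t hA hN ht ht0 hc hθ hph ξ hξ
  have hξ1 := norm_le_of_mem_lowBall hξ
  have hξ2 := le_coord_of_mem_lowBall hξ
  have hξ3 : 1 / 4 ≤ ‖ξ‖ := hξ2.trans ((le_abs_self _).trans (norm_coord_le 0 ξ))
  refine le_trans ?_ (h.norm_velHat_ge hA hN hc ht (hθ.trans (min_le_left _ _)) hph hξ1 hξ2)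
  set θ := 4 * rate (Bool × Fin 2) κ Λ * t * (2 * A * discArea) with hθdef
  set r := freq ξ with hr
  have r1 : 1 ≤ r := by rw [hr, freq]; nlinarith [Real.pi_gt_three]
  have r2 : r ≤ 4 := by rw [hr, freq]; nlinarith [Real.pi_le_four, norm_nonneg ξ]
  have h1 : W * (8 * θ) ≤ q / 4 := by
    have := hθ.trans (min_le_right _ _)
    rw [le_div_iff₀ (by positivity)] at this
    linarith
  have h2 : W * (|lam ξ| * t) ≤ q / 4 := by
    rw [le_div_iff₀ (by positivity)] at ht0
    have h3 : |lam ξ| ≤ L := h.abs_lam_le_of_norm_le hξ1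
    have h4 := mul_le_mul_of_nonneg_left (mul_le_mul_of_nonneg_right h3 ht) hWpos.le
    linarith
  have h3 : r * q * A ^ 2 ≤ r / (2 * (1 + d * r ^ 2)) * (A ^ 2 / 4 * halfDiscArea) / 2 := by
    have e : r / (2 * (1 + d * r ^ 2)) * (A ^ 2 / 4 * halfDiscArea) / 2 =
        r * (halfDiscArea / (16 * (1 + d * r ^ 2))) * A ^ 2 := by
      have : 1 + d * r ^ 2 ≠ 0 := by positivity
      field_simp; ring
    rw [e, hq]
    have : r ^ 2 ≤ 16 := by nlinarith
    have : 1 + d * r ^ 2 ≤ 1 + 16 * d := by nlinarith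
    gcongr
  have hm : waveBound b d κ ξ * (16 * κ ^ 2) * (A * (2 * A * discArea)) ≤ r * W * A ^ 2 := by
    calc waveBound b d κ ξ * (16 * κ ^ 2) * (A * (2 * A * discArea))
        ≤ 2 * κ * r * (16 * κ ^ 2) * (A * (2 * A * discArea)) := by
          gcongr; exact h.waveBound_le ξ
      _ = _ := by rw [hW]; ring
  have hθ0 : 0 ≤ 8 * θ + |lam ξ| * t := by
    have hr0 : 0 ≤ rate (Bool × Fin 2) κ Λ := by
      have := hc.nonneg_rate
      unfold rate; positivity
    have : 0 ≤ θ := by positivity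
    positivity
  calc q / 2 * (A ^ 2 * t) ≤ r * (q / 2 * (A ^ 2 * t)) :=
        le_mul_of_one_le_left (by positivity) r1
    _ = t * (r * q * A ^ 2) - r * A ^ 2 * t * (q / 4 + q / 4) := by ring
    _ ≤ t * (r * q * A ^ 2) - r * A ^ 2 * t * (W * (8 * θ) + W * (|lam ξ| * t)) := by gcongr
    _ = t * (r * q * A ^ 2) - r * W * A ^ 2 * t * (8 * θ + |lam ξ| * t) := by ring
    _ ≤ _ := by
      refine sub_le_sub ?_ ?_
      · rw [mul_div_assoc]; exact mul_le_mul_of_nonneg_left h3 ht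
      · exact mul_le_mul_of_nonneg_right (mul_le_mul_of_nonneg_right hm ht) hθ0

/-- Existence of a solution with small initial datum that becomes large. -/
lemma exists_flow (h : IsDispersion a b c d μ lam κ) (hadm : Admissible a b c d) :
    ∃ c₁ > 0, ∃ θ₀ > 0, θ₀ ≤ 1 / 2 ∧ ∃ t₀ > 0, ∀ A N Λ t T τ s : ℝ, 0 ≤ A → 3 ≤ N → 0 ≤ t →
      t ≤ t₀ → 0 ≤ Λ → t ≤ T → T < τ → s ≤ 0 →
      (∀ (n : ℕ) ξ, ‖ξ‖ ≤ (n + 2) * (N + 1) → waveBound b d κ ξ ≤ Λ * (n + 2)) →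
      4 * rate (Bool × Fin 2) κ Λ * t * (2 * A * discArea) ≤ θ₀ →
      4 * rate (Bool × Fin 2) κ Λ * τ * (2 * A * discArea) ≤ 1 / 2 →
      (∀ ξ ζ : Plane, |‖ξ‖ - N| ≤ 1 → |‖ζ‖ - N| ≤ 1 → |lam ξ - lam ζ| * t ≤ 1) →
      ∃ (v₀ : State) (v : ℝ → State), IsFlow a b c d T v₀ v ∧
        State.sobolevNorm s v₀ ≤
          3 * (ENNReal.ofReal (2 * κ * A * (N - 1) ^ s) * packetConst) ∧
        ENNReal.ofReal (c₁ * (A ^ 2 * t)) * lowConst s ≤ State.sobolevNorm s (v t) := by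
  obtain ⟨c₁, hc₁, θ₀, hθ₀, hθ₀', t₀, ht₀, key⟩ := h.exists_norm_velHat_ge
  refine ⟨c₁, hc₁, θ₀, hθ₀, hθ₀', t₀, ht₀, ?_⟩
  intro A N Λ t T τ s hA hN ht htt hΛ htT hT hs hm hθ hτ hph
  have hκ := h.one_le
  have hc := h.controls hA (by linarith : 0 ≤ N) hΛ hm
  have hr := h.rapidCurve_twist hc hτ
  have hsol := h.isSolution hr hT
  have ht' : |t| < τ := by rw [abs_of_nonneg ht]; linarith
  have h0' : |(0 : ℝ)| < τ := by rw [abs_zero]; linarith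
  have h0 : twist lam ((waveInteraction b d μ lam).sol (packet A N)) 0 = packet A N := by
    funext ξ
    rw [twist, mul_zero, osc_zero, one_mul, Controls.sol_zero]
  refine ⟨_, _, hsol.isFlow hadm, ?_, ?_⟩
  · have s1 := (hr.etaHat h).isSpec h0' (h.hermitian_etaHat _)
    have s2 := fun j => (hr.velHat j).isSpec h0' (hermitian_velHat j _)
    rw [h0] at s1
    simp only [h0] at s2
    rw [h0, State.sobolevNorm, Fin.sum_univ_two]
    have b1 := s1.sobolevNorm_le_of_packetBound hA (by linarith : 1 < N) hs (by linarith)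
      (h.norm_etaHat_packet_le hA)
    have b2 := fun j => (s2 j).sobolevNorm_le_of_packetBound hA (by linarith : 1 < N) hs
      (by linarith) (h.norm_velHat_packet_le hA j)
    refine (add_le_add b1 (add_le_add (b2 0) (b2 1))).trans (le_of_eq ?_)
    ring
  · refine le_trans ?_ (sobolevNorm_snd_le s _ 0)
    exact ((hr.velHat 0).isSpec ht' (hermitian_velHat 0 _)).le_sobolevNorm hs (by positivity)
      (key A N Λ t hA hN ht htt hc hθ hph)

end IsDispersion

lemma eventually_ofReal_mul_lt {f : ℝ → ℝ} (hf : Tendsto f atTop (𝓝 0)) {δ : ℝ≥0∞} (hδ : 0 < δ) :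
    ∀ᶠ N in atTop, 3 * (ENNReal.ofReal (f N) * packetConst) < δ := by
  have h1 := ENNReal.Tendsto.const_mul (a := 3) (ENNReal.Tendsto.mul_const (b := packetConst)
    (ENNReal.tendsto_ofReal hf) (Or.inr packetConst_ne_top)) (Or.inr (by norm_num))
  simp only [ENNReal.ofReal_zero, zero_mul, mul_zero] at h1
  exact h1.eventually_lt_const hδ

end Boussinesq

end
-- The three regimes
noncomputable section

namespace Boussinesq

variable {a b c d κ : ℝ} {μ lam : Plane → ℝ}

open Interaction IsBounded

/-- From `r ≤ 1 + r²`. Regularization makes the nonlinearity bounded, so the lifespan does not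
depend on the packet frequency. -/
lemma freq_div_le {p : ℝ} (hp : 0 < p) (ξ : Plane) :
    freq ξ / (1 + p * freq ξ ^ 2) ≤ 1 + 1 / p := by
  have h0 := freq_nonneg ξ
  rw [div_le_iff₀ (by positivity)]
  have : (1 + 1 / p) * (1 + p * freq ξ ^ 2) = 1 + freq ξ ^ 2 + 1 / p + p * freq ξ ^ 2 := by
    field_simp; ring
  rw [this]
  have : 0 ≤ 1 / p + p * freq ξ ^ 2 := by positivity
  nlinarith [sq_nonneg (freq ξ - 1)]

/-- Discontinuity of the flow when both equations are regularized and the phase is nearly constant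
at high frequency. -/
lemma IsDispersion.flowDiscontinuousOn (h : IsDispersion a b c d μ lam κ)
    (hadm : Admissible a b c d) (hb : 0 < b) (hd : 0 < d) {L : ℝ}
    (hL : ∀ ξ ζ : Plane, |‖ξ‖ - ‖ζ‖| ≤ 2 → |lam ξ - lam ζ| ≤ L) {s : ℝ} (hs : s < 0) {T : ℝ}
    (hT : 0 < T) : FlowDiscontinuousOn a b c d s T := by
  obtain ⟨c₁, hc₁, θ₀, hθ₀, -, t₀, ht₀, key⟩ := h.exists_flow hadm
  have hκ := h.one_le
  have hV := discArea_pos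
  have hL0 : 0 ≤ L := (abs_nonneg _).trans (hL 0 0 (by simp))
  set Λ : ℝ := κ * ((1 + 1 / b) + (1 + 1 / d)) with hΛ
  have hΛ0 : 0 ≤ Λ := by positivity
  have hm : ∀ ξ, waveBound b d κ ξ ≤ Λ := fun ξ =>
    mul_le_mul_of_nonneg_left (add_le_add (freq_div_le hb ξ) (freq_div_le hd ξ)) (by linarith)
  set ρ := rate (Bool × Fin 2) κ Λ with hρ
  have hρ0 : 0 ≤ ρ := by rw [hρ]; unfold rate; positivity
  -- The amplitude depends on `T` but not on `N` or `δ`. It makes the series converge up to time `T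
  -- + 1`, beyond `T`, so that two-sided derivatives exist on all of `[0, T]`.
  set A : ℝ := 1 / (16 * ρ * (T + 1) * discArea + 1) with hA
  have hA0 : 0 < A := by positivity
  have hA1 : 4 * ρ * (T + 1) * (2 * A * discArea) ≤ 1 / 2 := by
    rw [hA, show 4 * ρ * (T + 1) * (2 * (1 / (16 * ρ * (T + 1) * discArea + 1)) * discArea) =
      8 * ρ * (T + 1) * discArea / (16 * ρ * (T + 1) * discArea + 1) by ring,
      div_le_iff₀ (by positivity)]
    linarith
  -- The time at which the solution is measured: short enough for phase coherence over the packet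
  -- and for the smallness of the higher terms, and again independent of `N`.
  set t : ℝ := min (min T t₀) (min (1 / (L + 1)) (θ₀ / (8 * ρ * A * discArea + 1))) with ht
  have ht0 : 0 < t := by positivity
  have t1 : t ≤ T := (min_le_left _ _).trans (min_le_left _ _)
  have t2 : t ≤ t₀ := (min_le_left _ _).trans (min_le_right _ _)
  have t3 : t ≤ 1 / (L + 1) := (min_le_right _ _).trans (min_le_left _ _)
  have t4 : t ≤ θ₀ / (8 * ρ * A * discArea + 1) := (min_le_right _ _).trans (min_le_right _ _)
  rw [le_div_iff₀ (by positivity)] at t3 t4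
  refine ⟨ENNReal.ofReal (c₁ * (A ^ 2 * t)) * lowConst s,
    ENNReal.mul_pos (ENNReal.ofReal_pos.2 (by positivity)).ne' (lowConst_pos s).ne', ?_⟩
  intro δ hδ
  have hlim : Tendsto (fun N : ℝ => 2 * κ * A * (N - 1) ^ s) atTop (𝓝 0) := by
    have h1 : Tendsto (fun x : ℝ => x ^ s) atTop (𝓝 0) := by
      simpa using tendsto_rpow_neg_atTop (neg_pos.2 hs)
    have h2 := (h1.comp (tendsto_atTop_add_const_right atTop (-1) tendsto_id)).const_mul
      (2 * κ * A)
    simpa [sub_eq_add_neg] using h2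
  obtain ⟨N, hN1, hN2⟩ := ((eventually_ofReal_mul_lt hlim hδ).and (eventually_ge_atTop 3)).exists
  obtain ⟨v₀, v, hv, hv0, hvt⟩ := key A N Λ t T (T + 1) s hA0.le hN2 ht0.le t2 hΛ0 t1 (by linarith)
    hs.le (fun n ξ _ => (hm ξ).trans (le_mul_of_one_le_right hΛ0
      (by linarith [Nat.cast_nonneg (α := ℝ) n]))) (by rw [← hρ]; nlinarith) hA1
    (fun ξ ζ hξ hζ => by
      have h1 : |‖ξ‖ - ‖ζ‖| ≤ 2 := by
        rw [abs_le] at *; constructor <;> linarith [hξ.1, hξ.2, hζ.1, hζ.2]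
      have h2 := mul_le_mul_of_nonneg_right (hL ξ ζ h1) ht0.le
      linarith)
  exact ⟨v₀, v, hv, hv0.trans_lt hN1, t, ⟨ht0.le, t1⟩, hvt⟩

/-- The symbol of the regularized dispersion operators. -/
def disp (p q X : ℝ) : ℝ := (1 - p * X) / (1 + q * X)

lemma disp_mul {p q X : ℝ} (hq : 0 < q) (hX : 0 ≤ X) : (1 + q * X) * disp p q X = 1 - p * X := by
  have : 1 + q * X ≠ 0 := by positivity
  rw [disp]; field_simp

lemma le_disp {p q X l : ℝ} (hq : 0 < q) (hX : 0 ≤ X) (h1 : l ≤ 1) (h2 : l ≤ -p / q) :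
    l ≤ disp p q X := by
  rw [le_div_iff₀ hq] at h2
  rw [disp, le_div_iff₀ (by positivity)]
  nlinarith [mul_le_mul_of_nonneg_right h2 hX]

lemma disp_le {p q X u : ℝ} (hq : 0 < q) (hX : 0 ≤ X) (h1 : 1 ≤ u) (h2 : -p / q ≤ u) :
    disp p q X ≤ u := by
  rw [div_le_iff₀ hq] at h2
  rw [disp, div_le_iff₀ (by positivity)]
  nlinarith [mul_le_mul_of_nonneg_right h2 hX]

/-- The symbol tends to a constant at infinity, fast enough that its increments still have size `|r
- r'|` after multiplication by the frequency. This bounds the variation of the phase over a packet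
at arbitrarily high frequency. -/
lemma mul_abs_disp_sub_le {p q r r' : ℝ} (hq : 0 < q) (hr : 0 ≤ r) (hr' : 0 ≤ r') :
    r' * |disp p q (r ^ 2) - disp p q (r' ^ 2)| ≤ 2 * |p + q| / q * |r - r'| := by
  have h1 : 0 < 1 + q * r ^ 2 := by positivity
  have h2 : 0 < 1 + q * r' ^ 2 := by positivity
  have e : disp p q (r ^ 2) - disp p q (r' ^ 2) =
      (p + q) * (r - r') * -((r + r') / ((1 + q * r ^ 2) * (1 + q * r' ^ 2))) := by
    rw [disp, disp]; field_simp; ring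
  have h3 : r' * ((r + r') / ((1 + q * r ^ 2) * (1 + q * r' ^ 2))) ≤ 2 / q := by
    rw [← mul_div_assoc, div_le_div_iff₀ (by positivity) hq]
    have h4 : 0 ≤ q * (r - r') ^ 2 := by positivity
    have h5 : 0 ≤ q ^ 2 * r ^ 2 * r' ^ 2 := by positivity
    have h6 : 0 ≤ q * r ^ 2 := by positivity
    nlinarith
  have h7 : 0 ≤ (r + r') / ((1 + q * r ^ 2) * (1 + q * r' ^ 2)) := by positivity
  rw [e, abs_mul, abs_mul, abs_neg, abs_of_nonneg h7]
  calc r' * (|p + q| * |r - r'| * ((r + r') / ((1 + q * r ^ 2) * (1 + q * r' ^ 2))))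
      = |p + q| * |r - r'| * (r' * ((r + r') / ((1 + q * r ^ 2) * (1 + q * r' ^ 2)))) := by ring
    _ ≤ |p + q| * |r - r'| * (2 / q) := by gcongr
    _ = _ := by ring

/-- The generic regime. -/
lemma exists_isDispersion_generic (ha : a < 0) (hc : c < 0) (hb : 0 < b) (hd : 0 < d) :
    ∃ (μ lam : Plane → ℝ) (κ L : ℝ), IsDispersion a b c d μ lam κ ∧
      ∀ ξ ζ : Plane, |‖ξ‖ - ‖ζ‖| ≤ 2 → |lam ξ - lam ζ| ≤ L := by
  -- The symbols `w₁`, `w₂` interpolate between `1` at frequency zero and `-c / d`, `-a / b` at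
  -- infinity, hence lie between `l` and `u`. The signs of the coefficients give `l > 0`.
  -- Eliminating from the dispersion relations leads to `μ² = w₂ / w₁` and `lam = freq * √(w₁ w₂)`.
  set l : ℝ := min 1 (min (-a / b) (-c / d)) with hl
  set u : ℝ := max 1 (max (-a / b) (-c / d)) with hu
  have hl0 : 0 < l := lt_min one_pos (lt_min (div_pos (by linarith) hb) (div_pos (by linarith) hd))
  have hlu : l ≤ u := (min_le_left _ _).trans (le_max_left _ _)
  have hu0 : 0 < u := hl0.trans_le hlu
  set w₁ : Plane → ℝ := fun ξ => disp c d (freq ξ ^ 2) with hw₁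
  set w₂ : Plane → ℝ := fun ξ => disp a b (freq ξ ^ 2) with hw₂
  have l1 : ∀ ξ, l ≤ w₁ ξ := fun ξ => le_disp hd (sq_nonneg _) (min_le_left _ _)
    ((min_le_right _ _).trans (min_le_right _ _))
  have l2 : ∀ ξ, l ≤ w₂ ξ := fun ξ => le_disp hb (sq_nonneg _) (min_le_left _ _)
    ((min_le_right _ _).trans (min_le_left _ _))
  have u1 : ∀ ξ, w₁ ξ ≤ u := fun ξ => disp_le hd (sq_nonneg _) (le_max_left _ _)
    ((le_max_right _ _).trans (le_max_right _ _))
  have u2 : ∀ ξ, w₂ ξ ≤ u := fun ξ => disp_le hb (sq_nonneg _) (le_max_left _ _)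
    ((le_max_left _ _).trans (le_max_right _ _))
  have p1 : ∀ ξ, 0 < w₁ ξ := fun ξ => hl0.trans_le (l1 ξ)
  have p2 : ∀ ξ, 0 < w₂ ξ := fun ξ => hl0.trans_le (l2 ξ)
  set μ : Plane → ℝ := fun ξ => √(w₂ ξ / w₁ ξ) with hμ
  have hμ2 : ∀ ξ, μ ξ ^ 2 = w₂ ξ / w₁ ξ := fun ξ => Real.sq_sqrt (div_pos (p2 ξ) (p1 ξ)).le
  have hμ0 : ∀ ξ, 0 ≤ μ ξ := fun ξ => Real.sqrt_nonneg _
  have hσ : ∀ ξ, (w₁ ξ * μ ξ) ^ 2 = w₁ ξ * w₂ ξ := fun ξ => by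
    rw [mul_pow, hμ2]; have := (p1 ξ).ne'; field_simp
  have mf : Measurable freq := continuous_freq.measurable
  have mw₁ : Measurable w₁ := by simp only [hw₁, disp]; fun_prop
  have mw₂ : Measurable w₂ := by simp only [hw₂, disp]; fun_prop
  have mμ : Measurable μ := (mw₂.div mw₁).sqrt
  have hκ : 1 ≤ u / l := by rw [le_div_iff₀ hl0]; linarith
  refine ⟨μ, fun ξ => freq ξ * (w₁ ξ * μ ξ), u / l, 4 * Real.pi * u +
    u / (2 * l) * ((2 * |c + d| / d + 2 * |a + b| / b) * (4 * Real.pi)), ⟨hb.le, hd.le, hκ, mμ,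
    mf.mul (mw₁.mul mμ), fun ξ => ?_, fun ξ => ?_, fun ξ => ?_, fun ξ => ?_, fun ξ => ?_,
    fun ξ => ?_⟩, fun ξ ζ hξζ => ?_⟩
  · simp [hμ, hw₁, hw₂]
  · simp [hμ, hw₁, hw₂]
  · refine Real.le_sqrt_of_sq_le ?_
    have h1 : (u / l)⁻¹ ≤ 1 := inv_le_one_of_one_le₀ hκ
    have h0 : 0 ≤ (u / l)⁻¹ := by positivity
    have h2 : (u / l)⁻¹ ≤ w₂ ξ / w₁ ξ := by
      rw [inv_div]; exact div_le_div₀ (p2 ξ).le (l2 ξ) (p1 ξ) (u1 ξ)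
    nlinarith
  · refine Real.sqrt_le_iff.2 ⟨by positivity, ?_⟩
    have h2 : w₂ ξ / w₁ ξ ≤ u / l := div_le_div₀ hu0.le (u2 ξ) hl0 (l1 ξ)
    nlinarith
  · have e1 := disp_mul (p := a) hb (sq_nonneg (freq ξ))
    have e2 : w₁ ξ * μ ξ ^ 2 = w₂ ξ := by rw [hμ2]; have := (p1 ξ).ne'; field_simp
    calc (1 + b * freq ξ ^ 2) * (freq ξ * (w₁ ξ * μ ξ)) * μ ξ =
        freq ξ * ((1 + b * freq ξ ^ 2) * (w₁ ξ * μ ξ ^ 2)) := by ring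
      _ = freq ξ * (1 - a * freq ξ ^ 2) := by rw [e2]; exact congrArg _ e1
  · have e1 := disp_mul (p := c) hd (sq_nonneg (freq ξ))
    calc (1 + d * freq ξ ^ 2) * (freq ξ * (w₁ ξ * μ ξ)) =
        freq ξ * ((1 + d * freq ξ ^ 2) * w₁ ξ) * μ ξ := by ring
      _ = freq ξ * (1 - c * freq ξ ^ 2) * μ ξ := by
        rw [show (1 + d * freq ξ ^ 2) * w₁ ξ = 1 - c * freq ξ ^ 2 from e1]
  · set σ : Plane → ℝ := fun ξ => w₁ ξ * μ ξ with hσdef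
    have hσ0 : ∀ ξ, 0 ≤ σ ξ := fun ξ => mul_nonneg (p1 ξ).le (hμ0 ξ)
    have hσl : ∀ ξ, l ≤ σ ξ := fun ξ => abs_le_of_sq_le_sq' (by
      rw [hσ]; nlinarith [l1 ξ, l2 ξ]) (hσ0 ξ) |>.2
    have hσu : ∀ ξ, σ ξ ≤ u := fun ξ => abs_le_of_sq_le_sq' (by
      rw [hσ]; nlinarith [u1 ξ, u2 ξ, p1 ξ, p2 ξ]) hu0.le |>.2
    have hr : |freq ξ - freq ζ| ≤ 4 * Real.pi := by
      rw [freq, freq, ← mul_sub, abs_mul, abs_of_pos (by positivity)]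
      nlinarith [Real.pi_pos]
    have k1 := mul_abs_disp_sub_le (p := c) hd (freq_nonneg ξ) (freq_nonneg ζ)
    have k2 := mul_abs_disp_sub_le (p := a) hb (freq_nonneg ξ) (freq_nonneg ζ)
    -- The square root `σ` of `w₁ w₂` is removed by the difference of squares; `σ ≥ l` allows
    -- division by the sum.
    have k3 : (σ ξ - σ ζ) * (σ ξ + σ ζ) = w₁ ξ * (w₂ ξ - w₂ ζ) + w₂ ζ * (w₁ ξ - w₁ ζ) := by
      have i1 := hσ ξ
      have i2 := hσ ζ
      simp only [hσdef]
      linear_combination i1 - i2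
    have k4 : |σ ξ - σ ζ| * (2 * l) ≤ u * (|w₂ ξ - w₂ ζ| + |w₁ ξ - w₁ ζ|) := by
      calc |σ ξ - σ ζ| * (2 * l) ≤ |σ ξ - σ ζ| * (σ ξ + σ ζ) := by
            gcongr; linarith [hσl ξ, hσl ζ]
        _ = |w₁ ξ * (w₂ ξ - w₂ ζ) + w₂ ζ * (w₁ ξ - w₁ ζ)| := by
            rw [← k3, abs_mul, abs_of_nonneg (add_nonneg (hσ0 ξ) (hσ0 ζ))]
        _ ≤ w₁ ξ * |w₂ ξ - w₂ ζ| + w₂ ζ * |w₁ ξ - w₁ ζ| := by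
            refine (abs_add_le _ _).trans (le_of_eq ?_)
            rw [abs_mul, abs_mul, abs_of_pos (p1 ξ), abs_of_pos (p2 ζ)]
        _ ≤ u * |w₂ ξ - w₂ ζ| + u * |w₁ ξ - w₁ ζ| := by
            gcongr
            · exact u1 ξ
            · exact u2 ζ
        _ = _ := by ring
    have k5 : freq ζ * |σ ξ - σ ζ| ≤
        u / (2 * l) * ((2 * |c + d| / d + 2 * |a + b| / b) * (4 * Real.pi)) := by
      rw [div_mul_eq_mul_div, le_div_iff₀ (by positivity)]
      calc freq ζ * |σ ξ - σ ζ| * (2 * l) = freq ζ * (|σ ξ - σ ζ| * (2 * l)) := by ring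
        _ ≤ freq ζ * (u * (|w₂ ξ - w₂ ζ| + |w₁ ξ - w₁ ζ|)) :=
            mul_le_mul_of_nonneg_left k4 (freq_nonneg ζ)
        _ = u * (freq ζ * |w₁ ξ - w₁ ζ| + freq ζ * |w₂ ξ - w₂ ζ|) := by ring
        _ ≤ u * (2 * |c + d| / d * |freq ξ - freq ζ| + 2 * |a + b| / b * |freq ξ - freq ζ|) :=
            mul_le_mul_of_nonneg_left (add_le_add k1 k2) hu0.le
        _ = u * ((2 * |c + d| / d + 2 * |a + b| / b) * |freq ξ - freq ζ|) := by ring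
        _ ≤ _ := by gcongr
    have k6 : freq ξ * σ ξ - freq ζ * σ ζ =
        (freq ξ - freq ζ) * σ ξ + freq ζ * (σ ξ - σ ζ) := by ring
    calc |freq ξ * σ ξ - freq ζ * σ ζ| ≤ |freq ξ - freq ζ| * σ ξ + freq ζ * |σ ξ - σ ζ| := by
          rw [k6]
          refine (abs_add_le _ _).trans (le_of_eq ?_)
          rw [abs_mul (freq ξ - freq ζ), abs_mul (freq ζ), abs_of_nonneg (hσ0 ξ),
            abs_of_nonneg (freq_nonneg ζ)]
      _ ≤ 4 * Real.pi * u + _ :=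
          add_le_add (mul_le_mul hr (hσu ξ) (hσ0 ξ) (by positivity)) k5

/-- The BBM-BBM regime. -/
lemma isDispersion_bbm (hb : 0 < b) :
    IsDispersion 0 b 0 b (fun _ => 1) (fun ξ => freq ξ / (1 + b * freq ξ ^ 2)) 1 := by
  have mf : Measurable freq := continuous_freq.measurable
  have hne : ∀ ξ, 1 + b * freq ξ ^ 2 ≠ 0 := fun ξ => by positivity
  refine ⟨hb.le, hb.le, le_rfl, measurable_const, by fun_prop, fun ξ => rfl, fun ξ => by simp,
    fun ξ => by simp, fun ξ => le_rfl, fun ξ => ?_, fun ξ => ?_⟩ <;>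
  · have := hne ξ
    field_simp; ring

/-- The KdV-KdV regime. -/
lemma isDispersion_kdv (c : ℝ) :
    IsDispersion c 0 c 0 (fun _ => 1) (fun ξ => freq ξ * (1 - c * freq ξ ^ 2)) 1 := by
  have mf : Measurable freq := continuous_freq.measurable
  refine ⟨le_rfl, le_rfl, le_rfl, measurable_const, by fun_prop, fun ξ => rfl, fun ξ => by simp,
    fun ξ => by simp, fun ξ => le_rfl, fun ξ => ?_, fun ξ => ?_⟩ <;> ring

/-- With `N = M ^ 2`, `A = M ^ 3` and `t = k / M ^ 6`, the growth `A ^ 2 * t = k` is fixed, the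
phases of order `N ^ 3` stay coherent up to time `t`, and the ratio of the series is of order `N * t
* A`, that is, `1 / M`. The datum has size `M ^ (3 + 2 * s)`. Writing `N` as a square avoids
fractional powers. -/
lemma localFlowDiscontinuous_kdv (hc : 0 < c) {s : ℝ} (hs : s < -3 / 2) :
    LocalFlowDiscontinuous c 0 c 0 s := by
  have h := isDispersion_kdv c
  obtain ⟨c₁, hc₁, θ₀, hθ₀, hθ₀', t₀, ht₀, key⟩ :=
    h.exists_flow (Or.inr ⟨rfl, hc, rfl, rfl⟩)
  have hV := discArea_pos
  -- The reciprocal of twice the constant in the bound of `lam` by `M ^ 6` on the packet.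
  set k : ℝ := 1 / (2 * (1 + |c|) * (1 + 4 * Real.pi) ^ 3) with hk
  have hk0 : 0 < k := by positivity
  refine ⟨ENNReal.ofReal (c₁ * k) * lowConst s,
    ENNReal.mul_pos (ENNReal.ofReal_pos.2 (by positivity)).ne' (lowConst_pos s).ne', ?_⟩
  intro T hT δ hδ
  have hlim : Tendsto (fun M : ℝ => 2 * 1 * M ^ 3 * (M ^ 2 - 1) ^ s) atTop (𝓝 0) := by
    have h1 : Tendsto (fun x : ℝ => x ^ (3 + 2 * s)) atTop (𝓝 0) := by
      simpa using tendsto_rpow_neg_atTop (y := -(3 + 2 * s)) (by linarith)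
    have h2 := (h1.comp (tendsto_id.atTop_div_const (by norm_num : (0 : ℝ) < 2))).const_mul 16
    rw [mul_zero] at h2
    refine tendsto_of_tendsto_of_tendsto_of_le_of_le' tendsto_const_nhds h2 ?_ ?_
    · filter_upwards [eventually_ge_atTop 2] with M hM
      have := Real.rpow_nonneg (by nlinarith : 0 ≤ M ^ 2 - 1) s
      positivity
    · filter_upwards [eventually_ge_atTop 2] with M hM
      have h3 : (M ^ 2 - 1) ^ s ≤ ((M / 2) ^ 2) ^ s :=
        Real.rpow_le_rpow_of_nonpos (by positivity) (by nlinarith) (by linarith)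
      have h4 : ((M / 2) ^ 2) ^ s = (M / 2) ^ (2 * s) := by
        rw [Real.rpow_mul (by positivity), Real.rpow_two]
      have h5 : (M / 2) ^ (3 + 2 * s) = (M / 2) ^ 3 * (M / 2) ^ (2 * s) := by
        rw [Real.rpow_add (by positivity)]; norm_cast
      calc 2 * 1 * M ^ 3 * (M ^ 2 - 1) ^ s ≤ 2 * 1 * M ^ 3 * (M / 2) ^ (2 * s) := by
            rw [← h4]; gcongr
        _ = 16 * (M / 2) ^ (3 + 2 * s) := by rw [h5]; ring
  have hinv : Tendsto (fun M : ℝ => M⁻¹) atTop (𝓝 0) := tendsto_inv_atTop_zero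
  obtain ⟨M, ⟨⟨⟨hM1, hM2⟩, hM3⟩, hM4⟩, hM5⟩ := ((((eventually_ofReal_mul_lt hlim hδ).and
    (eventually_ge_atTop 2)).and (hinv.eventually_lt_const (show (0 : ℝ) < t₀ / k by positivity))).and
    (hinv.eventually_lt_const (show (0 : ℝ) < T / k by positivity))).and
    (hinv.eventually_lt_const (show (0 : ℝ) < θ₀ / (4096 * Real.pi * k * discArea) by positivity))
    |>.exists
  have hM0 : 0 < M := by linarith
  set t : ℝ := k / M ^ 6 with ht
  have htpos : 0 < t := by positivity
  have htM : t ≤ k * M⁻¹ := by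
    rw [ht, ← div_eq_mul_inv]
    gcongr
    exact le_self_pow₀ (by linarith) (by norm_num)
  have t1 : t ≤ t₀ := htM.trans (by
    rw [lt_div_iff₀ hk0] at hM3; linarith)
  have t2 : t ≤ T := htM.trans (by
    rw [lt_div_iff₀ hk0] at hM4; linarith)
  have hMsq : 4 ≤ M ^ 2 := by nlinarith
  set Λ : ℝ := 4 * Real.pi * (M ^ 2 + 1) with hΛ
  -- Proved at time `2 * t`, so that the series converges on an interval strictly longer than `[0,
  -- t]`.
  have hθ : 4 * rate (Bool × Fin 2) 1 Λ * (2 * t) * (2 * M ^ 3 * discArea) ≤ θ₀ := by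
    have e : rate (Bool × Fin 2) 1 Λ = 32 * Λ := by simp [rate]; norm_num
    rw [lt_div_iff₀ (by positivity)] at hM5
    calc 4 * rate (Bool × Fin 2) 1 Λ * (2 * t) * (2 * M ^ 3 * discArea) =
        2048 * Real.pi * k * discArea * ((M ^ 2 + 1) * (M ^ 3 / M ^ 6)) := by
          rw [e, hΛ, ht]; ring
      _ = 2048 * Real.pi * k * discArea * ((M ^ 2 + 1) * (M⁻¹ / M ^ 2)) := by
          congr 2; field_simp
      _ ≤ 2048 * Real.pi * k * discArea * ((M ^ 2 + M ^ 2) * (M⁻¹ / M ^ 2)) := by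
          gcongr; linarith
      _ = M⁻¹ * (4096 * Real.pi * k * discArea) := by field_simp; ring
      _ ≤ θ₀ := hM5.le
  have hrate0 : 0 ≤ rate (Bool × Fin 2) 1 Λ := by unfold rate; positivity
  have hθ' : 4 * rate (Bool × Fin 2) 1 Λ * t * (2 * M ^ 3 * discArea) ≤ θ₀ := by
    refine le_trans ?_ hθ
    gcongr
    linarith
  have hbound : ∀ (n : ℕ) (ξ : Plane), ‖ξ‖ ≤ (n + 2) * (M ^ 2 + 1) →
      waveBound 0 0 1 ξ ≤ Λ * (n + 2) := fun n ξ hξ => by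
    refine (h.waveBound_le ξ).trans ?_
    rw [freq, hΛ]
    nlinarith [mul_le_mul_of_nonneg_left hξ (by positivity : 0 ≤ 4 * Real.pi)]
  have hphase : ∀ ξ ζ : Plane, |‖ξ‖ - M ^ 2| ≤ 1 → |‖ζ‖ - M ^ 2| ≤ 1 →
      |freq ξ * (1 - c * freq ξ ^ 2) - freq ζ * (1 - c * freq ζ ^ 2)| * t ≤ 1 := by
    intro ξ ζ hξ hζ
    -- No difference is exploited: each phase is itself at most `1 / (2 * t)`.
    have hb : ∀ ξ : Plane, |‖ξ‖ - M ^ 2| ≤ 1 → |freq ξ * (1 - c * freq ξ ^ 2)| ≤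
        (1 + |c|) * (1 + 4 * Real.pi) ^ 3 * M ^ 6 := fun ξ hξ => by
      have i1 : ‖ξ‖ ≤ M ^ 2 + 1 := by linarith [(abs_le.1 hξ).2]
      refine (h.abs_lam_le_of_norm_le i1).trans ?_
      have i2 : 1 + 2 * Real.pi * (M ^ 2 + 1) ≤ (1 + 4 * Real.pi) * M ^ 2 := by
        nlinarith [Real.pi_pos]
      calc 1 * (1 + |c|) * (1 + 2 * Real.pi * (M ^ 2 + 1)) ^ 3
          ≤ 1 * (1 + |c|) * ((1 + 4 * Real.pi) * M ^ 2) ^ 3 := by gcongr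
        _ = _ := by ring
    calc |freq ξ * (1 - c * freq ξ ^ 2) - freq ζ * (1 - c * freq ζ ^ 2)| * t
        ≤ ((1 + |c|) * (1 + 4 * Real.pi) ^ 3 * M ^ 6 +
          (1 + |c|) * (1 + 4 * Real.pi) ^ 3 * M ^ 6) * t := by
          gcongr
          exact (abs_sub _ _).trans (add_le_add (hb ξ hξ) (hb ζ hζ))
      _ = 1 := by rw [ht, hk]; field_simp; ring
  obtain ⟨v₀, v, hv, hv0, hvt⟩ := key (M ^ 3) (M ^ 2) Λ t t (2 * t) s (by positivity)
    (by linarith) htpos.le t1 (by positivity) le_rfl (by linarith) (by linarith) hbound hθ'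
    (hθ.trans hθ₀') hphase
  refine ⟨t, ⟨htpos, t2⟩, v₀, v, hv, hv0.trans_lt hM1, t, ⟨htpos.le, le_rfl⟩, ?_⟩
  rwa [show (M ^ 3) ^ 2 * t = k by rw [ht]; field_simp] at hvt

end Boussinesq

end

theorem theorem2 :
    -- generic regime
    (∀ a b c d s : ℝ, a < 0 → c < 0 → 0 < b → 0 < d → s < -1 / 2 →
      ∀ T : ℝ, 0 < T → Boussinesq.FlowDiscontinuousOn a b c d s T) ∧
    -- KdV-KdV regime
    (∀ s : ℝ, s < -3 / 2 →
      Boussinesq.LocalFlowDiscontinuous (1 / 6) 0 (1 / 6) 0 s) ∧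
    -- BBM-BBM regime
    (∀ s : ℝ, s < 0 →
      ∀ T : ℝ, 0 < T → Boussinesq.FlowDiscontinuousOn 0 (1 / 6) 0 (1 / 6) s T) := by
  refine ⟨fun a b c d s ha hc hb hd hs T hT => ?_, fun s hs => ?_, fun s hs T hT => ?_⟩
  · obtain ⟨μ, lam, κ, L, h, hL⟩ := Boussinesq.exists_isDispersion_generic ha hc hb hd
    exact h.flowDiscontinuousOn (Or.inl ⟨ha.le, hc.le, hb, hd⟩) hb hd hL (by linarith) hT
  · exact Boussinesq.localFlowDiscontinuous_kdv (by norm_num) hs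
  · have hb : (0 : ℝ) < 1 / 6 := by norm_num
    have h0 : ∀ ξ, 0 ≤ Boussinesq.freq ξ / (1 + 1 / 6 * Boussinesq.freq ξ ^ 2) := fun ξ =>
      div_nonneg (Boussinesq.freq_nonneg ξ) (by positivity)
    -- Here the phase itself lies between `0` and `1 + 1 / (1 / 6)`, so its variation needs no
    -- separate estimate.
    refine (Boussinesq.isDispersion_bbm hb).flowDiscontinuousOn
      (Or.inl ⟨le_rfl, le_rfl, hb, hb⟩) hb hb (L := 1 + 1 / (1 / 6)) (fun ξ ζ _ => ?_) hs hT
    have h1 := Boussinesq.freq_div_le hb ξ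
    have h2 := Boussinesq.freq_div_le hb ζ
    rw [abs_le]
    constructor <;> linarith [h0 ξ, h0 ζ]
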